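/- **Conventions.** Monoidal categories and functors are strict. A *CD-category* is a symmetric monoidal category in which every object carries a commutative comonoid (copy, delete) compatible with $\otimes$; a *hypergraph category* is a CD-category in which every object also carries a commutative monoid (compare, omni) compatible with $\otimes$, such that monoid and comonoid form a special Frobenius algebra. *CD-functors* and *hypergraph functors* are the strict symmetric monoidal functors preserving this structure. Fix a set $A$. $\mathsf{Mat}$ is the hypergraph category whose objects are finite sets of words over $A$, all words of one set having the same length, with concatenation as tensor product, and whose morphisms $X\to Y$ are the functions $Y\times X\to\mathbb{R}^{\ge 0}$, composed as matrices; copy, delete, compare and omni are the usual $0/1$-matrices. $\mathsf{FinStoch}\subseteq\mathsf{Mat}$ is the CD-subcategory of stochastic matrices, $q\colon\mathsf{Mat}\to\mathsf{FinProjStoch}$ is the quotient identifying $f$ with $\lambda f$ for every $\lambda>0$, and $i\colon \mathsf{FinStoch}\to\mathsf{FinProjStoch}$ is the restriction of $q$. **Graphs.** $\mathsf{ODAG}$ is the category of finite ordered DAGs (a finite directed graph with a total order on its vertices such that $v\to w$ implies $v<w$), and $\mathsf{OUGr}$ that of finite simple undirected graphs with a total order on the vertices. Morphisms in both are maps of vertices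 that are monotone ($v\le w$ implies $\alpha(v)\le\alpha(w)$) and send each edge to an edge or collapse its two ends to one vertex. The *triangulation* $\mathrm{tr}(\mathcal H)$ of $\mathcal H\in\mathsf{OUGr}$ is the ordered DAG with the same ordered vertices in which $v\to w$ if and only if $v<w$ and there is a path $v - w_1 - \cdots - w_n=w$ in $\mathcal H$, $n\ge 1$, with $w_i\ge w$ for all $i$. **Syntax.** For an ordered DAG $\mathcal G$, $\mathsf{CDSyn}_{\mathcal G}$ is the free CD-category with the vertices as generating objects and one generator $\mathrm{pa}(v)\to v$ for each vertex $v$. For $\mathcal H\in \mathsf{OUGr}$, $\mathsf{Syn}_{\mathcal H}$ is the free hypergraph category with the vertices as generating objects and one generator $I\to C$ for each nonempty clique $C$ (words of vertices are in ascending order). $\mathsf{CDSyn}_\bullet$ and $\mathsf{Syn}_\bullet$ are the free CD-category and the free hypergraph category on one object $\bullet$ and one generator $s\colon I\to\bullet$. Let $\star\colon\mathsf{CDSyn}_\bullet\to\mathsf{Syn}_\bullet$ be the CD-functor with $\bullet\mapsto\bullet$, $s\mapsto s$. The CD-functor $!_{\mathcal G}\colon \mathsf{CDSyn}_\bullet\to\mathsf{CDSyn}_{\mathcal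 G}$ sends $\bullet$ to the product of all vertices and $s$ to the copy-composition of all generators (in ascending order of the vertices, each generator is applied to copies of the outputs of the earlier ones). The hypergraph functor $!_{\mathcal H}\colon \mathsf{Syn}_\bullet\to\mathsf{Syn}_{\mathcal H}$ sends $\bullet$ to the product of all vertices and $s$ to the compare-composition of all generators (their tensor product, with all occurrences of each vertex compared). **Networks.** An object of $\mathsf{BN}$ is a pair $(\omega,\mathcal G)$ of a CD-functor $\omega\colon\mathsf{CDSyn}_\bullet\to\mathsf{FinStoch}$ and an ordered DAG $\mathcal G$ such that $\omega=F\circ{!_{\mathcal G}}$ for some CD-functor $F\colon\mathsf{CDSyn}_{\mathcal G}\to\mathsf{FinStoch}$. An object of $\mathsf{MN}$ is a pair $(\omega,\mathcal H)$ of such an $\omega$ and an $\mathcal H\in\mathsf{OUGr}$ such that $i\circ\omega=q\circ\Phi\circ{!_{\mathcal H}}\circ\star$ for some hypergraph functor $\Phi\colon\mathsf{Syn}_{\mathcal H}\to\mathsf{Mat}$. In both categories, a morphism from $(\omega,\mathcal K)$ to $(\omega',\mathcal K')$ is a pair $(\alpha,\eta)$ of a morphism of graphs $\alpha\colon\mathcal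 K'\to\mathcal K$ (in $\mathsf{ODAG}$, respectively $\mathsf{OUGr}$) and a family of stochastic matrices $\eta_X\colon\omega(X)\to\omega'(X)$, $X\in \mathsf{CDSyn}_\bullet$, with $\eta_{X\otimes Y}=\eta_X\otimes\eta_Y$, $\eta_I=\mathrm{id}$ and $\eta_\bullet\circ\omega(s)=\omega'(s)$; composition is component-wise. **Theorem.** There is a functor $\mathrm{tr}\colon\mathsf{MN}\to\mathsf{BN}$ which sends each object $(\omega,\mathcal H)$ to $(\omega,\mathrm{tr}(\mathcal H))$ and each morphism $(\alpha,\eta)$ to $(\alpha,\eta)$, that is, to the same map of vertices and the same family $\eta$. -/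

import Mathlib

open CategoryTheory MonoidalCategory
open scoped NNReal

universe u v w u₁ v₁ u₂ v₂

namespace PGM

/-! ### Strict CD-categories, strict hypergraph categories and their functors -/

/-- A monoidal category is strict: the coherence isomorphisms are identities (transported along
equalities of objects). -/
class IsStrict (C : Type u) [Category.{v} C] [MonoidalCategory C] : Prop where
  tensor_assoc : ∀ X Y Z : C, (X ⊗ Y) ⊗ Z = X ⊗ (Y ⊗ Z)
  unit_tensor : ∀ X : C, 𝟙_ C ⊗ X = X
  tensor_unit : ∀ X : C, X ⊗ 𝟙_ C = X
  associator_eq : ∀ X Y Z : C, (α_ X Y Z).hom = eqToHom (tensor_assoc X Y Z)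
  leftUnitor_eq : ∀ X : C, (λ_ X).hom = eqToHom (unit_tensor X)
  rightUnitor_eq : ∀ X : C, (ρ_ X).hom = eqToHom (tensor_unit X)

/-- The copy map of an object of a CD-category. -/
abbrev copy {C : Type u} [Category.{v} C] [MonoidalCategory C] [CopyDiscardCategory C] (X : C) :
    X ⟶ X ⊗ X := (CopyDiscardCategory.comonObj X).comul

/-- The delete map of an object of a CD-category. -/
abbrev del {C : Type u} [Category.{v} C] [MonoidalCategory C] [CopyDiscardCategory C] (X : C) :
    X ⟶ 𝟙_ C := (CopyDiscardCategory.comonObj X).counit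

/-- A hypergraph category: a CD-category in which every object also carries a commutative monoid
(`compare`, `omni`), compatible with the monoidal structure, and such that monoid and comonoid
form a special Frobenius algebra. -/
class HypergraphCategory (C : Type u) [Category.{v} C] [MonoidalCategory C]
    [CopyDiscardCategory C] where
  compare : ∀ X : C, X ⊗ X ⟶ X
  omni : ∀ X : C, 𝟙_ C ⟶ X
  omni_compare : ∀ X : C, omni X ▷ X ≫ compare X = (λ_ X).hom
  compare_omni : ∀ X : C, X ◁ omni X ≫ compare X = (ρ_ X).hom
  compare_assoc : ∀ X : C,
    compare X ▷ X ≫ compare X = (α_ X X X).hom ≫ X ◁ compare X ≫ compare X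
  compare_comm : ∀ X : C, (β_ X X).hom ≫ compare X = compare X
  compare_tensor : ∀ X Y : C,
    compare (X ⊗ Y) = tensorμ X Y X Y ≫ (compare X ⊗ₘ compare Y)
  omni_tensor : ∀ X Y : C, omni (X ⊗ Y) = (λ_ (𝟙_ C)).inv ≫ (omni X ⊗ₘ omni Y)
  compare_unit : compare (𝟙_ C) = (λ_ (𝟙_ C)).hom
  omni_unit : omni (𝟙_ C) = 𝟙 (𝟙_ C)
  special : ∀ X : C, copy X ≫ compare X = 𝟙 X
  frobenius_left : ∀ X : C,
    copy X ▷ X ≫ (α_ X X X).hom ≫ X ◁ compare X = compare X ≫ copy X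
  frobenius_right : ∀ X : C,
    X ◁ copy X ≫ (α_ X X X).inv ≫ compare X ▷ X = compare X ≫ copy X

/-- A CD-functor: a strict symmetric monoidal functor preserving copy and delete. -/
structure CDFunctor (C : Type u₁) [Category.{v₁} C] [MonoidalCategory C] [CopyDiscardCategory C]
    (D : Type u₂) [Category.{v₂} D] [MonoidalCategory D] [CopyDiscardCategory D]
    extends C ⥤ D where
  obj_unit : obj (𝟙_ C) = 𝟙_ D
  obj_tensor : ∀ X Y : C, obj (X ⊗ Y) = obj X ⊗ obj Y
  map_tensor : ∀ {X Y Z W : C} (f : X ⟶ Y) (g : Z ⟶ W),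
    map (f ⊗ₘ g) =
      eqToHom (obj_tensor X Z) ≫ (map f ⊗ₘ map g) ≫ eqToHom (obj_tensor Y W).symm
  map_braiding : ∀ X Y : C,
    map (β_ X Y).hom =
      eqToHom (obj_tensor X Y) ≫ (β_ (obj X) (obj Y)).hom ≫ eqToHom (obj_tensor Y X).symm
  map_copy : ∀ X : C, map (copy X) = copy (obj X) ≫ eqToHom (obj_tensor X X).symm
  map_del : ∀ X : C, map (del X) = del (obj X) ≫ eqToHom obj_unit.symm

/-- A hypergraph functor: a CD-functor preserving compare and omni. -/
structure HypFunctor (C : Type u₁) [Category.{v₁} C] [MonoidalCategory C] [CopyDiscardCategory C]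
    [HypergraphCategory C]
    (D : Type u₂) [Category.{v₂} D] [MonoidalCategory D] [CopyDiscardCategory D]
    [HypergraphCategory D]
    extends CDFunctor C D where
  map_compare : ∀ X : C,
    map (HypergraphCategory.compare X) =
      eqToHom (obj_tensor X X) ≫ HypergraphCategory.compare (obj X)
  map_omni : ∀ X : C,
    map (HypergraphCategory.omni X) = eqToHom obj_unit ≫ HypergraphCategory.omni (obj X)

/-! ### Matrices with nonnegative entries -/

/-- An object of the category of matrices: a finite set of words over the alphabet `A`, all of the
same length `len`, so that concatenation of words gives the (strictly associative) cartesian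
product. -/
@[ext]
structure MatObj (A : Type u) where
  len : ℕ
  carrier : Finset (List A)
  length_eq : ∀ x ∈ carrier, x.length = len

/-- A matrix `X ⟶ Y`: a function `Y × X → ℝ≥0`, encoded by its extension by zero to all pairs
of words. The entry `f(y ∣ x)` is `f.entry y x`. -/
@[ext]
structure MatHom {A : Type u} (X Y : MatObj A) where
  entry : List A → List A → ℝ≥0
  entry_eq_zero : ∀ y x, ¬ (y ∈ Y.carrier ∧ x ∈ X.carrier) → entry y x = 0

namespace MatObj

variable {A : Type u}

open scoped Classical in
/-- The matrix of the function `φ` from `X` to `Y`. -/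
noncomputable def ofFun (X Y : MatObj A) (φ : List A → List A)
    (hφ : ∀ x ∈ X.carrier, φ x ∈ Y.carrier) : MatHom X Y where
  entry y x := if x ∈ X.carrier ∧ y = φ x then 1 else 0
  entry_eq_zero _ x h := if_neg fun ⟨h1, h2⟩ => h ⟨h2 ▸ hφ x h1, h1⟩

/-- The transpose of a matrix. -/
def _root_.PGM.MatHom.transpose {X Y : MatObj A} (f : MatHom X Y) : MatHom Y X where
  entry x y := f.entry y x
  entry_eq_zero x y h := f.entry_eq_zero y x fun h' => h h'.symm

open scoped Classical in
noncomputable instance category : Category (MatObj A) where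
  Hom X Y := MatHom X Y
  id X := ofFun X X id fun _ h => h
  comp {X Y Z} f g :=
    { entry := fun z x => ∑ y ∈ Y.carrier, g.entry z y * f.entry y x
      entry_eq_zero := fun z x h => Finset.sum_eq_zero fun _ _ => by
        by_cases hz : z ∈ Z.carrier
        · rw [f.entry_eq_zero _ x fun h' => h ⟨hz, h'.2⟩, mul_zero]
        · rw [g.entry_eq_zero z _ fun h' => hz h'.1, zero_mul] }
  id_comp {X Y} f := by
    refine MatHom.ext (funext fun y => funext fun x => ?_)
    by_cases hx : x ∈ X.carrier
    · change ∑ z ∈ X.carrier, f.entry y z * (if x ∈ X.carrier ∧ z = x then 1 else 0) = _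
      rw [Finset.sum_eq_single x (fun z _ hz => by simp [hz]) (fun h => absurd hx h)]
      simp [hx]
    · simp [ofFun, hx, f.entry_eq_zero y x (fun h => hx h.2)]
  comp_id {X Y} f := by
    refine MatHom.ext (funext fun y => funext fun x => ?_)
    by_cases hy : y ∈ Y.carrier
    · change ∑ z ∈ Y.carrier, (if z ∈ Y.carrier ∧ y = z then 1 else 0) * f.entry z x = _
      rw [Finset.sum_eq_single y (fun z _ hz => by simp [Ne.symm hz]) (fun h => absurd hy h)]
      simp [hy]
    · have : ∀ z, ¬ (z ∈ Y.carrier ∧ y = z) := fun z => by aesop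
      simp [ofFun, this, f.entry_eq_zero y x (fun h => hy h.1)]
  assoc {W X Y Z} f g h := by
    refine MatHom.ext (funext fun z => funext fun x => ?_)
    simp only [Finset.mul_sum, Finset.sum_mul]
    rw [Finset.sum_comm]
    simp only [mul_assoc]

theorem comp_entry {X Y Z : MatObj A} (f : X ⟶ Y) (g : Y ⟶ Z) (z x : List A) :
    MatHom.entry (f ≫ g) z x = ∑ y ∈ Y.carrier, MatHom.entry g z y * MatHom.entry f y x := rfl

theorem hom_ext {X Y : MatObj A} {f g : X ⟶ Y}
    (h : ∀ y ∈ Y.carrier, ∀ x ∈ X.carrier, MatHom.entry f y x = MatHom.entry g y x) : f = g := by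
  apply MatHom.ext
  funext y x
  by_cases hyx : y ∈ Y.carrier ∧ x ∈ X.carrier
  · exact h y hyx.1 x hyx.2
  · rw [MatHom.entry_eq_zero f y x hyx, MatHom.entry_eq_zero g y x hyx]

open scoped Classical in
theorem ofFun_entry {X Y : MatObj A} {φ : List A → List A}
    {hφ : ∀ x ∈ X.carrier, φ x ∈ Y.carrier} {x : List A} (hx : x ∈ X.carrier) (y : List A) :
    (ofFun X Y φ hφ).entry y x = if y = φ x then 1 else 0 := by
  simp [ofFun, hx]

/-- Precomposition with the matrix of a function. -/
theorem ofFun_comp_entry {X Y Z : MatObj A} {φ : List A → List A}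
    {hφ : ∀ x ∈ X.carrier, φ x ∈ Y.carrier} (g : Y ⟶ Z) {x : List A} (hx : x ∈ X.carrier)
    (z : List A) :
    MatHom.entry ((show X ⟶ Y from ofFun X Y φ hφ) ≫ g) z x = MatHom.entry g z (φ x) := by
  rw [comp_entry, Finset.sum_eq_single (φ x)]
  · rw [ofFun_entry hx, if_pos rfl, mul_one]
  · intro y _ hy
    rw [ofFun_entry hx, if_neg hy, mul_zero]
  · intro h
    exact absurd (hφ x hx) h

/-- Postcomposition with the transposed matrix of a function. -/
theorem comp_transpose_entry {X Y Z : MatObj A} {φ : List A → List A}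
    {hφ : ∀ x ∈ Z.carrier, φ x ∈ Y.carrier} (f : X ⟶ Y) {z : List A} (hz : z ∈ Z.carrier)
    (x : List A) :
    MatHom.entry (f ≫ (show Y ⟶ Z from (ofFun Z Y φ hφ).transpose)) z x
      = MatHom.entry f (φ z) x := by
  rw [comp_entry, Finset.sum_eq_single (φ z)]
  · rw [MatHom.transpose, ofFun_entry hz, if_pos rfl, one_mul]
  · intro y _ hy
    rw [MatHom.transpose, ofFun_entry hz, if_neg hy, zero_mul]
  · intro h
    exact absurd (hφ z hz) h

theorem ofFun_comp_ofFun {X Y Z : MatObj A} {φ ψ : List A → List A}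
    {hφ : ∀ x ∈ X.carrier, φ x ∈ Y.carrier} {hψ : ∀ x ∈ Y.carrier, ψ x ∈ Z.carrier} :
    (show X ⟶ Y from ofFun X Y φ hφ) ≫ (show Y ⟶ Z from ofFun Y Z ψ hψ)
      = ofFun X Z (fun x => ψ (φ x)) (fun x hx => hψ _ (hφ x hx)) := by
  refine hom_ext fun z _ x hx => ?_
  rw [ofFun_comp_entry _ hx, ofFun_entry hx, ofFun_entry (hφ x hx)]

theorem ofFun_congr {X Y : MatObj A} {φ ψ : List A → List A}
    {hφ : ∀ x ∈ X.carrier, φ x ∈ Y.carrier} {hψ : ∀ x ∈ X.carrier, ψ x ∈ Y.carrier}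
    (h : ∀ x ∈ X.carrier, φ x = ψ x) : ofFun X Y φ hφ = ofFun X Y ψ hψ := by
  refine hom_ext (X := X) (Y := Y) fun z _ x hx => ?_
  rw [ofFun_entry hx, ofFun_entry hx, h x hx]

theorem eqToHom_eq {X Y : MatObj A} (h : X = Y) :
    eqToHom h = ofFun X Y id (fun x hx => by subst h; exact hx) := by
  subst h; rfl

/-- Invertible matrices from invertible functions. -/
noncomputable def isoOfFun {X Y : MatObj A} (φ ψ : List A → List A)
    (hφ : ∀ x ∈ X.carrier, φ x ∈ Y.carrier) (hψ : ∀ y ∈ Y.carrier, ψ y ∈ X.carrier)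
    (h1 : ∀ x ∈ X.carrier, ψ (φ x) = x) (h2 : ∀ y ∈ Y.carrier, φ (ψ y) = y) : X ≅ Y where
  hom := ofFun X Y φ hφ
  inv := ofFun Y X ψ hψ
  hom_inv_id := ofFun_comp_ofFun.trans (ofFun_congr h1)
  inv_hom_id := ofFun_comp_ofFun.trans (ofFun_congr h2)

theorem comp_iso_entry {X Y Z : MatObj A} {φ ψ : List A → List A}
    {hφ : ∀ x ∈ Y.carrier, φ x ∈ Z.carrier}
    (hψ : ∀ y ∈ Z.carrier, ψ y ∈ Y.carrier)
    (h1 : ∀ x ∈ Y.carrier, ψ (φ x) = x) (h2 : ∀ y ∈ Z.carrier, φ (ψ y) = y)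
    (f : X ⟶ Y) {z : List A} (hz : z ∈ Z.carrier) (x : List A) :
    MatHom.entry (f ≫ (show Y ⟶ Z from ofFun Y Z φ hφ)) z x = MatHom.entry f (ψ z) x := by
  rw [comp_entry, Finset.sum_eq_single (ψ z)]
  · rw [ofFun_entry (hψ z hz), if_pos (h2 z hz).symm, one_mul]
  · intro y hy hne
    rw [ofFun_entry hy, if_neg, zero_mul]
    rintro rfl
    exact hne (h1 y hy).symm
  · intro h
    exact absurd (hψ z hz) h

open scoped Classical in
/-- The monoidal product of objects: all concatenations of a word of `X` and a word of `Y`. -/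
noncomputable def tensor (X Y : MatObj A) : MatObj A where
  len := X.len + Y.len
  carrier := Finset.image₂ (· ++ ·) X.carrier Y.carrier
  length_eq := by
    intro x hx
    obtain ⟨a, ha, b, hb, rfl⟩ := Finset.mem_image₂.1 hx
    simp [X.length_eq a ha, Y.length_eq b hb]

/-- The monoidal unit: the set containing only the empty word. -/
def unit : MatObj A where
  len := 0
  carrier := {[]}
  length_eq := by simp

theorem mem_tensor {X Y : MatObj A} {z : List A} :
    z ∈ (tensor X Y).carrier ↔ ∃ x ∈ X.carrier, ∃ y ∈ Y.carrier, x ++ y = z := by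
  classical
  simp [tensor, Finset.mem_image₂]

theorem append_mem {X Y : MatObj A} {x y : List A} (hx : x ∈ X.carrier) (hy : y ∈ Y.carrier) :
    x ++ y ∈ (tensor X Y).carrier := mem_tensor.2 ⟨x, hx, y, hy, rfl⟩

theorem take_append {X : MatObj A} {x : List A} (hx : x ∈ X.carrier) (y : List A) :
    (x ++ y).take X.len = x := by
  rw [← X.length_eq x hx]; simp

theorem drop_append {X : MatObj A} {x : List A} (hx : x ∈ X.carrier) (y : List A) :
    (x ++ y).drop X.len = y := by
  rw [← X.length_eq x hx]; simp

theorem take_mem {X Y : MatObj A} {z : List A} (hz : z ∈ (tensor X Y).carrier) :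
    z.take X.len ∈ X.carrier := by
  obtain ⟨x, hx, y, hy, rfl⟩ := mem_tensor.1 hz
  rwa [take_append hx]

theorem drop_mem {X Y : MatObj A} {z : List A} (hz : z ∈ (tensor X Y).carrier) :
    z.drop X.len ∈ Y.carrier := by
  obtain ⟨x, hx, y, hy, rfl⟩ := mem_tensor.1 hz
  rwa [drop_append hx]

/-- The Kronecker product of matrices. -/
noncomputable def kron {X Y Z W : MatObj A} (f : MatHom X Y) (g : MatHom Z W) :
    MatHom (tensor X Z) (tensor Y W) where
  entry p q := f.entry (p.take Y.len) (q.take X.len) * g.entry (p.drop Y.len) (q.drop X.len)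
  entry_eq_zero p q h := by
    by_contra hne
    have h1 : p.take Y.len ∈ Y.carrier ∧ q.take X.len ∈ X.carrier := by
      by_contra h'
      exact hne (by rw [f.entry_eq_zero _ _ h', zero_mul])
    have h2 : p.drop Y.len ∈ W.carrier ∧ q.drop X.len ∈ Z.carrier := by
      by_contra h'
      exact hne (by rw [g.entry_eq_zero _ _ h', mul_zero])
    refine h ⟨?_, ?_⟩
    · rw [← List.take_append_drop Y.len p]; exact append_mem h1.1 h2.1
    · rw [← List.take_append_drop X.len q]; exact append_mem h1.2 h2.2

theorem kron_entry {X Y Z W : MatObj A} (f : MatHom X Y) (g : MatHom Z W) {y x : List A}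
    (hy : y ∈ Y.carrier) (hx : x ∈ X.carrier) (w z : List A) :
    (kron f g).entry (y ++ w) (x ++ z) = f.entry y x * g.entry w z := by
  simp only [kron, take_append hy, take_append hx, drop_append hy, drop_append hx]

theorem tensor_hom_ext {X Y : MatObj A} {Z : MatObj A} {f g : Z ⟶ tensor X Y}
    (h : ∀ x ∈ X.carrier, ∀ y ∈ Y.carrier, ∀ z ∈ Z.carrier,
      MatHom.entry f (x ++ y) z = MatHom.entry g (x ++ y) z) : f = g := by
  refine hom_ext fun p hp z hz => ?_
  obtain ⟨x, hx, y, hy, rfl⟩ := mem_tensor.1 hp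
  exact h x hx y hy z hz

theorem kron_ofFun {X Y Z W : MatObj A} {φ ψ : List A → List A}
    {hφ : ∀ x ∈ X.carrier, φ x ∈ Y.carrier} {hψ : ∀ x ∈ Z.carrier, ψ x ∈ W.carrier} :
    kron (ofFun X Y φ hφ) (ofFun Z W ψ hψ) =
      ofFun (tensor X Z) (tensor Y W) (fun q => φ (q.take X.len) ++ ψ (q.drop X.len))
        (fun _ hq => append_mem (hφ _ (take_mem hq)) (hψ _ (drop_mem hq))) := by
  refine hom_ext (X := tensor X Z) (Y := tensor Y W) fun p hp q hq => ?_
  obtain ⟨y, hy, w, hw, rfl⟩ := mem_tensor.1 hp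
  obtain ⟨x, hx, z, hz, rfl⟩ := mem_tensor.1 hq
  rw [kron_entry _ _ hy hx, ofFun_entry hq, ofFun_entry hx, ofFun_entry hz, take_append hx,
    drop_append hx]
  have : y ++ w = φ x ++ ψ z ↔ y = φ x ∧ w = ψ z :=
    ⟨fun h => List.append_inj h (by rw [Y.length_eq y hy, Y.length_eq _ (hφ x hx)]),
      fun h => by rw [h.1, h.2]⟩
  by_cases h1 : y = φ x <;> by_cases h2 : w = ψ z <;> simp [this, h1, h2]

theorem sum_tensor {X Y : MatObj A} (F : List A → ℝ≥0) :
    ∑ p ∈ (tensor X Y).carrier, F p = ∑ x ∈ X.carrier, ∑ y ∈ Y.carrier, F (x ++ y) := by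
  classical
  rw [← Finset.sum_product']
  simp only [tensor, ← Finset.image_uncurry_product]
  refine Finset.sum_image ?_
  rintro ⟨x, y⟩ h ⟨x', y'⟩ h' heq
  simp only [Finset.coe_product, Set.mem_prod, Finset.mem_coe] at h h'
  obtain ⟨h1, h2⟩ := List.append_inj heq
    ((X.length_eq x h.1).trans (X.length_eq x' h'.1).symm)
  exact Prod.ext h1 h2

theorem kron_comp {X₁ Y₁ Z₁ X₂ Y₂ Z₂ : MatObj A} (f₁ : X₁ ⟶ Y₁) (f₂ : X₂ ⟶ Y₂) (g₁ : Y₁ ⟶ Z₁)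
    (g₂ : Y₂ ⟶ Z₂) :
    (show tensor X₁ X₂ ⟶ tensor Y₁ Y₂ from kron f₁ f₂) ≫
      (show tensor Y₁ Y₂ ⟶ tensor Z₁ Z₂ from kron g₁ g₂) = kron (f₁ ≫ g₁) (f₂ ≫ g₂) := by
  refine hom_ext fun p hp q hq => ?_
  obtain ⟨y, hy, w, hw, rfl⟩ := mem_tensor.1 hp
  obtain ⟨x, hx, z, hz, rfl⟩ := mem_tensor.1 hq
  rw [comp_entry, sum_tensor, kron_entry _ _ hy hx, comp_entry, comp_entry,
    Finset.sum_mul_sum]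
  refine Finset.sum_congr rfl fun a ha => Finset.sum_congr rfl fun b hb => ?_
  rw [kron_entry _ _ hy ha, kron_entry _ _ ha hx]
  ring

theorem tensor_assoc_eq (X Y Z : MatObj A) :
    tensor (tensor X Y) Z = tensor X (tensor Y Z) := by
  ext1
  · exact Nat.add_assoc _ _ _
  · ext p
    simp only [mem_tensor]
    constructor
    · rintro ⟨_, ⟨x, hx, y, hy, rfl⟩, z, hz, rfl⟩
      exact ⟨x, hx, y ++ z, ⟨y, hy, z, hz, rfl⟩, by simp⟩
    · rintro ⟨x, hx, _, ⟨y, hy, z, hz, rfl⟩, rfl⟩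
      exact ⟨x ++ y, ⟨x, hx, y, hy, rfl⟩, z, hz, by simp⟩

theorem unit_tensor_eq (X : MatObj A) : tensor unit X = X := by
  ext1
  · exact Nat.zero_add _
  · ext p; simp [mem_tensor, unit]

theorem tensor_unit_eq (X : MatObj A) : tensor X unit = X := by
  ext1
  · exact Nat.add_zero _
  · ext p; simp [mem_tensor, unit]

noncomputable instance monoidalStruct : MonoidalCategoryStruct (MatObj A) where
  tensorObj := tensor
  tensorUnit := unit
  tensorHom f g := kron f g
  whiskerLeft X _ _ f := kron (𝟙 X) f
  whiskerRight f X := kron f (𝟙 X)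
  associator X Y Z := eqToIso (tensor_assoc_eq X Y Z)
  leftUnitor X := eqToIso (unit_tensor_eq X)
  rightUnitor X := eqToIso (tensor_unit_eq X)

theorem associator_hom (X Y Z : MatObj A) : (α_ X Y Z).hom =
    ofFun (tensor (tensor X Y) Z) (tensor X (tensor Y Z)) id
      (fun x hx => by rw [← tensor_assoc_eq]; exact hx) := eqToHom_eq (tensor_assoc_eq X Y Z)

theorem associator_inv (X Y Z : MatObj A) : (α_ X Y Z).inv =
    ofFun (tensor X (tensor Y Z)) (tensor (tensor X Y) Z) id
      (fun x hx => by rw [tensor_assoc_eq]; exact hx) := eqToHom_eq (tensor_assoc_eq X Y Z).symm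

theorem leftUnitor_hom (X : MatObj A) : (λ_ X).hom =
    ofFun (tensor unit X) X id (fun x hx => by rw [unit_tensor_eq] at hx; exact hx) :=
  eqToHom_eq (unit_tensor_eq X)

theorem leftUnitor_inv (X : MatObj A) : (λ_ X).inv =
    ofFun X (tensor unit X) id (fun x hx => by rw [unit_tensor_eq]; exact hx) :=
  eqToHom_eq (unit_tensor_eq X).symm

theorem rightUnitor_hom (X : MatObj A) : (ρ_ X).hom =
    ofFun (tensor X unit) X id (fun x hx => by rw [tensor_unit_eq] at hx; exact hx) :=
  eqToHom_eq (tensor_unit_eq X)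

theorem rightUnitor_inv (X : MatObj A) : (ρ_ X).inv =
    ofFun X (tensor X unit) id (fun x hx => by rw [tensor_unit_eq]; exact hx) :=
  eqToHom_eq (tensor_unit_eq X).symm

theorem kron_id (X Y : MatObj A) :
    kron (𝟙 X) (𝟙 Y) = 𝟙 (tensor X Y) :=
  kron_ofFun.trans (ofFun_congr fun x _ => List.take_append_drop X.len x)

theorem kron_assoc {X₁ X₂ X₃ Y₁ Y₂ Y₃ : MatObj A} (f₁ : MatHom X₁ Y₁) (f₂ : MatHom X₂ Y₂)
    (f₃ : MatHom X₃ Y₃) :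
    (kron (kron f₁ f₂) f₃).entry = (kron f₁ (kron f₂ f₃)).entry := by
  have hY : Y₁.len + Y₂.len = (tensor Y₁ Y₂).len := rfl
  have hX : X₁.len + X₂.len = (tensor X₁ X₂).len := rfl
  funext p q
  simp only [kron, ← hY, ← hX, List.take_take, List.drop_drop, List.drop_take, mul_assoc,
    Nat.add_sub_cancel_left, Nat.min_eq_left (Nat.le_add_right _ _)]

theorem comp_ofFun_id_entry {X Y Z : MatObj A} {hφ : ∀ x ∈ Y.carrier, id x ∈ Z.carrier}
    (h : Z = Y) (f : X ⟶ Y) :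
    MatHom.entry (f ≫ (show Y ⟶ Z from ofFun Y Z id hφ)) = MatHom.entry f := by
  subst h
  exact congrArg _ (Category.comp_id f)

theorem ofFun_id_comp_entry {X Y Z : MatObj A} {hφ : ∀ x ∈ X.carrier, id x ∈ Y.carrier}
    (h : Y = X) (f : Y ⟶ Z) :
    MatHom.entry ((show X ⟶ Y from ofFun X Y id hφ) ≫ f) = MatHom.entry f := by
  subst h
  exact congrArg _ (Category.id_comp f)

theorem kron_unit_left {X Y : MatObj A} (f : X ⟶ Y) :
    (kron (𝟙 (unit : MatObj A)) f).entry = MatHom.entry f := by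
  funext p q
  have h : MatHom.entry (𝟙 (unit : MatObj A)) [] [] = 1 :=
    (ofFun_entry (by simp [unit]) _).trans (if_pos rfl)
  have := kron_entry (𝟙 (unit : MatObj A)) f (y := []) (x := []) (by simp [unit])
    (by simp [unit]) p q
  rw [h, one_mul] at this
  exact this

theorem kron_unit_right {X Y : MatObj A} (f : X ⟶ Y) :
    (kron f (𝟙 (unit : MatObj A))).entry = MatHom.entry f := by
  funext p q
  by_cases hpq : p ∈ Y.carrier ∧ q ∈ X.carrier
  · have h : MatHom.entry (𝟙 (unit : MatObj A)) [] [] = 1 :=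
      (ofFun_entry (by simp [unit]) _).trans (if_pos rfl)
    have := kron_entry f (𝟙 (unit : MatObj A)) hpq.1 hpq.2 [] []
    rw [h, mul_one, List.append_nil, List.append_nil] at this
    exact this
  · rw [MatHom.entry_eq_zero f p q hpq]
    refine MatHom.entry_eq_zero _ _ _ ?_
    rwa [tensor_unit_eq, tensor_unit_eq]

/-- The morphism `m` is the matrix of the function `φ`. -/
def IsFun {X Y : MatObj A} (m : X ⟶ Y) (φ : List A → List A) : Prop :=
  ∃ hφ : ∀ x ∈ X.carrier, φ x ∈ Y.carrier, m = ofFun X Y φ hφ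

theorem IsFun.comp {X Y Z : MatObj A} {m : X ⟶ Y} {n : Y ⟶ Z} {φ ψ : List A → List A}
    (hm : IsFun m φ) (hn : IsFun n ψ) : IsFun (m ≫ n) (fun x => ψ (φ x)) := by
  obtain ⟨h1, rfl⟩ := hm
  obtain ⟨h2, rfl⟩ := hn
  exact ⟨fun x hx => h2 _ (h1 x hx), ofFun_comp_ofFun⟩

theorem IsFun.kron {X Y Z W : MatObj A} {m : X ⟶ Y} {n : Z ⟶ W} {φ ψ : List A → List A}
    (hm : IsFun m φ) (hn : IsFun n ψ) :
    IsFun (m ⊗ₘ n) (fun q => φ (q.take X.len) ++ ψ (q.drop X.len)) := by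
  obtain ⟨h1, rfl⟩ := hm
  obtain ⟨h2, rfl⟩ := hn
  exact ⟨_, kron_ofFun⟩

theorem IsFun.id (X : MatObj A) : IsFun (𝟙 X) _root_.id := ⟨fun _ h => h, rfl⟩

theorem IsFun.whiskerLeft (X : MatObj A) {Z W : MatObj A} {n : Z ⟶ W} {ψ : List A → List A}
    (hn : IsFun n ψ) : IsFun (X ◁ n) (fun q => q.take X.len ++ ψ (q.drop X.len)) :=
  (IsFun.id X).kron hn

theorem IsFun.whiskerRight (X : MatObj A) {Z W : MatObj A} {n : Z ⟶ W} {ψ : List A → List A}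
    (hn : IsFun n ψ) : IsFun (n ▷ X) (fun q => ψ (q.take Z.len) ++ q.drop Z.len) :=
  hn.kron (IsFun.id X)

theorem IsFun.eq {X Y : MatObj A} {m n : X ⟶ Y} {φ ψ : List A → List A}
    (hm : IsFun m φ) (hn : IsFun n ψ) (h : ∀ x ∈ X.carrier, φ x = ψ x) : m = n := by
  obtain ⟨h1, rfl⟩ := hm
  obtain ⟨h2, rfl⟩ := hn
  exact ofFun_congr h

theorem IsFun.congr {X Y : MatObj A} {m : X ⟶ Y} {φ ψ : List A → List A}
    (hm : IsFun m φ) (h : ∀ x ∈ X.carrier, φ x = ψ x) : IsFun m ψ := by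
  obtain ⟨h1, rfl⟩ := hm
  exact ⟨fun x hx => h x hx ▸ h1 x hx, ofFun_congr h⟩

theorem IsFun.associator_hom (X Y Z : MatObj A) : IsFun (α_ X Y Z).hom _root_.id :=
  ⟨_, MatObj.associator_hom X Y Z⟩

theorem IsFun.associator_inv (X Y Z : MatObj A) : IsFun (α_ X Y Z).inv _root_.id :=
  ⟨_, MatObj.associator_inv X Y Z⟩

theorem IsFun.leftUnitor_hom (X : MatObj A) : IsFun (λ_ X).hom _root_.id :=
  ⟨_, MatObj.leftUnitor_hom X⟩

theorem IsFun.leftUnitor_inv (X : MatObj A) : IsFun (λ_ X).inv _root_.id :=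
  ⟨_, MatObj.leftUnitor_inv X⟩

theorem IsFun.rightUnitor_hom (X : MatObj A) : IsFun (ρ_ X).hom _root_.id :=
  ⟨_, MatObj.rightUnitor_hom X⟩

theorem IsFun.rightUnitor_inv (X : MatObj A) : IsFun (ρ_ X).inv _root_.id :=
  ⟨_, MatObj.rightUnitor_inv X⟩

@[simp] theorem len_tensor (X Y : MatObj A) : (X ⊗ Y).len = X.len + Y.len := rfl

@[simp] theorem len_unit : (𝟙_ (MatObj A)).len = 0 := rfl

theorem mem_unit {x : List A} : x ∈ (𝟙_ (MatObj A)).carrier ↔ x = [] := by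
  change x ∈ ({[]} : Finset (List A)) ↔ _
  simp

noncomputable instance monoidal : MonoidalCategory (MatObj A) :=
  MonoidalCategory.ofTensorHom
    (id_tensorHom_id := kron_id)
    (id_tensorHom := fun _ _ _ _ => rfl)
    (tensorHom_id := fun _ _ => rfl)
    (tensorHom_comp_tensorHom := kron_comp)
    (associator_naturality := fun {X₁ X₂ X₃ Y₁ Y₂ Y₃} f₁ f₂ f₃ => by
      apply MatHom.ext
      rw [associator_hom, associator_hom]
      refine (comp_ofFun_id_entry (tensor_assoc_eq _ _ _).symm _).trans
        (Eq.trans ?_ (ofFun_id_comp_entry (tensor_assoc_eq _ _ _).symm _).symm)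
      exact kron_assoc f₁ f₂ f₃)
    (leftUnitor_naturality := fun {X Y} f => by
      rw [leftUnitor_hom, leftUnitor_hom]
      apply MatHom.ext
      refine (comp_ofFun_id_entry (unit_tensor_eq _).symm _).trans
        (Eq.trans ?_ (ofFun_id_comp_entry (unit_tensor_eq _).symm _).symm)
      exact kron_unit_left f)
    (rightUnitor_naturality := fun {X Y} f => by
      rw [rightUnitor_hom, rightUnitor_hom]
      apply MatHom.ext
      refine (comp_ofFun_id_entry (tensor_unit_eq _).symm _).trans
        (Eq.trans ?_ (ofFun_id_comp_entry (tensor_unit_eq _).symm _).symm)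
      exact kron_unit_right f)
    (pentagon := fun W X Y Z => by
      refine (((IsFun.associator_hom W X Y).kron (IsFun.id Z)).comp
        ((IsFun.associator_hom W (X ⊗ Y) Z).comp
        ((IsFun.id W).kron (IsFun.associator_hom X Y Z)))).eq
        ((IsFun.associator_hom (W ⊗ X) Y Z).comp (IsFun.associator_hom W X (Y ⊗ Z))) ?_
      intro x _
      simp)
    (triangle := fun X Y => by
      refine ((IsFun.associator_hom X (𝟙_ _) Y).comp
        ((IsFun.id X).kron (IsFun.leftUnitor_hom Y))).eq
        ((IsFun.rightUnitor_hom X).kron (IsFun.id Y)) ?_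
      intro x _
      simp)

instance isStrict : IsStrict (MatObj A) where
  tensor_assoc := tensor_assoc_eq
  unit_tensor := unit_tensor_eq
  tensor_unit := tensor_unit_eq
  associator_eq _ _ _ := rfl
  leftUnitor_eq _ := rfl
  rightUnitor_eq _ := rfl

/-- Induction principle for words of a product. -/
theorem tensor_forall {X Y : MatObj A} {P : List A → Prop}
    (h : ∀ a ∈ X.carrier, ∀ b ∈ Y.carrier, P (a ++ b)) : ∀ x ∈ (X ⊗ Y).carrier, P x := by
  intro x hx
  obtain ⟨a, ha, b, hb, rfl⟩ := mem_tensor.1 hx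
  exact h a ha b hb

theorem swap_mem {X Y : MatObj A} : ∀ p ∈ (tensor X Y).carrier,
    p.drop X.len ++ p.take X.len ∈ (tensor Y X).carrier :=
  fun _ hp => append_mem (drop_mem hp) (take_mem hp)

theorem swap_swap {X Y : MatObj A} : ∀ p ∈ (tensor X Y).carrier,
    (p.drop X.len ++ p.take X.len).drop Y.len ++ (p.drop X.len ++ p.take X.len).take Y.len = p :=
  tensor_forall fun a ha b hb => by simp [← X.length_eq a ha, ← Y.length_eq b hb]

/-- The symmetry: exchange of the two parts of a word. -/
noncomputable def swap (X Y : MatObj A) : X ⊗ Y ≅ Y ⊗ X :=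
  isoOfFun (X := tensor X Y) (Y := tensor Y X)
    (fun p => p.drop X.len ++ p.take X.len) (fun p => p.drop Y.len ++ p.take Y.len)
    swap_mem swap_mem swap_swap swap_swap

theorem IsFun.swap (X Y : MatObj A) :
    IsFun (swap X Y).hom (fun p => p.drop X.len ++ p.take X.len) := ⟨swap_mem, rfl⟩

theorem swap_natural {X Y Z W : MatObj A} (f : X ⟶ Y) (g : Z ⟶ W) :
    (f ⊗ₘ g) ≫ (swap Y W).hom = (swap X Z).hom ≫ (g ⊗ₘ f) := by
  refine hom_ext (tensor_forall fun w hw y hy => tensor_forall fun x hx z hz => ?_)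
  have hwy : w ++ y ∈ (tensor W Y).carrier := append_mem hw hy
  have hxz : x ++ z ∈ (tensor X Z).carrier := append_mem hx hz
  refine (comp_iso_entry (X := tensor X Z) (Y := tensor Y W) (Z := tensor W Y)
    (φ := fun p => p.drop Y.len ++ p.take Y.len) (ψ := fun p => p.drop W.len ++ p.take W.len)
    (hφ := swap_mem) swap_mem swap_swap swap_swap (kron f g) hwy _).trans ?_
  refine Eq.trans ?_ (ofFun_comp_entry (X := tensor X Z) (Y := tensor Z X) (Z := tensor W Y)
    (φ := fun p => p.drop X.len ++ p.take X.len) (hφ := swap_mem) (kron g f) hxz _).symm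
  simp only [take_append hw, drop_append hw, take_append hx, drop_append hx]
  rw [kron_entry _ _ hy hx, kron_entry _ _ hw hz, mul_comm]

noncomputable instance symmetric : SymmetricCategory (MatObj A) where
  braiding := swap
  braiding_naturality_right X Y Z f := swap_natural (𝟙 X) f
  braiding_naturality_left f Z := swap_natural f (𝟙 Z)
  hexagon_forward X Y Z := by
    refine ((IsFun.associator_hom X Y Z).comp ((IsFun.swap X (Y ⊗ Z)).comp
      (IsFun.associator_hom Y Z X))).eq (((IsFun.swap X Y).whiskerRight Z).comp
      ((IsFun.associator_hom Y X Z).comp ((IsFun.swap X Z).whiskerLeft Y))) ?_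
    refine tensor_forall (tensor_forall fun a ha b hb c hc => ?_)
    simp [← X.length_eq a ha, ← Y.length_eq b hb, List.take_append,
      List.drop_append, List.take_of_length_le, List.drop_eq_nil_of_le]
  hexagon_reverse X Y Z := by
    refine ((IsFun.associator_inv X Y Z).comp ((IsFun.swap (X ⊗ Y) Z).comp
      (IsFun.associator_inv Z X Y))).eq (((IsFun.swap Y Z).whiskerLeft X).comp
      ((IsFun.associator_inv X Z Y).comp ((IsFun.swap X Z).whiskerRight Y))) ?_
    refine tensor_forall fun a ha => tensor_forall fun b hb c hc => ?_
    simp [← X.length_eq a ha, ← Y.length_eq b hb, ← Z.length_eq c hc, List.take_append,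
      List.drop_append, List.take_of_length_le, List.drop_eq_nil_of_le]
  symmetry X Y := (swap X Y).hom_inv_id

theorem IsFun.braiding (X Y : MatObj A) :
    IsFun (β_ X Y).hom (fun p => p.drop X.len ++ p.take X.len) := IsFun.swap X Y

/-- Copy: the entry at `(z, x)` is `1` if `z` is the pair `x ++ x`, and `0` otherwise. -/
noncomputable def copyHom (X : MatObj A) : X ⟶ X ⊗ X :=
  ofFun X (tensor X X) (fun x => x ++ x) (fun _ hx => append_mem hx hx)

/-- Delete: all entries are `1`. -/
noncomputable def delHom (X : MatObj A) : X ⟶ 𝟙_ (MatObj A) :=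
  ofFun X unit (fun _ => []) (fun _ _ => mem_unit.2 rfl)

theorem IsFun.copyHom (X : MatObj A) : IsFun (copyHom X) (fun x => x ++ x) := ⟨_, rfl⟩

theorem IsFun.delHom (X : MatObj A) : IsFun (delHom X) (fun _ => []) := ⟨_, rfl⟩

@[reducible] noncomputable def comon (X : MatObj A) : ComonObj X where
  counit := delHom X
  comul := copyHom X
  counit_comul := ((IsFun.copyHom X).comp ((IsFun.delHom X).whiskerRight X)).eq
    (IsFun.leftUnitor_inv X) fun x hx => by simp [← X.length_eq x hx]
  comul_counit := ((IsFun.copyHom X).comp ((IsFun.delHom X).whiskerLeft X)).eq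
    (IsFun.rightUnitor_inv X) fun x hx => by simp [← X.length_eq x hx]
  comul_assoc := ((IsFun.copyHom X).comp ((IsFun.copyHom X).whiskerLeft X)).eq
    ((IsFun.copyHom X).comp (((IsFun.copyHom X).whiskerRight X).comp
      (IsFun.associator_hom X X X))) fun x hx => by simp [← X.length_eq x hx]

theorem IsFun.tensorMid (X Y Z W : MatObj A) : IsFun (tensorμ X Y Z W)
    (fun p => p.take X.len ++ ((p.drop X.len).drop Y.len).take Z.len ++
      ((p.drop X.len).take Y.len ++ ((p.drop X.len).drop Y.len).drop Z.len)) := by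
  refine IsFun.congr ((IsFun.associator_hom X Y (Z ⊗ W)).comp
    (((IsFun.associator_inv Y Z W).whiskerLeft X).comp
    ((((IsFun.braiding Y Z).whiskerRight W).whiskerLeft X).comp
    (((IsFun.associator_hom Z Y W).whiskerLeft X).comp (IsFun.associator_inv X Z (Y ⊗ W)))))) ?_
  refine tensor_forall (tensor_forall fun a ha b hb => tensor_forall fun c hc d hd => ?_)
  simp [← X.length_eq a ha, ← Y.length_eq b hb, ← Z.length_eq c hc, List.take_append,
      List.drop_append, -List.drop_drop, List.take_of_length_le, List.drop_eq_nil_of_le]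

noncomputable instance copyDiscard : CopyDiscardCategory (MatObj A) where
  comonObj := comon
  isCommComonObj X :=
    letI := comon X
    { comul_comm := ((IsFun.copyHom X).comp (IsFun.braiding X X)).eq (IsFun.copyHom X)
        fun x hx => by simp [← X.length_eq x hx] }
  copy_tensor X Y := (IsFun.copyHom (X ⊗ Y)).eq
    (((IsFun.copyHom X).kron (IsFun.copyHom Y)).comp (IsFun.tensorMid X X Y Y))
    (tensor_forall fun a ha b hb => by
      simp [← X.length_eq a ha, ← Y.length_eq b hb, -List.drop_drop])
  discard_tensor X Y := (IsFun.delHom (X ⊗ Y)).eq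
    (((IsFun.delHom X).kron (IsFun.delHom Y)).comp (IsFun.leftUnitor_hom _)) fun x hx => by simp
  copy_unit := (IsFun.copyHom _).eq (IsFun.leftUnitor_inv _) fun x hx => by
    simp [mem_unit.1 hx]
  discard_unit := (IsFun.delHom _).eq (IsFun.id _) fun x hx => by
    simp [mem_unit.1 hx]

/-- Compare: the transpose of copy. -/
noncomputable def compareHom (X : MatObj A) : X ⊗ X ⟶ X := (copyHom X).transpose

/-- Omni: the transpose of delete, all of whose entries are `1`. -/
noncomputable def omniHom (X : MatObj A) : 𝟙_ (MatObj A) ⟶ X := (delHom X).transpose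

/-- The morphism `m : X ⟶ Y` is the transposed matrix of the function `φ` from `Y` to `X`. -/
def IsCofun {X Y : MatObj A} (m : X ⟶ Y) (φ : List A → List A) : Prop :=
  ∃ hφ : ∀ y ∈ Y.carrier, φ y ∈ X.carrier, m = (ofFun Y X φ hφ).transpose

theorem transpose_comp {X Y Z : MatObj A} (f : X ⟶ Y) (g : Y ⟶ Z) :
    (show Z ⟶ Y from MatHom.transpose g) ≫ (show Y ⟶ X from MatHom.transpose f) =
      MatHom.transpose (f ≫ g) := by
  refine MatHom.ext (funext fun x => funext fun z => ?_)
  exact Finset.sum_congr rfl fun _ _ => mul_comm _ _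

theorem IsCofun.comp {X Y Z : MatObj A} {m : X ⟶ Y} {n : Y ⟶ Z} {φ ψ : List A → List A}
    (hm : IsCofun m φ) (hn : IsCofun n ψ) : IsCofun (m ≫ n) (fun z => φ (ψ z)) := by
  obtain ⟨h1, rfl⟩ := hm
  obtain ⟨h2, rfl⟩ := hn
  exact ⟨fun x hx => h1 _ (h2 x hx),
    (transpose_comp _ _).trans (congrArg MatHom.transpose ofFun_comp_ofFun)⟩

theorem IsCofun.kron {X Y Z W : MatObj A} {m : X ⟶ Y} {n : Z ⟶ W} {φ ψ : List A → List A}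
    (hm : IsCofun m φ) (hn : IsCofun n ψ) :
    IsCofun (m ⊗ₘ n) (fun q => φ (q.take Y.len) ++ ψ (q.drop Y.len)) := by
  obtain ⟨h1, rfl⟩ := hm
  obtain ⟨h2, rfl⟩ := hn
  exact ⟨_, congrArg MatHom.transpose (kron_ofFun (hφ := h1) (hψ := h2))⟩

theorem IsFun.isCofun {X Y : MatObj A} {m : X ⟶ Y} {φ ψ : List A → List A}
    (hm : IsFun m φ) (hψ : ∀ y ∈ Y.carrier, ψ y ∈ X.carrier)
    (h1 : ∀ x ∈ X.carrier, ψ (φ x) = x) (h2 : ∀ y ∈ Y.carrier, φ (ψ y) = y) : IsCofun m ψ := by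
  classical
  obtain ⟨hφ, rfl⟩ := hm
  refine ⟨hψ, hom_ext fun y hy x hx => ?_⟩
  rw [ofFun_entry hx, MatHom.transpose, ofFun_entry hy]
  refine if_congr ⟨?_, ?_⟩ rfl rfl
  · rintro rfl
    exact (h1 x hx).symm
  · rintro rfl
    exact (h2 y hy).symm

theorem IsFun.isCofun_id {X Y : MatObj A} (h : X = Y) {m : X ⟶ Y}
    (hm : IsFun m _root_.id) : IsCofun m _root_.id :=
  hm.isCofun (fun x hx => by subst h; exact hx) (fun _ _ => rfl) (fun _ _ => rfl)

theorem IsCofun.id (X : MatObj A) : IsCofun (𝟙 X) _root_.id := (IsFun.id X).isCofun_id rfl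

theorem IsCofun.whiskerLeft (X : MatObj A) {Z W : MatObj A} {n : Z ⟶ W} {ψ : List A → List A}
    (hn : IsCofun n ψ) : IsCofun (X ◁ n) (fun q => q.take X.len ++ ψ (q.drop X.len)) :=
  (IsCofun.id X).kron hn

theorem IsCofun.whiskerRight (X : MatObj A) {Z W : MatObj A} {n : Z ⟶ W} {ψ : List A → List A}
    (hn : IsCofun n ψ) : IsCofun (n ▷ X) (fun q => ψ (q.take W.len) ++ q.drop W.len) :=
  hn.kron (IsCofun.id X)

theorem IsCofun.eq {X Y : MatObj A} {m n : X ⟶ Y} {φ ψ : List A → List A}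
    (hm : IsCofun m φ) (hn : IsCofun n ψ) (h : ∀ x ∈ Y.carrier, φ x = ψ x) : m = n := by
  obtain ⟨h1, rfl⟩ := hm
  obtain ⟨h2, rfl⟩ := hn
  exact congrArg MatHom.transpose (ofFun_congr h)

theorem IsCofun.associator_hom (X Y Z : MatObj A) : IsCofun (α_ X Y Z).hom _root_.id :=
  (IsFun.associator_hom X Y Z).isCofun_id (tensor_assoc_eq X Y Z)

theorem IsCofun.associator_inv (X Y Z : MatObj A) : IsCofun (α_ X Y Z).inv _root_.id :=
  (IsFun.associator_inv X Y Z).isCofun_id (tensor_assoc_eq X Y Z).symm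

theorem IsCofun.leftUnitor_hom (X : MatObj A) : IsCofun (λ_ X).hom _root_.id :=
  (IsFun.leftUnitor_hom X).isCofun_id (unit_tensor_eq X)

theorem IsCofun.leftUnitor_inv (X : MatObj A) : IsCofun (λ_ X).inv _root_.id :=
  (IsFun.leftUnitor_inv X).isCofun_id (unit_tensor_eq X).symm

theorem IsCofun.rightUnitor_hom (X : MatObj A) : IsCofun (ρ_ X).hom _root_.id :=
  (IsFun.rightUnitor_hom X).isCofun_id (tensor_unit_eq X)

theorem IsCofun.braiding (X Y : MatObj A) :
    IsCofun (β_ X Y).hom (fun p => p.drop Y.len ++ p.take Y.len) :=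
  (IsFun.braiding X Y).isCofun swap_mem swap_swap swap_swap

theorem IsCofun.compareHom (X : MatObj A) : IsCofun (compareHom X) (fun x => x ++ x) :=
  ⟨fun _ hx => append_mem hx hx, rfl⟩

theorem IsCofun.omniHom (X : MatObj A) : IsCofun (omniHom X) (fun _ => []) :=
  ⟨fun _ _ => mem_unit.2 rfl, rfl⟩

open scoped Classical in
theorem IsFun.comp_isCofun_entry {X Y Z : MatObj A} {m : X ⟶ Y} {n : Y ⟶ Z}
    {φ ψ : List A → List A} (hm : IsFun m φ) (hn : IsCofun n ψ) {x z : List A}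
    (hx : x ∈ X.carrier) (hz : z ∈ Z.carrier) :
    MatHom.entry (m ≫ n) z x = if ψ z = φ x then 1 else 0 := by
  obtain ⟨h1, rfl⟩ := hm
  obtain ⟨h2, rfl⟩ := hn
  exact (comp_transpose_entry (hφ := h2) (ofFun X Y φ h1) hz x).trans (ofFun_entry hx _)

theorem compare_copy_entry (X : MatObj A) {a b c d : List A} (ha : a ∈ X.carrier)
    (hc : c ∈ X.carrier) :
    MatHom.entry (compareHom X ≫ copyHom X) (c ++ d) (a ++ b)
      = open scoped Classical in if c = a ∧ d = a ∧ b = a then 1 else 0 := by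
  classical
  have key : ∀ x ∈ X.carrier, MatHom.entry (copyHom X) (c ++ d) x
      * MatHom.entry (compareHom X) x (a ++ b)
        = if x = a ∧ c = a ∧ d = a ∧ b = a then 1 else 0 := by
    intro x hx
    have e1 : MatHom.entry (copyHom X) (c ++ d) x = if c ++ d = x ++ x then 1 else 0 :=
      ofFun_entry hx _
    have e2 : MatHom.entry (compareHom X) x (a ++ b) = if a ++ b = x ++ x then 1 else 0 :=
      ofFun_entry (Y := tensor X X) (φ := fun x => x ++ x)
        (hφ := fun _ hx => append_mem hx hx) hx (a ++ b)
    have lx := X.length_eq x hx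
    have i1 : c ++ d = x ++ x ↔ c = x ∧ d = x :=
      ⟨fun h => List.append_inj h ((X.length_eq c hc).trans lx.symm), fun h => by rw [h.1, h.2]⟩
    have i2 : a ++ b = x ++ x ↔ a = x ∧ b = x :=
      ⟨fun h => List.append_inj h ((X.length_eq a ha).trans lx.symm), fun h => by rw [h.1, h.2]⟩
    rw [e1, e2]
    simp only [i1, i2]
    by_cases hxa : x = a
    · subst hxa
      by_cases hc : c = x <;> by_cases hd : d = x <;> by_cases hb : b = x <;> simp [hc, hd, hb]
    · have : a ≠ x := fun h => hxa h.symm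
      simp [hxa, this]
  rw [comp_entry, Finset.sum_congr rfl key, Finset.sum_eq_single a]
  · simp
  · intro x _ hxa
    simp [hxa]
  · intro h
    exact absurd ha h

noncomputable instance hypergraph : HypergraphCategory (MatObj A) where
  compare := compareHom
  omni := omniHom
  omni_compare X := (((IsCofun.omniHom X).whiskerRight X).comp (IsCofun.compareHom X)).eq
    (IsCofun.leftUnitor_hom X) fun x hx => by simp [← X.length_eq x hx]
  compare_omni X := (((IsCofun.omniHom X).whiskerLeft X).comp (IsCofun.compareHom X)).eq
    (IsCofun.rightUnitor_hom X) fun x hx => by simp [← X.length_eq x hx]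
  compare_assoc X := (((IsCofun.compareHom X).whiskerRight X).comp (IsCofun.compareHom X)).eq
    ((IsCofun.associator_hom X X X).comp (((IsCofun.compareHom X).whiskerLeft X).comp
      (IsCofun.compareHom X))) fun x hx => by simp [← X.length_eq x hx]
  compare_comm X := ((IsCofun.braiding X X).comp (IsCofun.compareHom X)).eq
    (IsCofun.compareHom X) fun x hx => by simp [← X.length_eq x hx]
  compare_tensor X Y := by
    refine (IsCofun.compareHom (X ⊗ Y)).eq (((IsCofun.associator_hom X Y (X ⊗ Y)).comp
      (((IsCofun.associator_inv Y X Y).whiskerLeft X).comp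
      ((((IsCofun.braiding Y X).whiskerRight Y).whiskerLeft X).comp
      (((IsCofun.associator_hom X Y Y).whiskerLeft X).comp
        (IsCofun.associator_inv X X (Y ⊗ Y)))))).comp
      ((IsCofun.compareHom X).kron (IsCofun.compareHom Y))) ?_
    refine tensor_forall fun a ha b hb => ?_
    simp [← X.length_eq a ha, ← Y.length_eq b hb, List.take_append,
      List.drop_append, List.take_of_length_le, List.drop_eq_nil_of_le]
  omni_tensor X Y := (IsCofun.omniHom (X ⊗ Y)).eq ((IsCofun.leftUnitor_inv _).comp
    ((IsCofun.omniHom X).kron (IsCofun.omniHom Y))) fun x hx => by simp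
  compare_unit := (IsCofun.compareHom _).eq (IsCofun.leftUnitor_hom _) fun x hx => by
    simp [mem_unit.1 hx]
  omni_unit := (IsCofun.omniHom _).eq (IsCofun.id _) fun x hx => by
    simp [mem_unit.1 hx]
  special X := by
    classical
    refine hom_ext fun z hz x hx => ?_
    refine ((IsFun.copyHom X).comp_isCofun_entry (IsCofun.compareHom X) hx hz).trans ?_
    refine Eq.trans (if_congr ⟨fun h => ?_, fun h => ?_⟩ rfl rfl) (ofFun_entry hx z).symm
    · exact (List.append_inj h ((X.length_eq z hz).trans (X.length_eq x hx).symm)).1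
    · rw [show z = x from h]
  frobenius_left X := by
    classical
    refine hom_ext (tensor_forall fun c hc d hd => tensor_forall fun a ha b hb => ?_)
    refine Eq.trans ?_ (compare_copy_entry X ha hc).symm
    refine (congrArg (fun m => MatHom.entry m (c ++ d) (a ++ b)) (Category.assoc _ _ _).symm).trans
      (((((IsFun.copyHom X).whiskerRight X).comp
      (IsFun.associator_hom X X X)).comp_isCofun_entry ((IsCofun.compareHom X).whiskerLeft X)
        (append_mem ha hb) (append_mem hc hd)).trans ?_)
    refine if_congr ?_ rfl rfl
    simp only [id, take_append hc, drop_append hc, take_append ha, drop_append ha]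
    have lc := X.length_eq c hc
    have la := X.length_eq a ha
    rw [List.append_assoc]
    constructor
    · intro h
      obtain ⟨h1, h2⟩ := List.append_inj h (lc.trans la.symm)
      obtain ⟨h3, h4⟩ := List.append_inj h2 ((X.length_eq d hd).trans la.symm)
      exact ⟨h1, h3, by rw [← h4, h3]⟩
    · rintro ⟨rfl, rfl, rfl⟩
      rfl
  frobenius_right X := by
    classical
    refine hom_ext (tensor_forall fun c hc d hd => tensor_forall fun a ha b hb => ?_)
    refine Eq.trans ?_ (compare_copy_entry X ha hc).symm
    refine (congrArg (fun m => MatHom.entry m (c ++ d) (a ++ b)) (Category.assoc _ _ _).symm).trans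
      (((((IsFun.copyHom X).whiskerLeft X).comp
      (IsFun.associator_inv X X X)).comp_isCofun_entry ((IsCofun.compareHom X).whiskerRight X)
        (append_mem ha hb) (append_mem hc hd)).trans ?_)
    refine if_congr ?_ rfl rfl
    simp only [id, take_append hc, drop_append hc, take_append ha, drop_append ha]
    have lc := X.length_eq c hc
    have la := X.length_eq a ha
    rw [List.append_assoc]
    constructor
    · intro h
      obtain ⟨h1, h2⟩ := List.append_inj h (lc.trans la.symm)
      obtain ⟨h3, h4⟩ := List.append_inj h2 (lc.trans (X.length_eq b hb).symm)
      exact ⟨h1, by rw [h4, ← h3, h1], by rw [← h3, h1]⟩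
    · rintro ⟨rfl, rfl, rfl⟩
      rfl

/-- A matrix is stochastic if each of its columns sums to one. -/
def stochastic (A : Type u) : MorphismProperty (MatObj A) := fun X Y f =>
  ∀ x ∈ X.carrier, ∑ y ∈ Y.carrier, MatHom.entry f y x = 1

theorem IsFun.stochastic {X Y : MatObj A} {m : X ⟶ Y} {φ : List A → List A} (hm : IsFun m φ) :
    stochastic A m := by
  obtain ⟨hφ, rfl⟩ := hm
  intro x hx
  rw [Finset.sum_eq_single (φ x)]
  · exact (ofFun_entry hx _).trans (if_pos rfl)
  · intro y _ hy
    exact (ofFun_entry hx _).trans (if_neg hy)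
  · intro h
    exact absurd (hφ x hx) h

theorem stochastic_comp {X Y Z : MatObj A} (f : X ⟶ Y) (g : Y ⟶ Z) (hf : stochastic A f)
    (hg : stochastic A g) : stochastic A (f ≫ g) := by
  intro x hx
  simp only [comp_entry]
  rw [Finset.sum_comm, ← hf x hx]
  refine Finset.sum_congr rfl fun y hy => ?_
  rw [← Finset.sum_mul, hg y hy, one_mul]

theorem stochastic_kron {X Y Z W : MatObj A} (f : X ⟶ Y) (g : Z ⟶ W) (hf : stochastic A f)
    (hg : stochastic A g) : stochastic A (f ⊗ₘ g) := by
  refine tensor_forall fun a ha b hb => ?_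
  refine (sum_tensor _).trans ?_
  refine Eq.trans (Finset.sum_congr rfl fun y hy => Finset.sum_congr rfl fun w _ =>
    kron_entry f g hy ha w b) ?_
  rw [← Finset.sum_mul_sum, hf a ha, hg b hb, one_mul]

instance : (stochastic A).IsMultiplicative where
  id_mem X := (IsFun.id X).stochastic
  comp_mem f g hf hg := stochastic_comp f g hf hg

instance : (stochastic A).IsStableUnderBraiding where
  whiskerLeft X _ _ g hg := stochastic_kron (𝟙 X) g (IsFun.id X).stochastic hg
  whiskerRight f hf Y := stochastic_kron f (𝟙 Y) hf (IsFun.id Y).stochastic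
  associator_hom_mem X Y Z := (IsFun.associator_hom X Y Z).stochastic
  associator_inv_mem X Y Z := (IsFun.associator_inv X Y Z).stochastic
  leftUnitor_hom_mem X := (IsFun.leftUnitor_hom X).stochastic
  leftUnitor_inv_mem X := (IsFun.leftUnitor_inv X).stochastic
  rightUnitor_hom_mem X := (IsFun.rightUnitor_hom X).stochastic
  rightUnitor_inv_mem X := (IsFun.rightUnitor_inv X).stochastic
  braiding_hom_mem X Y := (IsFun.braiding X Y).stochastic
  braiding_inv_mem X Y := (IsFun.braiding Y X).stochastic

instance (X : MatObj A) : (stochastic A).IsStableUnderComonoid X where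
  counit_mem := (IsFun.delHom X).stochastic
  comul_mem := (IsFun.copyHom X).stochastic

/-- Two matrices are proportional if they differ by a positive global factor. -/
def proportional (A : Type u) : HomRel (MatObj A) := fun _ _ f g =>
  ∃ c : ℝ≥0, 0 < c ∧ ∀ y x, c * MatHom.entry f y x = MatHom.entry g y x

instance : Congruence (proportional A) where
  equivalence :=
    { refl := fun _ => ⟨1, one_pos, fun _ _ => one_mul _⟩
      symm := fun ⟨c, hc, h⟩ => ⟨c⁻¹, inv_pos.2 hc, fun y x => by
        rw [← h, inv_mul_cancel_left₀ hc.ne']⟩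
      trans := fun ⟨c, hc, h⟩ ⟨c', hc', h'⟩ => ⟨c' * c, mul_pos hc' hc, fun y x => by
        rw [← h', ← h, mul_assoc]⟩ }
  comp_left := fun f g g' ⟨c, hc, h⟩ => ⟨c, hc, fun y x => by
    simp only [comp_entry, Finset.mul_sum, ← h, mul_assoc]⟩
  comp_right := fun g ⟨c, hc, h⟩ => ⟨c, hc, fun y x => by
    simp only [comp_entry, Finset.mul_sum, ← h, mul_left_comm]⟩

end MatObj

/-- The hypergraph category of matrices with nonnegative entries. -/
abbrev Mat (A : Type u) := MatObj A

/-- The CD-category of stochastic matrices: the subcategory of `Mat A` with all objects and with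
the stochastic matrices as morphisms. -/
abbrev FinStoch (A : Type u) := WideSubcategory (MatObj.stochastic A)

/-- The category of matrices up to a positive global factor. -/
abbrev FinProjStoch (A : Type u) := CategoryTheory.Quotient (MatObj.proportional A)

/-- The quotient functor. -/
noncomputable abbrev quotFunctor (A : Type u) : Mat A ⥤ FinProjStoch A :=
  CategoryTheory.Quotient.functor (MatObj.proportional A)

/-- The embedding sending a stochastic matrix to its class. -/
noncomputable abbrev stochFunctor (A : Type u) : FinStoch A ⥤ FinProjStoch A :=
  wideSubcategoryInclusion (MatObj.stochastic A) ⋙ quotFunctor A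

theorem FinStoch.eqToHom_hom {A : Type u} {X Y : FinStoch A} (h : X = Y) :
    (eqToHom h).hom = eqToHom (congrArg WideSubcategory.obj h) := by
  subst h; rfl

instance (A : Type u) : IsStrict (FinStoch A) where
  tensor_assoc X Y Z := congrArg WideSubcategory.mk (MatObj.tensor_assoc_eq X.obj Y.obj Z.obj)
  unit_tensor X := congrArg WideSubcategory.mk (MatObj.unit_tensor_eq X.obj)
  tensor_unit X := congrArg WideSubcategory.mk (MatObj.tensor_unit_eq X.obj)
  associator_eq _ _ _ := WideSubcategory.hom_ext _ (FinStoch.eqToHom_hom _).symm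
  leftUnitor_eq _ := WideSubcategory.hom_ext _ (FinStoch.eqToHom_hom _).symm
  rightUnitor_eq _ := WideSubcategory.hom_ext _ (FinStoch.eqToHom_hom _).symm

/-! ### Free CD-categories and free hypergraph categories -/

/-- A monoidal signature: generating objects, and generating morphisms typed by words. -/
structure Signature where
  Ob : Type w
  Gen : Type w
  dom : Gen → List Ob
  cod : Gen → List Ob

/-- Which structure is freely generated: that of a CD-category or of a hypergraph category. -/
inductive Doctrine
  | cd
  | hypergraph

/-- String diagram terms over a signature. The terms `compare` and `omni` are only available for
hypergraph categories; `eqTo` is an identity between two equal words. -/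
inductive Term (S : Signature.{w}) (d : Doctrine) : List S.Ob → List S.Ob → Type w
  | id (X : List S.Ob) : Term S d X X
  | comp {X Y Z : List S.Ob} (f : Term S d X Y) (g : Term S d Y Z) : Term S d X Z
  | tensor {X Y Z W : List S.Ob} (f : Term S d X Y) (g : Term S d Z W) :
      Term S d (X ++ Z) (Y ++ W)
  | eqTo {X Y : List S.Ob} (h : X = Y) : Term S d X Y
  | swap (X Y : List S.Ob) : Term S d (X ++ Y) (Y ++ X)
  | copy (X : List S.Ob) : Term S d X (X ++ X)
  | del (X : List S.Ob) : Term S d X []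
  | compare (h : d = .hypergraph) (X : List S.Ob) : Term S d (X ++ X) X
  | omni (h : d = .hypergraph) (X : List S.Ob) : Term S d [] X
  | gen (g : S.Gen) : Term S d (S.dom g) (S.cod g)

namespace Term

variable {S : Signature.{w}} {d : Doctrine}

/-- The rebracketing term `(X Y) Z ⟶ X (Y Z)`. -/
abbrev assoc (X Y Z : List S.Ob) : Term S d ((X ++ Y) ++ Z) (X ++ (Y ++ Z)) :=
  eqTo (List.append_assoc X Y Z)

/-- The rebracketing term `X (Y Z) ⟶ (X Y) Z`. -/
abbrev assocInv (X Y Z : List S.Ob) : Term S d (X ++ (Y ++ Z)) ((X ++ Y) ++ Z) :=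
  eqTo (List.append_assoc X Y Z).symm

/-- The interchange of the two middle words. -/
abbrev mid (X Y Z W : List S.Ob) :
    Term S d ((X ++ Y) ++ (Z ++ W)) ((X ++ Z) ++ (Y ++ W)) :=
  (assoc X Y (Z ++ W)).comp <| ((id X).tensor (assocInv Y Z W)).comp <|
    ((id X).tensor ((swap Y Z).tensor (id W))).comp <|
      ((id X).tensor (assoc Z Y W)).comp <| assocInv X Z (Y ++ W)

/-- The equations of strict symmetric monoidal categories, of commutative comonoids compatible
with the monoidal structure and, for hypergraph categories, of special commutative Frobenius
algebras compatible with the monoidal structure. -/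
inductive Rel : ∀ {X Y : List S.Ob}, Term S d X Y → Term S d X Y → Prop
  | comp_left {X Y Z} {f f' : Term S d X Y} (g : Term S d Y Z) :
      Rel f f' → Rel (f.comp g) (f'.comp g)
  | comp_right {X Y Z} (f : Term S d X Y) {g g' : Term S d Y Z} :
      Rel g g' → Rel (f.comp g) (f.comp g')
  | tensor_left {X Y Z W} {f f' : Term S d X Y} (g : Term S d Z W) :
      Rel f f' → Rel (f.tensor g) (f'.tensor g)
  | tensor_right {X Y Z W} (f : Term S d X Y) {g g' : Term S d Z W} :
      Rel g g' → Rel (f.tensor g) (f.tensor g')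
  | id_comp {X Y} (f : Term S d X Y) : Rel ((id X).comp f) f
  | comp_id {X Y} (f : Term S d X Y) : Rel (f.comp (id Y)) f
  | comp_assoc {X Y Z W} (f : Term S d X Y) (g : Term S d Y Z) (h : Term S d Z W) :
      Rel ((f.comp g).comp h) (f.comp (g.comp h))
  | eqTo_refl {X} (h : X = X) : Rel (eqTo h) (id X)
  | tensor_id (X Y) : Rel ((id X).tensor (id Y)) (id (X ++ Y))
  | tensor_comp {X₁ Y₁ Z₁ X₂ Y₂ Z₂} (f₁ : Term S d X₁ Y₁) (f₂ : Term S d X₂ Y₂)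
      (g₁ : Term S d Y₁ Z₁) (g₂ : Term S d Y₂ Z₂) :
      Rel ((f₁.tensor f₂).comp (g₁.tensor g₂)) ((f₁.comp g₁).tensor (f₂.comp g₂))
  | tensor_assoc {X₁ X₂ X₃ Y₁ Y₂ Y₃} (f₁ : Term S d X₁ Y₁) (f₂ : Term S d X₂ Y₂)
      (f₃ : Term S d X₃ Y₃) :
      Rel (((f₁.tensor f₂).tensor f₃).comp (assoc Y₁ Y₂ Y₃))
        ((assoc X₁ X₂ X₃).comp (f₁.tensor (f₂.tensor f₃)))
  | unit_tensor {X Y} (f : Term S d X Y) :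
      Rel (((id []).tensor f).comp (eqTo (List.nil_append Y)))
        ((eqTo (List.nil_append X)).comp f)
  | tensor_unit {X Y} (f : Term S d X Y) :
      Rel ((f.tensor (id [])).comp (eqTo (List.append_nil Y)))
        ((eqTo (List.append_nil X)).comp f)
  | swap_natural {X Y Z W} (f : Term S d X Y) (g : Term S d Z W) :
      Rel ((f.tensor g).comp (swap Y W)) ((swap X Z).comp (g.tensor f))
  | swap_swap (X Y) : Rel ((swap X Y).comp (swap Y X)) (id (X ++ Y))
  | hexagon_forward (X Y Z) :
      Rel ((assoc X Y Z).comp ((swap X (Y ++ Z)).comp (assoc Y Z X)))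
        (((swap X Y).tensor (id Z)).comp ((assoc Y X Z).comp ((id Y).tensor (swap X Z))))
  | hexagon_reverse (X Y Z) :
      Rel ((assocInv X Y Z).comp ((swap (X ++ Y) Z).comp (assocInv Z X Y)))
        (((id X).tensor (swap Y Z)).comp ((assocInv X Z Y).comp ((swap X Z).tensor (id Y))))
  | copy_del_left (X) :
      Rel ((copy X).comp ((del X).tensor (id X))) (eqTo (List.nil_append X).symm)
  | copy_del_right (X) :
      Rel ((copy X).comp ((id X).tensor (del X))) (eqTo (List.append_nil X).symm)
  | copy_assoc (X) :
      Rel ((copy X).comp ((id X).tensor (copy X)))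
        ((copy X).comp (((copy X).tensor (id X)).comp (assoc X X X)))
  | copy_comm (X) : Rel ((copy X).comp (swap X X)) (copy X)
  | copy_tensor (X Y) :
      Rel (copy (X ++ Y)) (((copy X).tensor (copy Y)).comp (mid X X Y Y))
  | del_tensor (X Y) :
      Rel (del (X ++ Y)) (((del X).tensor (del Y)).comp (eqTo (List.nil_append [])))
  | copy_unit : Rel (copy []) (eqTo (List.nil_append []).symm)
  | del_unit : Rel (del []) (id [])
  | omni_compare (h) (X) :
      Rel (((omni h X).tensor (id X)).comp (compare h X)) (eqTo (List.nil_append X))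
  | compare_omni (h) (X) :
      Rel (((id X).tensor (omni h X)).comp (compare h X)) (eqTo (List.append_nil X))
  | compare_assoc (h) (X) :
      Rel (((compare h X).tensor (id X)).comp (compare h X))
        ((assoc X X X).comp (((id X).tensor (compare h X)).comp (compare h X)))
  | compare_comm (h) (X) : Rel ((swap X X).comp (compare h X)) (compare h X)
  | compare_tensor (h) (X Y) :
      Rel (compare h (X ++ Y)) ((mid X Y X Y).comp ((compare h X).tensor (compare h Y)))
  | omni_tensor (h) (X Y) :
      Rel (omni h (X ++ Y)) ((eqTo (List.nil_append []).symm).comp ((omni h X).tensor (omni h Y)))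
  | compare_unit (h) : Rel (compare h []) (eqTo (List.nil_append []))
  | omni_unit (h) : Rel (omni h []) (id [])
  | special (h) (X) : Rel ((copy X).comp (compare h X)) (id X)
  | frobenius_left (h) (X) :
      Rel (((copy X).tensor (id X)).comp ((assoc X X X).comp ((id X).tensor (compare h X))))
        ((compare h X).comp (copy X))
  | frobenius_right (h) (X) :
      Rel (((id X).tensor (copy X)).comp ((assocInv X X X).comp ((compare h X).tensor (id X))))
        ((compare h X).comp (copy X))

end Term

/-- The free CD-category (for `d = .cd`) or free hypergraph category (for `d = .hypergraph`) on a
signature. Its objects are words in the generating objects. -/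
structure Free (S : Signature.{w}) (d : Doctrine) : Type w where
  word : List S.Ob

namespace Free

variable {S : Signature.{w}} {d : Doctrine}

/-- The morphisms of a free category: terms modulo the equations. -/
instance category : Category (Free S d) where
  Hom X Y := Quot (Term.Rel (S := S) (d := d) (X := X.word) (Y := Y.word))
  id X := Quot.mk _ (Term.id X.word)
  comp f g := Quot.map₂ Term.comp (fun f _ _ h => .comp_right f h) (fun _ _ g h => .comp_left g h)
    f g
  id_comp := by rintro X Y ⟨f⟩; exact Quot.sound (.id_comp f)
  comp_id := by rintro X Y ⟨f⟩; exact Quot.sound (.comp_id f)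
  assoc := by rintro W X Y Z ⟨f⟩ ⟨g⟩ ⟨h⟩; exact Quot.sound (.comp_assoc f g h)

/-- The morphism represented by a term. -/
def mk' {X Y : List S.Ob} (f : Term S d X Y) : (⟨X⟩ : Free S d) ⟶ ⟨Y⟩ :=
  Quot.mk _ f

theorem eqToHom_eq {X Y : List S.Ob} (h : X = Y) :
    eqToHom (congrArg (Free.mk (d := d)) h) = mk' (Term.eqTo h) := by
  subst h
  exact (Quot.sound (.eqTo_refl rfl)).symm

/-- The tensor product of morphisms. -/
def tensorHom {X Y Z W : Free S d} (f : X ⟶ Y) (g : Z ⟶ W) :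
    (⟨X.word ++ Z.word⟩ : Free S d) ⟶ ⟨Y.word ++ W.word⟩ :=
  Quot.map₂ Term.tensor (fun f _ _ h => .tensor_right f h) (fun _ _ g h => .tensor_left g h) f g

theorem eqTo_trans {X Y Z : List S.Ob} (h : X = Y) (h' : Y = Z) :
    mk' (d := d) (Term.eqTo h) ≫ mk' (Term.eqTo h') = mk' (Term.eqTo (h.trans h')) := by
  rw [← eqToHom_eq (d := d), ← eqToHom_eq (d := d), ← eqToHom_eq (d := d)]
  exact eqToHom_trans _ _

/-- The isomorphism between two equal words. -/
def isoOfEq {X Y : List S.Ob} (h : X = Y) : (⟨X⟩ : Free S d) ≅ ⟨Y⟩ where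
  hom := mk' (Term.eqTo h)
  inv := mk' (Term.eqTo h.symm)
  hom_inv_id := (eqTo_trans h h.symm).trans (Quot.sound (.eqTo_refl rfl))
  inv_hom_id := (eqTo_trans h.symm h).trans (Quot.sound (.eqTo_refl rfl))

instance monoidalStruct : MonoidalCategoryStruct (Free S d) where
  tensorObj X Y := ⟨X.word ++ Y.word⟩
  tensorUnit := ⟨[]⟩
  tensorHom f g := tensorHom f g
  whiskerLeft X _ _ f := tensorHom (𝟙 X) f
  whiskerRight f X := tensorHom f (𝟙 X)
  associator X Y Z := isoOfEq (List.append_assoc X.word Y.word Z.word)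
  leftUnitor X := isoOfEq (List.nil_append X.word)
  rightUnitor X := isoOfEq (List.append_nil X.word)

theorem tensor_id (X Y : Free S d) :
    tensorHom (𝟙 X) (𝟙 Y) = 𝟙 (⟨X.word ++ Y.word⟩ : Free S d) :=
  Quot.sound (.tensor_id X.word Y.word)

theorem tensor_eqTo_left {X Y : List S.Ob} (h : X = Y) (Z : Free S d) :
    tensorHom (mk' (d := d) (Term.eqTo h)) (𝟙 Z) =
      mk' (Term.eqTo (congrArg (· ++ Z.word) h)) := by
  subst h
  rw [← eqToHom_eq (d := d), ← eqToHom_eq (d := d)]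
  exact tensor_id ⟨X⟩ Z

theorem tensor_eqTo_right {X Y : List S.Ob} (h : X = Y) (Z : Free S d) :
    tensorHom (𝟙 Z) (mk' (d := d) (Term.eqTo h)) =
      mk' (Term.eqTo (congrArg (Z.word ++ ·) h)) := by
  subst h
  rw [← eqToHom_eq (d := d), ← eqToHom_eq (d := d)]
  exact tensor_id Z ⟨X⟩

instance monoidal : MonoidalCategory (Free S d) :=
  MonoidalCategory.ofTensorHom
    (id_tensorHom_id := tensor_id)
    (id_tensorHom := fun _ _ _ _ => rfl)
    (tensorHom_id := fun _ _ => rfl)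
    (tensorHom_comp_tensorHom := by
      rintro _ _ _ _ _ _ ⟨f₁⟩ ⟨f₂⟩ ⟨g₁⟩ ⟨g₂⟩; exact Quot.sound (.tensor_comp f₁ f₂ g₁ g₂))
    (associator_naturality := by
      rintro _ _ _ _ _ _ ⟨f₁⟩ ⟨f₂⟩ ⟨f₃⟩; exact Quot.sound (.tensor_assoc f₁ f₂ f₃))
    (leftUnitor_naturality := by rintro _ _ ⟨f⟩; exact Quot.sound (.unit_tensor f))
    (rightUnitor_naturality := by rintro _ _ ⟨f⟩; exact Quot.sound (.tensor_unit f))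
    (pentagon := fun W X Y Z =>
      (congrArg₂ (· ≫ ·) (tensor_eqTo_left _ Z)
        ((congrArg₂ (· ≫ ·) rfl (tensor_eqTo_right _ W)).trans (eqTo_trans _ _))).trans
        ((eqTo_trans _ _).trans (eqTo_trans _ _).symm))
    (triangle := fun X Y =>
      ((congrArg₂ (· ≫ ·) rfl (tensor_eqTo_right _ X)).trans (eqTo_trans _ _)).trans
        (tensor_eqTo_left _ Y).symm)

instance isStrict : IsStrict (Free S d) where
  tensor_assoc X Y Z := congrArg Free.mk (List.append_assoc X.word Y.word Z.word)
  unit_tensor X := congrArg Free.mk (List.nil_append X.word)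
  tensor_unit X := congrArg Free.mk (List.append_nil X.word)
  associator_eq X Y Z := (eqToHom_eq (List.append_assoc X.word Y.word Z.word)).symm
  leftUnitor_eq X := (eqToHom_eq (List.nil_append X.word)).symm
  rightUnitor_eq X := (eqToHom_eq (List.append_nil X.word)).symm

instance symmetric : SymmetricCategory (Free S d) where
  braiding X Y :=
    { hom := mk' (Term.swap X.word Y.word)
      inv := mk' (Term.swap Y.word X.word)
      hom_inv_id := Quot.sound (.swap_swap X.word Y.word)
      inv_hom_id := Quot.sound (.swap_swap Y.word X.word) }
  braiding_naturality_right X _ _ := by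
    rintro ⟨f⟩; exact Quot.sound (.swap_natural (Term.id X.word) f)
  braiding_naturality_left := by
    rintro _ _ ⟨f⟩ Z; exact Quot.sound (.swap_natural f (Term.id Z.word))
  hexagon_forward X Y Z := Quot.sound (.hexagon_forward X.word Y.word Z.word)
  hexagon_reverse X Y Z := Quot.sound (.hexagon_reverse X.word Y.word Z.word)
  symmetry X Y := Quot.sound (.swap_swap X.word Y.word)

/-- The comonoid structure on a word. -/
@[reducible] def comon (X : Free S d) : ComonObj X where
  counit := mk' (Term.del X.word)
  comul := mk' (Term.copy X.word)
  counit_comul := Quot.sound (.copy_del_left X.word)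
  comul_counit := Quot.sound (.copy_del_right X.word)
  comul_assoc := Quot.sound (.copy_assoc X.word)

instance copyDiscard : CopyDiscardCategory (Free S d) where
  comonObj := comon
  isCommComonObj X :=
    letI := comon X
    { comul_comm := Quot.sound (.copy_comm X.word) }
  copy_tensor X Y := Quot.sound (.copy_tensor X.word Y.word)
  discard_tensor X Y := Quot.sound (.del_tensor X.word Y.word)
  copy_unit := Quot.sound .copy_unit
  discard_unit := Quot.sound .del_unit

instance hypergraph : HypergraphCategory (Free S .hypergraph) where
  compare X := mk' (Term.compare rfl X.word)
  omni X := mk' (Term.omni rfl X.word)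
  omni_compare X := Quot.sound (.omni_compare rfl X.word)
  compare_omni X := Quot.sound (.compare_omni rfl X.word)
  compare_assoc X := Quot.sound (.compare_assoc rfl X.word)
  compare_comm X := Quot.sound (.compare_comm rfl X.word)
  compare_tensor X Y := Quot.sound (.compare_tensor rfl X.word Y.word)
  omni_tensor X Y := Quot.sound (.omni_tensor rfl X.word Y.word)
  compare_unit := Quot.sound (.compare_unit rfl)
  omni_unit := Quot.sound (.omni_unit rfl)
  special X := Quot.sound (.special rfl X.word)
  frobenius_left X := Quot.sound (.frobenius_left rfl X.word)
  frobenius_right X := Quot.sound (.frobenius_right rfl X.word)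

end Free

/-! ### Functors out of free categories -/

section Lift

set_option linter.unusedSectionVars false

variable {D : Type u} [Category.{v} D] [MonoidalCategory D]

/-- The value of a word, given the values of the generating objects. -/
def wordObj {B : Type w} (o : B → D) : List B → D
  | [] => 𝟙_ D
  | a :: l => o a ⊗ wordObj o l

theorem wordObj_append [IsStrict D] {B : Type w} (o : B → D) (X Y : List B) :
    wordObj o (X ++ Y) = wordObj o X ⊗ wordObj o Y := by
  induction X with
  | nil => exact (IsStrict.unit_tensor _).symm
  | cons a l ih =>
    change o a ⊗ wordObj o (l ++ Y) = (o a ⊗ wordObj o l) ⊗ wordObj o Y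
    rw [ih, IsStrict.tensor_assoc]

theorem associator_inv_eq [IsStrict D] (X Y Z : D) :
    (α_ X Y Z).inv = eqToHom (IsStrict.tensor_assoc X Y Z).symm := by
  rw [← cancel_epi (α_ X Y Z).hom, Iso.hom_inv_id, IsStrict.associator_eq, eqToHom_trans,
    eqToHom_refl]

theorem leftUnitor_inv_eq [IsStrict D] (X : D) :
    (λ_ X).inv = eqToHom (IsStrict.unit_tensor X).symm := by
  rw [← cancel_epi (λ_ X).hom, Iso.hom_inv_id, IsStrict.leftUnitor_eq, eqToHom_trans,
    eqToHom_refl]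

theorem rightUnitor_inv_eq [IsStrict D] (X : D) :
    (ρ_ X).inv = eqToHom (IsStrict.tensor_unit X).symm := by
  rw [← cancel_epi (ρ_ X).hom, Iso.hom_inv_id, IsStrict.rightUnitor_eq, eqToHom_trans,
    eqToHom_refl]

variable [CopyDiscardCategory D] [IsStrict D]

/-- The value of a term in a strict CD-category (with a hypergraph structure if needed), given the
values of the generators. -/
noncomputable def interp {S : Signature.{w}} {d : Doctrine}
    (hyp : d = .hypergraph → HypergraphCategory D) (o : S.Ob → D)
    (m : ∀ g : S.Gen, wordObj o (S.dom g) ⟶ wordObj o (S.cod g)) :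
    ∀ {X Y : List S.Ob}, Term S d X Y → (wordObj o X ⟶ wordObj o Y)
  | _, _, .id X => 𝟙 (wordObj o X)
  | _, _, .comp f g => interp hyp o m f ≫ interp hyp o m g
  | _, _, .tensor (X := X) (Y := Y) (Z := Z) (W := W) f g =>
    eqToHom (wordObj_append o X Z) ≫ (interp hyp o m f ⊗ₘ interp hyp o m g) ≫
      eqToHom (wordObj_append o Y W).symm
  | _, _, .eqTo h => eqToHom (congrArg (wordObj o) h)
  | _, _, .swap X Y =>
    eqToHom (wordObj_append o X Y) ≫ (β_ (wordObj o X) (wordObj o Y)).hom ≫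
      eqToHom (wordObj_append o Y X).symm
  | _, _, .copy X => copy (wordObj o X) ≫ eqToHom (wordObj_append o X X).symm
  | _, _, .del X => del (wordObj o X)
  | _, _, .compare h X =>
    letI := hyp h
    eqToHom (wordObj_append o X X) ≫ HypergraphCategory.compare (wordObj o X)
  | _, _, .omni h X =>
    letI := hyp h
    HypergraphCategory.omni (wordObj o X)
  | _, _, .gen g => m g

theorem mid_aux {X Y Z W : D} {XY ZW XY_ZW Y_ZW X_Y_ZW YZ YZ_W X_YZ_W ZY ZY_W X_ZY_W YW Z_YW X_Z_YW
    XZ XZ_YW : D} (e₁ : XY = X ⊗ Y) (e₂ : ZW = Z ⊗ W) (e₃ : XY_ZW = XY ⊗ ZW) (e₄ : Y_ZW = Y ⊗ ZW)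
    (e₅ : X_Y_ZW = X ⊗ Y_ZW) (e₆ : YZ = Y ⊗ Z) (e₇ : YZ_W = YZ ⊗ W) (e₈ : X_YZ_W = X ⊗ YZ_W)
    (e₉ : ZY = Z ⊗ Y) (f₁ : ZY_W = ZY ⊗ W) (f₂ : X_ZY_W = X ⊗ ZY_W) (f₃ : YW = Y ⊗ W)
    (f₄ : Z_YW = Z ⊗ YW) (f₅ : X_Z_YW = X ⊗ Z_YW) (f₆ : XZ = X ⊗ Z) (f₇ : XZ_YW = XZ ⊗ YW)
    (g₁ : XY_ZW = X_Y_ZW) (g₂ : Y_ZW = YZ_W) (g₃ : ZY_W = Z_YW) (g₄ : X_Z_YW = XZ_YW) :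
    eqToHom g₁ ≫ (eqToHom e₅ ≫ (𝟙 X ⊗ₘ eqToHom g₂) ≫ eqToHom e₈.symm) ≫
      (eqToHom e₈ ≫ (𝟙 X ⊗ₘ (eqToHom e₇ ≫ ((eqToHom e₆ ≫ (β_ Y Z).hom ≫ eqToHom e₉.symm) ⊗ₘ 𝟙 W) ≫
        eqToHom f₁.symm)) ≫ eqToHom f₂.symm) ≫
      (eqToHom f₂ ≫ (𝟙 X ⊗ₘ eqToHom g₃) ≫ eqToHom f₅.symm) ≫ eqToHom g₄ =
    eqToHom e₃ ≫ eqToHom (by rw [e₁, e₂]) ≫ tensorμ X Y Z W ≫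
      eqToHom (by rw [← f₆, ← f₃]) ≫ eqToHom f₇.symm := by
  subst e₁ e₂ e₃ e₄ e₅ e₆ e₇ e₈ e₉ f₁ f₂ f₃ f₄ f₅ f₆ f₇
  simp [tensorμ, IsStrict.associator_eq, associator_inv_eq]


theorem tensor_assoc_aux {X₁ X₂ X₃ Y₁ Y₂ Y₃ : D} (f₁ : X₁ ⟶ Y₁) (f₂ : X₂ ⟶ Y₂) (f₃ : X₃ ⟶ Y₃)
    {A A' B B' P P' Q Q' : D} (hA : A = X₁ ⊗ X₂) (hB : B = A ⊗ X₃) (hP : P = X₂ ⊗ X₃)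
    (hQ : Q = X₁ ⊗ P) (hA' : A' = Y₁ ⊗ Y₂) (hB' : B' = A' ⊗ Y₃) (hP' : P' = Y₂ ⊗ Y₃)
    (hQ' : Q' = Y₁ ⊗ P') (e : B = Q) (e' : B' = Q') :
    (eqToHom hB ≫ ((eqToHom hA ≫ (f₁ ⊗ₘ f₂) ≫ eqToHom hA'.symm) ⊗ₘ f₃) ≫ eqToHom hB'.symm) ≫
      eqToHom e' =
    eqToHom e ≫ eqToHom hQ ≫ (f₁ ⊗ₘ (eqToHom hP ≫ (f₂ ⊗ₘ f₃) ≫ eqToHom hP'.symm)) ≫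
      eqToHom hQ'.symm := by
  subst hA hB hP hQ hA' hB' hP' hQ'
  have := MonoidalCategory.associator_naturality f₁ f₂ f₃
  rw [IsStrict.associator_eq, IsStrict.associator_eq] at this
  simpa using this

theorem hexagon_forward_aux {X Y Z XY XY_Z YZ X_YZ YZ_X ZX Y_ZX YX YX_Z XZ Y_XZ : D}
    (e₁ : XY = X ⊗ Y) (e₂ : XY_Z = XY ⊗ Z) (e₃ : YZ = Y ⊗ Z) (e₄ : X_YZ = X ⊗ YZ)
    (e₅ : YZ_X = YZ ⊗ X) (e₆ : ZX = Z ⊗ X) (e₇ : Y_ZX = Y ⊗ ZX) (e₈ : YX = Y ⊗ X)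
    (e₉ : YX_Z = YX ⊗ Z) (f₁ : XZ = X ⊗ Z) (f₂ : Y_XZ = Y ⊗ XZ) (g₁ : XY_Z = X_YZ)
    (g₂ : YZ_X = Y_ZX) (g₃ : YX_Z = Y_XZ) :
    eqToHom g₁ ≫ (eqToHom e₄ ≫ (β_ X YZ).hom ≫ eqToHom e₅.symm) ≫ eqToHom g₂ =
    (eqToHom e₂ ≫ ((eqToHom e₁ ≫ (β_ X Y).hom ≫ eqToHom e₈.symm) ⊗ₘ 𝟙 Z) ≫ eqToHom e₉.symm) ≫
      eqToHom g₃ ≫ eqToHom f₂ ≫ (𝟙 Y ⊗ₘ (eqToHom f₁ ≫ (β_ X Z).hom ≫ eqToHom e₆.symm)) ≫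
        eqToHom e₇.symm := by
  subst e₁ e₂ e₃ e₄ e₅ e₆ e₇ e₈ e₉ f₁ f₂
  have := BraidedCategory.hexagon_forward X Y Z
  simp only [IsStrict.associator_eq] at this
  simpa using this

theorem hexagon_reverse_aux {X Y Z YZ X_YZ XY XY_Z Z_XY ZX ZX_Y ZY X_ZY XZ XZ_Y : D}
    (e₁ : YZ = Y ⊗ Z) (e₂ : X_YZ = X ⊗ YZ) (e₃ : XY = X ⊗ Y) (e₄ : XY_Z = XY ⊗ Z)
    (e₅ : Z_XY = Z ⊗ XY) (e₆ : ZX = Z ⊗ X) (e₇ : ZX_Y = ZX ⊗ Y) (e₈ : ZY = Z ⊗ Y)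
    (e₉ : X_ZY = X ⊗ ZY) (f₁ : XZ = X ⊗ Z) (f₂ : XZ_Y = XZ ⊗ Y) (g₁ : X_YZ = XY_Z)
    (g₂ : Z_XY = ZX_Y) (g₃ : X_ZY = XZ_Y) :
    eqToHom g₁ ≫ (eqToHom e₄ ≫ (β_ XY Z).hom ≫ eqToHom e₅.symm) ≫ eqToHom g₂ =
    (eqToHom e₂ ≫ (𝟙 X ⊗ₘ (eqToHom e₁ ≫ (β_ Y Z).hom ≫ eqToHom e₈.symm)) ≫ eqToHom e₉.symm) ≫
      eqToHom g₃ ≫ eqToHom f₂ ≫ ((eqToHom f₁ ≫ (β_ X Z).hom ≫ eqToHom e₆.symm) ⊗ₘ 𝟙 Y) ≫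
        eqToHom e₇.symm := by
  subst e₁ e₂ e₃ e₄ e₅ e₆ e₇ e₈ e₉ f₁ f₂
  have := BraidedCategory.hexagon_reverse X Y Z
  simp only [associator_inv_eq] at this
  simpa using this

theorem copy_tensor_aux {X Y XY XX YY XY_XY XX_YY : D} {M : XX_YY ⟶ XY_XY} (e₁ : XY = X ⊗ Y)
    (e₂ : XX = X ⊗ X) (e₃ : YY = Y ⊗ Y) (e₄ : XY_XY = XY ⊗ XY) (e₅ : XX_YY = XX ⊗ YY)
    (hM : M = eqToHom e₅ ≫ eqToHom (by rw [e₂, e₃]) ≫ tensorμ X X Y Y ≫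
      eqToHom (by rw [← e₁]) ≫ eqToHom e₄.symm) :
    copy XY ≫ eqToHom e₄.symm =
      (eqToHom e₁ ≫ ((copy X ≫ eqToHom e₂.symm) ⊗ₘ (copy Y ≫ eqToHom e₃.symm)) ≫
        eqToHom e₅.symm) ≫ M := by
  subst e₁ e₂ e₃ e₄ e₅ hM
  have := CopyDiscardCategory.copy_tensor X Y
  simpa using this

theorem compare_tensor_aux [HypergraphCategory D] {X Y XY XX YY XY_XY XX_YY : D}
    {M : XY_XY ⟶ XX_YY} (e₁ : XY = X ⊗ Y)
    (e₂ : XX = X ⊗ X) (e₃ : YY = Y ⊗ Y) (e₄ : XY_XY = XY ⊗ XY) (e₅ : XX_YY = XX ⊗ YY)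
    (hM : M = eqToHom e₄ ≫ eqToHom (by rw [e₁]) ≫ tensorμ X Y X Y ≫
      eqToHom (by rw [← e₂, ← e₃]) ≫ eqToHom e₅.symm) :
    eqToHom e₄ ≫ HypergraphCategory.compare XY =
      M ≫ eqToHom e₅ ≫ ((eqToHom e₂ ≫ HypergraphCategory.compare X) ⊗ₘ
        (eqToHom e₃ ≫ HypergraphCategory.compare Y)) ≫ eqToHom e₁.symm := by
  subst e₁ e₂ e₃ e₄ e₅ hM
  have := HypergraphCategory.compare_tensor X Y
  simpa using this

theorem assoc_aux {X XX XX_X X_XX : D} (e₁ : XX = X ⊗ X) (e₂ : XX_X = XX ⊗ X)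
    (e₃ : X_XX = X ⊗ XX) (g : XX_X = X_XX) :
    (copy X ≫ eqToHom e₁.symm) ≫ eqToHom e₁ ≫ (𝟙 X ⊗ₘ (copy X ≫ eqToHom e₁.symm)) ≫
      eqToHom e₃.symm =
    (copy X ≫ eqToHom e₁.symm) ≫ (eqToHom e₁ ≫ ((copy X ≫ eqToHom e₁.symm) ⊗ₘ 𝟙 X) ≫
      eqToHom e₂.symm) ≫ eqToHom g := by
  subst e₁ e₂ e₃
  have := ComonObj.comul_assoc (X := X)
  rw [IsStrict.associator_eq] at this
  simpa using this

theorem compare_assoc_aux [HypergraphCategory D] {X XX XX_X X_XX : D} (e₁ : XX = X ⊗ X)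
    (e₂ : XX_X = XX ⊗ X) (e₃ : X_XX = X ⊗ XX) (g : XX_X = X_XX) :
    (eqToHom e₂ ≫ ((eqToHom e₁ ≫ HypergraphCategory.compare X) ⊗ₘ 𝟙 X) ≫ eqToHom e₁.symm) ≫
      eqToHom e₁ ≫ HypergraphCategory.compare X =
    eqToHom g ≫ (eqToHom e₃ ≫ (𝟙 X ⊗ₘ (eqToHom e₁ ≫ HypergraphCategory.compare X)) ≫
      eqToHom e₁.symm) ≫ eqToHom e₁ ≫ HypergraphCategory.compare X := by
  subst e₁ e₂ e₃
  have := HypergraphCategory.compare_assoc X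
  rw [IsStrict.associator_eq] at this
  simpa using this

theorem frobenius_left_aux [HypergraphCategory D] {X XX XX_X X_XX : D} (e₁ : XX = X ⊗ X)
    (e₂ : XX_X = XX ⊗ X) (e₃ : X_XX = X ⊗ XX) (g : XX_X = X_XX) :
    (eqToHom e₁ ≫ ((copy X ≫ eqToHom e₁.symm) ⊗ₘ 𝟙 X) ≫ eqToHom e₂.symm) ≫ eqToHom g ≫
      eqToHom e₃ ≫ (𝟙 X ⊗ₘ (eqToHom e₁ ≫ HypergraphCategory.compare X)) ≫ eqToHom e₁.symm =
    (eqToHom e₁ ≫ HypergraphCategory.compare X) ≫ copy X ≫ eqToHom e₁.symm := by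
  subst e₁ e₂ e₃
  have := HypergraphCategory.frobenius_left X
  rw [IsStrict.associator_eq] at this
  simpa using this

theorem frobenius_right_aux [HypergraphCategory D] {X XX XX_X X_XX : D} (e₁ : XX = X ⊗ X)
    (e₂ : XX_X = XX ⊗ X) (e₃ : X_XX = X ⊗ XX) (g : X_XX = XX_X) :
    (eqToHom e₁ ≫ (𝟙 X ⊗ₘ (copy X ≫ eqToHom e₁.symm)) ≫ eqToHom e₃.symm) ≫ eqToHom g ≫
      eqToHom e₂ ≫ ((eqToHom e₁ ≫ HypergraphCategory.compare X) ⊗ₘ 𝟙 X) ≫ eqToHom e₁.symm =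
    (eqToHom e₁ ≫ HypergraphCategory.compare X) ≫ copy X ≫ eqToHom e₁.symm := by
  subst e₁ e₂ e₃
  have := HypergraphCategory.frobenius_right X
  rw [associator_inv_eq] at this
  simpa using this

theorem unit_tensor_aux {X Y P P' : D} (f : X ⟶ Y) (e₁ : P = 𝟙_ D ⊗ X) (e₂ : P' = 𝟙_ D ⊗ Y)
    (g : P = X) (g' : P' = Y) :
    (eqToHom e₁ ≫ (𝟙 (𝟙_ D) ⊗ₘ f) ≫ eqToHom e₂.symm) ≫ eqToHom g' = eqToHom g ≫ f := by
  subst e₁ e₂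
  have := MonoidalCategory.leftUnitor_naturality f
  simp only [IsStrict.leftUnitor_eq] at this
  simp only [MonoidalCategory.id_tensorHom, eqToHom_refl, Category.id_comp, Category.comp_id]
  exact this

theorem tensor_unit_aux {X Y P P' : D} (f : X ⟶ Y) (e₁ : P = X ⊗ 𝟙_ D) (e₂ : P' = Y ⊗ 𝟙_ D)
    (g : P = X) (g' : P' = Y) :
    (eqToHom e₁ ≫ (f ⊗ₘ 𝟙 (𝟙_ D)) ≫ eqToHom e₂.symm) ≫ eqToHom g' = eqToHom g ≫ f := by
  subst e₁ e₂
  have := MonoidalCategory.rightUnitor_naturality f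
  simp only [IsStrict.rightUnitor_eq] at this
  simp only [MonoidalCategory.tensorHom_id, eqToHom_refl, Category.id_comp, Category.comp_id]
  exact this

theorem copy_del_left_aux {X XX P : D} (e₁ : XX = X ⊗ X) (e₂ : P = 𝟙_ D ⊗ X) (g : X = P) :
    (copy X ≫ eqToHom e₁.symm) ≫ eqToHom e₁ ≫ (del X ⊗ₘ 𝟙 X) ≫ eqToHom e₂.symm =
      eqToHom g := by
  subst e₁ e₂
  have := ComonObj.counit_comul (X := X)
  rw [leftUnitor_inv_eq] at this
  simpa using this

theorem copy_del_right_aux {X XX P : D} (e₁ : XX = X ⊗ X) (e₂ : P = X ⊗ 𝟙_ D) (g : X = P) :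
    (copy X ≫ eqToHom e₁.symm) ≫ eqToHom e₁ ≫ (𝟙 X ⊗ₘ del X) ≫ eqToHom e₂.symm =
      eqToHom g := by
  subst e₁ e₂
  have := ComonObj.comul_counit (X := X)
  rw [rightUnitor_inv_eq] at this
  simpa using this

theorem del_tensor_aux {X Y XY P : D} (e₁ : XY = X ⊗ Y) (e₂ : P = 𝟙_ D ⊗ 𝟙_ D) (g : P = 𝟙_ D) :
    del XY = (eqToHom e₁ ≫ (del X ⊗ₘ del Y) ≫ eqToHom e₂.symm) ≫ eqToHom g := by
  subst e₁ e₂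
  have := CopyDiscardCategory.discard_tensor X Y
  rw [IsStrict.leftUnitor_eq] at this
  simpa only [eqToHom_refl, Category.id_comp, Category.comp_id] using this

theorem copy_unit_aux {P : D} (e : P = 𝟙_ D ⊗ 𝟙_ D) (g : 𝟙_ D = P) :
    copy (𝟙_ D) ≫ eqToHom e.symm = eqToHom g := by
  subst e
  have := CopyDiscardCategory.copy_unit (C := D)
  rw [leftUnitor_inv_eq] at this
  simpa only [eqToHom_refl, Category.id_comp, Category.comp_id] using this

theorem omni_compare_aux [HypergraphCategory D] {X XX P : D} (e₁ : XX = X ⊗ X)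
    (e₂ : P = 𝟙_ D ⊗ X) (g : P = X) :
    (eqToHom e₂ ≫ (HypergraphCategory.omni X ⊗ₘ 𝟙 X) ≫ eqToHom e₁.symm) ≫ eqToHom e₁ ≫
      HypergraphCategory.compare X = eqToHom g := by
  subst e₁ e₂
  have := HypergraphCategory.omni_compare X
  rw [IsStrict.leftUnitor_eq] at this
  simpa using this

theorem compare_omni_aux [HypergraphCategory D] {X XX P : D} (e₁ : XX = X ⊗ X)
    (e₂ : P = X ⊗ 𝟙_ D) (g : P = X) :
    (eqToHom e₂ ≫ (𝟙 X ⊗ₘ HypergraphCategory.omni X) ≫ eqToHom e₁.symm) ≫ eqToHom e₁ ≫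
      HypergraphCategory.compare X = eqToHom g := by
  subst e₁ e₂
  have := HypergraphCategory.compare_omni X
  rw [IsStrict.rightUnitor_eq] at this
  simpa using this

theorem omni_tensor_aux [HypergraphCategory D] {X Y XY P : D} (e₁ : XY = X ⊗ Y)
    (e₂ : P = 𝟙_ D ⊗ 𝟙_ D) (g : 𝟙_ D = P) :
    HypergraphCategory.omni XY = eqToHom g ≫ eqToHom e₂ ≫
      (HypergraphCategory.omni X ⊗ₘ HypergraphCategory.omni Y) ≫ eqToHom e₁.symm := by
  subst e₁ e₂
  have := HypergraphCategory.omni_tensor X Y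
  rw [leftUnitor_inv_eq] at this
  simpa only [eqToHom_refl, Category.id_comp, Category.comp_id] using this

theorem compare_unit_aux [HypergraphCategory D] {P : D} (e : P = 𝟙_ D ⊗ 𝟙_ D) (g : P = 𝟙_ D) :
    eqToHom e ≫ HypergraphCategory.compare (𝟙_ D) = eqToHom g := by
  subst e
  have := HypergraphCategory.compare_unit (C := D)
  rw [IsStrict.leftUnitor_eq] at this
  simpa only [eqToHom_refl, Category.id_comp, Category.comp_id] using this

section Sound

variable {S : Signature.{w}} {d : Doctrine} (hyp : d = .hypergraph → HypergraphCategory D)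
  (o : S.Ob → D) (m : ∀ g : S.Gen, wordObj o (S.dom g) ⟶ wordObj o (S.cod g))

theorem interp_mid (X Y Z W : List S.Ob) :
    interp hyp o m (Term.mid X Y Z W) =
      eqToHom (wordObj_append o _ _) ≫ eqToHom (by rw [wordObj_append, wordObj_append]) ≫
        tensorμ (wordObj o X) (wordObj o Y) (wordObj o Z) (wordObj o W) ≫
        eqToHom (by rw [wordObj_append, wordObj_append]) ≫ eqToHom (wordObj_append o _ _).symm :=
  mid_aux (wordObj_append o _ _) (wordObj_append o _ _) (wordObj_append o _ _)
    (wordObj_append o _ _) (wordObj_append o _ _) (wordObj_append o _ _) (wordObj_append o _ _)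
    (wordObj_append o _ _) (wordObj_append o _ _) (wordObj_append o _ _) (wordObj_append o _ _)
    (wordObj_append o _ _) (wordObj_append o _ _) (wordObj_append o _ _) (wordObj_append o _ _)
    (wordObj_append o _ _) _ _ _ _

/-- The interpretation respects the equations. -/
theorem interp_rel {X Y : List S.Ob} {f g : Term S d X Y} (h : Term.Rel f g) :
    interp hyp o m f = interp hyp o m g := by
  induction h with
  | comp_left g _ ih => simp only [interp, ih]
  | comp_right f _ ih => simp only [interp, ih]
  | tensor_left g _ ih => simp only [interp, ih]
  | tensor_right f _ ih => simp only [interp, ih]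
  | id_comp f => simp [interp]
  | comp_id f => simp [interp]
  | comp_assoc f g h => simp [interp]
  | eqTo_refl h => simp [interp]
  | tensor_id X Y => simp [interp]
  | tensor_comp => simp [interp]
  | tensor_assoc =>
    exact tensor_assoc_aux _ _ _ (wordObj_append o _ _) (wordObj_append o _ _)
      (wordObj_append o _ _) (wordObj_append o _ _) (wordObj_append o _ _) (wordObj_append o _ _)
      (wordObj_append o _ _) (wordObj_append o _ _) _ _
  | unit_tensor f =>
    exact unit_tensor_aux _ (wordObj_append o _ _) (wordObj_append o _ _) _ _
  | tensor_unit f =>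
    exact tensor_unit_aux _ (wordObj_append o _ _) (wordObj_append o _ _) _ _
  | swap_natural f g => simp [interp]
  | swap_swap X Y => simp [interp]
  | hexagon_forward X Y Z =>
    exact hexagon_forward_aux (wordObj_append o _ _) (wordObj_append o _ _) (wordObj_append o _ _)
      (wordObj_append o _ _) (wordObj_append o _ _) (wordObj_append o _ _) (wordObj_append o _ _)
      (wordObj_append o _ _) (wordObj_append o _ _) (wordObj_append o _ _) (wordObj_append o _ _)
      _ _ _
  | hexagon_reverse X Y Z =>
    exact hexagon_reverse_aux (wordObj_append o _ _) (wordObj_append o _ _) (wordObj_append o _ _)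
      (wordObj_append o _ _) (wordObj_append o _ _) (wordObj_append o _ _) (wordObj_append o _ _)
      (wordObj_append o _ _) (wordObj_append o _ _) (wordObj_append o _ _) (wordObj_append o _ _)
      _ _ _
  | copy_del_left X =>
    exact copy_del_left_aux (wordObj_append o _ _) (wordObj_append o _ _) _
  | copy_del_right X =>
    exact copy_del_right_aux (wordObj_append o _ _) (wordObj_append o _ _) _
  | copy_assoc X =>
    exact assoc_aux (wordObj_append o _ _) (wordObj_append o _ _) (wordObj_append o _ _) _
  | copy_comm X =>
    simp [interp]
  | copy_tensor X Y =>
    exact copy_tensor_aux (wordObj_append o _ _) (wordObj_append o _ _) (wordObj_append o _ _)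
      (wordObj_append o _ _) (wordObj_append o _ _) (interp_mid hyp o m X X Y Y)
  | del_tensor X Y =>
    exact del_tensor_aux (wordObj_append o _ _) (wordObj_append o _ _) _
  | copy_unit => exact copy_unit_aux (wordObj_append o _ _) _
  | del_unit => exact CopyDiscardCategory.discard_unit
  | omni_compare h X =>
    let _ := hyp h
    exact omni_compare_aux (wordObj_append o _ _) (wordObj_append o _ _) _
  | compare_omni h X =>
    let _ := hyp h
    exact compare_omni_aux (wordObj_append o _ _) (wordObj_append o _ _) _
  | compare_assoc h X =>
    let _ := hyp h
    exact compare_assoc_aux (wordObj_append o _ _) (wordObj_append o _ _) (wordObj_append o _ _) _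
  | compare_comm h X =>
    let _ := hyp h
    have := HypergraphCategory.compare_comm (wordObj o X)
    simp [interp, this]
  | compare_tensor h X Y =>
    let _ := hyp h
    exact compare_tensor_aux (wordObj_append o _ _) (wordObj_append o _ _) (wordObj_append o _ _)
      (wordObj_append o _ _) (wordObj_append o _ _) (interp_mid hyp o m X Y X Y)
  | omni_tensor h X Y =>
    let _ := hyp h
    exact omni_tensor_aux (wordObj_append o _ _) (wordObj_append o _ _) _
  | compare_unit h =>
    let _ := hyp h
    exact compare_unit_aux (wordObj_append o _ _) _
  | omni_unit h =>
    let _ := hyp h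
    exact HypergraphCategory.omni_unit
  | special h X =>
    let _ := hyp h
    have := HypergraphCategory.special (wordObj o X)
    simpa [interp] using this
  | frobenius_left h X =>
    let _ := hyp h
    exact frobenius_left_aux (wordObj_append o _ _) (wordObj_append o _ _) (wordObj_append o _ _) _
  | frobenius_right h X =>
    let _ := hyp h
    exact frobenius_right_aux (wordObj_append o _ _) (wordObj_append o _ _) (wordObj_append o _ _) _

end Sound

end Lift

/-- The CD-functor out of a free category determined by the images of the generators. -/
noncomputable def lift {D : Type u} [Category.{v} D] [MonoidalCategory D] [CopyDiscardCategory D]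
    [IsStrict D] {S : Signature.{w}} {d : Doctrine} (hyp : d = .hypergraph → HypergraphCategory D)
    (o : S.Ob → D) (m : ∀ g : S.Gen, wordObj o (S.dom g) ⟶ wordObj o (S.cod g)) :
    CDFunctor (Free S d) D where
  obj X := wordObj o X.word
  map f := Quot.lift (interp hyp o m) (fun _ _ h => interp_rel hyp o m h) f
  map_id _ := rfl
  map_comp := by rintro X Y Z ⟨f⟩ ⟨g⟩; rfl
  obj_unit := rfl
  obj_tensor X Y := wordObj_append o X.word Y.word
  map_tensor := by rintro X Y Z W ⟨f⟩ ⟨g⟩; rfl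
  map_braiding _ _ := rfl
  map_copy _ := rfl
  map_del _ := (Category.comp_id _).symm

/-- The CD-functor out of a free CD-category determined by the images of the generators. -/
noncomputable def liftCD {D : Type u} [Category.{v} D] [MonoidalCategory D]
    [CopyDiscardCategory D] [IsStrict D] {S : Signature.{w}} (o : S.Ob → D)
    (m : ∀ g : S.Gen, wordObj o (S.dom g) ⟶ wordObj o (S.cod g)) : CDFunctor (Free S .cd) D :=
  lift (fun h => nomatch h) o m

/-- The hypergraph functor out of a free hypergraph category determined by the images of the
generators. -/
noncomputable def liftHyp {D : Type u} [Category.{v} D] [MonoidalCategory D]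
    [CopyDiscardCategory D] [IsStrict D] [HypergraphCategory D] {S : Signature.{w}} (o : S.Ob → D)
    (m : ∀ g : S.Gen, wordObj o (S.dom g) ⟶ wordObj o (S.cod g)) :
    HypFunctor (Free S .hypergraph) D where
  toCDFunctor := lift (fun _ => inferInstance) o m
  map_compare _ := rfl
  map_omni _ := (Category.id_comp _).symm

/-! ### Ordered graphs -/

/-- A finite ordered DAG: a finite directed graph with a total order on the vertices such that
`v → w` implies `v < w`. -/
structure ODAG where
  V : Type w
  [linearOrder : LinearOrder V]
  [fintype : Fintype V]
  edge : V → V → Prop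
  lt_of_edge : ∀ {v w : V}, edge v w → v < w

attribute [instance] ODAG.linearOrder ODAG.fintype

/-- A finite ordered undirected graph: a finite simple graph with a total order on the vertices. -/
structure OUGr where
  V : Type w
  [linearOrder : LinearOrder V]
  [fintype : Fintype V]
  graph : SimpleGraph V

attribute [instance] OUGr.linearOrder OUGr.fintype

namespace ODAG

/-- An order-preserving graph homomorphism. An edge between two vertices with the same image
is regarded as preserved. -/
@[ext]
structure Hom (G G' : ODAG.{w}) where
  toFun : G.V → G'.V
  map_le : ∀ {v w : G.V}, v ≤ w → toFun v ≤ toFun w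
  map_edge : ∀ {v w : G.V}, G.edge v w → toFun v = toFun w ∨ G'.edge (toFun v) (toFun w)

instance category : Category ODAG.{w} where
  Hom := Hom
  id G := ⟨id, fun h => h, Or.inr⟩
  comp α β := ⟨β.toFun ∘ α.toFun, fun h => β.map_le (α.map_le h), fun h =>
    (α.map_edge h).elim (fun h' => Or.inl (congrArg β.toFun h')) β.map_edge⟩

/-- The vertices in ascending order. -/
noncomputable def verts (G : ODAG.{w}) : List G.V := Finset.univ.sort (· ≤ ·)

open scoped Classical in
/-- The parents of a vertex in ascending order. -/
noncomputable def parents (G : ODAG.{w}) (v : G.V) : List G.V :=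
  (Finset.univ.filter fun u => G.edge u v).sort (· ≤ ·)

/-- The signature of an ordered DAG: the generating objects are the vertices, and each vertex
gives a generator from its parents to itself. -/
@[reducible]
noncomputable def sig (G : ODAG.{w}) : Signature.{w} where
  Ob := G.V
  Gen := G.V
  dom v := G.parents v
  cod v := [v]

end ODAG

namespace OUGr

/-- An order-preserving graph homomorphism. An edge between two vertices with the same image
is regarded as preserved. -/
@[ext]
structure Hom (H H' : OUGr.{w}) where
  toFun : H.V → H'.V
  map_le : ∀ {v w : H.V}, v ≤ w → toFun v ≤ toFun w
  map_adj : ∀ {v w : H.V}, H.graph.Adj v w →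
    toFun v = toFun w ∨ H'.graph.Adj (toFun v) (toFun w)

instance category : Category OUGr.{w} where
  Hom := Hom
  id H := ⟨id, fun h => h, Or.inr⟩
  comp α β := ⟨β.toFun ∘ α.toFun, fun h => β.map_le (α.map_le h), fun h =>
    (α.map_adj h).elim (fun h' => Or.inl (congrArg β.toFun h')) β.map_adj⟩

/-- The vertices in ascending order. -/
noncomputable def verts (H : OUGr.{w}) : List H.V := Finset.univ.sort (· ≤ ·)

/-- The (nonempty) cliques of the graph. -/
def Clique (H : OUGr.{w}) : Type w :=
  {C : Finset H.V // C.Nonempty ∧ H.graph.IsClique (C : Set H.V)}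

/-- The signature of an ordered undirected graph: the generating objects are the vertices, and each
clique `C` gives a generator from the empty word to the word of the elements of `C`. -/
@[reducible]
noncomputable def sig (H : OUGr.{w}) : Signature.{w} where
  Ob := H.V
  Gen := H.Clique
  dom _ := []
  cod C := C.1.sort (· ≤ ·)

/-- The triangulation of an ordered undirected graph: `v → w` when `v < w` and there is a path
`v — w₁ — ⋯ — wₙ = w` with `n ≥ 1` and `wᵢ ≥ w` for each `i`. -/
def triangulation (H : OUGr.{w}) : ODAG.{w} where
  V := H.V
  edge v w := v < w ∧ Relation.TransGen (fun a b => H.graph.Adj a b ∧ w ≤ b) v w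
  lt_of_edge h := h.1

end OUGr

/-! ### Copy-composition and compare-composition -/

namespace Term

variable {S : Signature.{w}} {d : Doctrine}

open scoped Classical in
/-- The projection of a word to one of its letters, deleting all the others. -/
noncomputable def proj (v : S.Ob) : (l : List S.Ob) → v ∈ l → Term S d l [v]
  | [], h => absurd h List.not_mem_nil
  | a :: l, h =>
    if e : a = v then
      ((Term.id [a]).tensor (Term.del l)).comp (Term.eqTo (e ▸ rfl : [a] = [v]))
    else
      (Term.del [a]).tensor (proj v l (List.mem_of_ne_of_mem (Ne.symm e) h))

/-- The wiring from a word `l` to a word all of whose letters occur in `l`, copying, deleting and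
permuting letters as necessary. -/
noncomputable def wire (l : List S.Ob) : (l' : List S.Ob) → (∀ v ∈ l', v ∈ l) → Term S d l l'
  | [], _ => Term.del l
  | v :: l', h =>
    (Term.copy l).comp ((proj v l (h v List.mem_cons_self)).tensor
      (wire l l' fun u hu => h u (List.mem_cons_of_mem v hu)))

open scoped Classical in
/-- The transpose of `Term.proj`. -/
noncomputable def inj (v : S.Ob) : (l : List S.Ob) → v ∈ l → Term S .hypergraph [v] l
  | [], h => absurd h List.not_mem_nil
  | a :: l, h =>
    if e : a = v then
      (Term.eqTo (e ▸ rfl : [v] = [a])).comp ((Term.id [a]).tensor (Term.omni rfl l))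
    else
      (Term.omni rfl [a]).tensor (inj v l (List.mem_of_ne_of_mem (Ne.symm e) h))

/-- The transpose of `Term.wire`: the wiring that compares all the occurrences of each letter. -/
noncomputable def merge (l' : List S.Ob) :
    (l : List S.Ob) → (∀ v ∈ l, v ∈ l') → Term S .hypergraph l l'
  | [], _ => Term.omni rfl l'
  | v :: l, h =>
    ((inj v l' (h v List.mem_cons_self)).tensor
      (merge l' l fun u hu => h u (List.mem_cons_of_mem v hu))).comp (Term.compare rfl l')

end Term

namespace ODAG

variable (G : ODAG.{w})

/-- The list `l` contains, after each of its elements, all the parents of that element. -/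
def Closed : List G.V → Prop
  | [] => True
  | v :: l => (∀ u ∈ G.parents v, u ∈ l) ∧ Closed l

/-- The copy-composition of the generators of the vertices in a list. The head of the list, which
plays the role of the biggest vertex, is computed from copies of its parents. -/
noncomputable def copyCompList : (l : List G.V) → G.Closed l → Term G.sig .cd [] l
  | [], _ => Term.id []
  | v :: l, h =>
    (copyCompList l h.2).comp <| (Term.copy (S := G.sig) l).comp <|
      ((Term.wire (S := G.sig) l (G.parents v) h.1).comp (Term.gen (S := G.sig) v)).tensor
        (Term.id (S := G.sig) l)

/-- The vertices in descending order. -/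
noncomputable def vertsDesc : List G.V := Finset.univ.sort (· ≥ ·)

theorem closed_of_pairwise (l : List G.V) (h : l.Pairwise (· > ·))
    (h' : ∀ v ∈ l, ∀ u < v, u ∈ l) : G.Closed l := by
  induction l with
  | nil => trivial
  | cons v l ih =>
    rw [List.pairwise_cons] at h
    refine ⟨fun u hu => ?_, ih h.2 fun w hw u hu => ?_⟩
    · have hlt : u < v := by
        classical
        simp only [parents, Finset.mem_sort, Finset.mem_filter] at hu
        exact G.lt_of_edge hu.2
      exact List.mem_of_ne_of_mem hlt.ne (h' v List.mem_cons_self u hlt)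
    · exact List.mem_of_ne_of_mem (hu.trans (h.1 w hw)).ne
        (h' w (List.mem_cons_of_mem v hw) u hu)

theorem closed_vertsDesc : G.Closed G.vertsDesc := by
  refine G.closed_of_pairwise _ ?_ fun _ _ u _ => (Finset.mem_sort _).2 (Finset.mem_univ u)
  exact (Finset.sortedGT_sort Finset.univ).pairwise

/-- The copy-composition of all the generators. -/
noncomputable def copyComp : Term G.sig .cd [] G.verts :=
  (G.copyCompList G.vertsDesc G.closed_vertsDesc).comp <|
    Term.wire (S := G.sig) G.vertsDesc G.verts fun u _ => (Finset.mem_sort _).2 (Finset.mem_univ u)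

end ODAG

namespace OUGr

variable (H : OUGr.{w})

/-- The vertices occurring in a list of cliques. -/
def out : List H.Clique → Finset H.V
  | [] => ∅
  | C :: S => C.1 ∪ out S

theorem subset_out (S : List H.Clique) (C : H.Clique) (h : C ∈ S) : C.1 ⊆ H.out S := by
  induction S with
  | nil => exact absurd h List.not_mem_nil
  | cons D S ih =>
    rcases List.mem_cons.1 h with rfl | h
    · exact Finset.subset_union_left
    · exact (ih h).trans Finset.subset_union_right

/-- The compare-composition of the generators of a list of cliques. -/
noncomputable def compareCompList :
    (S : List H.Clique) → Term H.sig .hypergraph [] ((H.out S).sort (· ≤ ·))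
  | [] => Term.eqTo (Finset.sort_empty (· ≤ ·)).symm
  | C :: S =>
    ((Term.gen (S := H.sig) C).tensor (compareCompList S)).comp <|
      Term.merge (S := H.sig) ((H.out (C :: S)).sort (· ≤ ·))
        (C.1.sort (· ≤ ·) ++ (H.out S).sort (· ≤ ·)) fun v hv => by
          simpa [out] using hv

noncomputable instance : Fintype H.Clique :=
  haveI : Finite H.Clique := inferInstanceAs (Finite (Subtype _))
  Fintype.ofFinite _

/-- A list of all the cliques, in an arbitrary order. -/
noncomputable def cliques : List H.Clique := Finset.univ.toList

theorem out_cliques : H.out H.cliques = Finset.univ := by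
  refine Finset.eq_univ_of_forall fun v => ?_
  refine H.subset_out H.cliques ⟨{v}, Finset.singleton_nonempty v, by simp⟩ ?_
    (Finset.mem_singleton_self v)
  exact Finset.mem_toList.2 (Finset.mem_univ _)

/-- The compare-composition of all the generators. -/
noncomputable def compareComp : Term H.sig .hypergraph [] H.verts :=
  (H.compareCompList H.cliques).comp <|
    Term.eqTo (congrArg (fun s : Finset H.V => s.sort (· ≤ ·)) H.out_cliques)

end OUGr

/-! ### Distributions and their factorisations -/

/-- The signature with a single generating object and a single generator from the empty word to
that object. -/
@[reducible]
def pointSig : Signature.{0} where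
  Ob := Unit
  Gen := Unit
  dom _ := []
  cod _ := [()]

/-- The free CD-category on one object with one state. -/
abbrev CDSynPoint : Type := Free pointSig .cd

/-- The free hypergraph category on one object with one state. -/
abbrev SynPoint : Type := Free pointSig .hypergraph

/-- The free CD-category on an ordered DAG. -/
abbrev CDSyn (G : ODAG.{w}) : Type w := Free G.sig .cd

/-- The free hypergraph category on an ordered undirected graph. -/
abbrev Syn (H : OUGr.{w}) : Type w := Free H.sig .hypergraph

/-- The generating object. -/
def CDSynPoint.pt : CDSynPoint := ⟨[()]⟩

/-- The generating state. -/
def CDSynPoint.state : 𝟙_ CDSynPoint ⟶ CDSynPoint.pt := Free.mk' (Term.gen (S := pointSig) ())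

/-- The CD-functor sending the generator of `CDSynPoint` to the generator of `SynPoint`. -/
noncomputable def star : CDFunctor CDSynPoint SynPoint :=
  liftCD (fun _ => ⟨[()]⟩) fun _ => Free.mk' (Term.gen (S := pointSig) ())

/-- The CD-functor sending the generating object to the tensor product of all the vertices, and the
generating state to the copy-composition of all the generators. -/
noncomputable def ODAG.bang (G : ODAG.{w}) : CDFunctor CDSynPoint (CDSyn G) :=
  liftCD (fun _ => ⟨G.verts⟩) fun _ =>
    Free.mk' (G.copyComp.comp (Term.eqTo (List.append_nil G.verts).symm))

/-- The hypergraph functor sending the generating object to the tensor product of all the vertices,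
and the generating state to the compare-composition of all the generators. -/
noncomputable def OUGr.bang (H : OUGr.{w}) : HypFunctor SynPoint (Syn H) :=
  liftHyp (fun _ => ⟨H.verts⟩) fun _ =>
    Free.mk' (H.compareComp.comp (Term.eqTo (List.append_nil H.verts).symm))

/-- A distribution-preserving monoidal transformation between CD-functors
`CDSynPoint → FinStoch`. -/
@[ext]
structure MonTrans {A : Type u} (ω ω' : CDFunctor CDSynPoint (FinStoch A)) where
  app : ∀ X : CDSynPoint, ω.obj X ⟶ ω'.obj X
  app_tensor : ∀ X Y : CDSynPoint, app (X ⊗ Y) =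
    eqToHom (ω.obj_tensor X Y) ≫ (app X ⊗ₘ app Y) ≫ eqToHom (ω'.obj_tensor X Y).symm
  app_unit : app (𝟙_ CDSynPoint) = eqToHom (ω.obj_unit.trans ω'.obj_unit.symm)
  preserve : eqToHom ω.obj_unit.symm ≫ ω.map CDSynPoint.state ≫ app CDSynPoint.pt =
    eqToHom ω'.obj_unit.symm ≫ ω'.map CDSynPoint.state

namespace MonTrans

variable {A : Type u}

/-- The identity transformation. -/
noncomputable def id (ω : CDFunctor CDSynPoint (FinStoch A)) : MonTrans ω ω where
  app X := 𝟙 (ω.obj X)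
  app_tensor X Y := by simp
  app_unit := by simp
  preserve := by simp

/-- The composite of two transformations. -/
noncomputable def comp {ω ω' ω'' : CDFunctor CDSynPoint (FinStoch A)} (η : MonTrans ω ω')
    (θ : MonTrans ω' ω'') : MonTrans ω ω'' where
  app X := η.app X ≫ θ.app X
  app_tensor X Y := by simp [η.app_tensor, θ.app_tensor]
  app_unit := by simp [η.app_unit, θ.app_unit]
  preserve := by
    rw [← θ.preserve, reassoc_of% η.preserve]

end MonTrans

/-! ### Bayesian networks and Markov networks -/

/-- A Bayesian network: a distribution, seen as a CD-functor `CDSynPoint → FinStoch`, together with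
an ordered DAG, such that the functor factors through `CDSyn`. -/
structure BN (A : Type u) where
  dist : CDFunctor CDSynPoint (FinStoch A)
  graph : ODAG.{w}
  factors : ∃ F : CDFunctor (CDSyn graph) (FinStoch A),
    dist.toFunctor = graph.bang.toFunctor ⋙ F.toFunctor

/-- A Markov network: a distribution, seen as a CD-functor `CDSynPoint → FinStoch`, together with
an ordered undirected graph, such that the functor factors through `Syn` up to normalisation. -/
structure MN (A : Type u) where
  dist : CDFunctor CDSynPoint (FinStoch A)
  graph : OUGr.{w}
  factors : ∃ Φ : HypFunctor (Syn graph) (Mat A),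
    dist.toFunctor ⋙ stochFunctor A =
      star.toFunctor ⋙ graph.bang.toFunctor ⋙ Φ.toFunctor ⋙ quotFunctor A

/-- A morphism of Bayesian networks. -/
@[ext]
structure BN.Hom {A : Type u} (M N : BN.{u, w} A) where
  graphHom : N.graph ⟶ M.graph
  trans : MonTrans M.dist N.dist

/-- A morphism of Markov networks. -/
@[ext]
structure MN.Hom {A : Type u} (M N : MN.{u, w} A) where
  graphHom : N.graph ⟶ M.graph
  trans : MonTrans M.dist N.dist

noncomputable instance BN.category (A : Type u) : Category (BN.{u, w} A) where
  Hom := BN.Hom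
  id M := ⟨𝟙 M.graph, MonTrans.id M.dist⟩
  comp f g := ⟨g.graphHom ≫ f.graphHom, f.trans.comp g.trans⟩
  id_comp _ := BN.Hom.ext (Category.comp_id _) (MonTrans.ext (funext fun _ => Category.id_comp _))
  comp_id _ := BN.Hom.ext (Category.id_comp _) (MonTrans.ext (funext fun _ => Category.comp_id _))
  assoc _ _ _ := BN.Hom.ext (Category.assoc _ _ _).symm
    (MonTrans.ext (funext fun _ => Category.assoc _ _ _))

noncomputable instance MN.category (A : Type u) : Category (MN.{u, w} A) where
  Hom := MN.Hom
  id M := ⟨𝟙 M.graph, MonTrans.id M.dist⟩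
  comp f g := ⟨g.graphHom ≫ f.graphHom, f.trans.comp g.trans⟩
  id_comp _ := MN.Hom.ext (Category.comp_id _) (MonTrans.ext (funext fun _ => Category.id_comp _))
  comp_id _ := MN.Hom.ext (Category.id_comp _) (MonTrans.ext (funext fun _ => Category.comp_id _))
  assoc _ _ _ := MN.Hom.ext (Category.assoc _ _ _).symm
    (MonTrans.ext (funext fun _ => Category.assoc _ _ _))

end PGM

namespace PGM

/-! Both components of a morphism are to be carried over unchanged, so functoriality is automatic
and two facts remain: a distribution that factors over $\mathcal H$ up to normalisation factors
exactly over $\mathrm{tr}(\mathcal H)$, and a morphism of undirected graphs is also a morphism of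
their triangulations.

For the first fact, evaluate matrices at an assignment $s$ of a value to every vertex.
Compare-composition becomes the product of the clique potentials at $s$
(`HypFunctor.entry_compareComp`), and copy-composition the product over the vertices of the entries
at $s_v$ and $s_{\mathrm{pa}(v)}$ (`CDFunctor.entry_copyComp`). What is left concerns finite
weights: if $P$ has total weight 1 and is a constant times a product of functions of cliques, then
$P(s)=\prod_v P(s_v\mid s_{\mathrm{pa}(v)})$ with parents taken in the triangulation.

By the chain rule along the vertex order (`eq_prod_condWeight`), it suffices that each $v$ is
independent of its predecessors given $\mathrm{pa}(v)$. Let $K$ be the set of vertices reachable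
from $v$ through vertices $\ge v$. A neighbour of $K$ is either $\ge v$, hence in $K$, or smaller
than $v$ and joined to $v$ by a path through $K$, hence a parent of $v$. So a clique meeting $K$
lies in $K\cup\mathrm{pa}(v)$, and $P=fg$ with $f$ a function of the coordinates in
$K\cup\mathrm{pa}(v)$ and $g$ of those outside $K$. All predecessors of $v$ lie outside $K$, and the
independence follows by exchanging the $K$-coordinates of two assignments that agree on
$\mathrm{pa}(v)$ (`marginal_insert_mul`). Positivity of $P$ is not needed: where the parents have
weight zero the conditional weight is set to a point mass, and both sides of the chain rule step
vanish.

The conditional weights are the entries of stochastic matrices, which define a CD-functor on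
$\mathsf{CDSyn}_{\mathrm{tr}(\mathcal H)}$. Since $\mathsf{CDSyn}_\bullet$ is free, its composite
with $!$ need only be compared with $\omega$ on the generating object and state
(`CDFunctor.ext_of_free`).

For the second fact, a monotone graph morphism $\alpha$ sends a path staying $\ge w$ to one staying
$\ge\alpha(w)$, possibly with some steps collapsed; if the two ends stay distinct, it still
witnesses an edge of the triangulation. -/

/-! ### Functors out of free CD-categories -/

/-- The composite of two CD-functors. -/
def CDFunctor.comp {C : Type*} [Category* C] [MonoidalCategory C] [CopyDiscardCategory C]
    {D : Type*} [Category* D] [MonoidalCategory D] [CopyDiscardCategory D]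
    {E : Type*} [Category* E] [MonoidalCategory E] [CopyDiscardCategory E]
    (F : CDFunctor C D) (G : CDFunctor D E) : CDFunctor C E where
  toFunctor := F.toFunctor ⋙ G.toFunctor
  obj_unit := (congrArg G.obj F.obj_unit).trans G.obj_unit
  obj_tensor X Y := (congrArg G.obj (F.obj_tensor X Y)).trans (G.obj_tensor _ _)
  map_tensor f g := by simp [F.map_tensor, G.map_tensor, eqToHom_map]
  map_braiding X Y := by simp [F.map_braiding, G.map_braiding, eqToHom_map]
  map_copy X := by simp [F.map_copy, G.map_copy, eqToHom_map]
  map_del X := by simp [F.map_del, G.map_del, eqToHom_map]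

section Uniqueness

variable {D : Type*} [Category* D]

/-- Two functors with propositionally equal object maps have values in different hom-types, so their
morphism parts are compared by heterogeneous equality; this and the next lemmas are the congruence
rules for that comparison. -/
theorem heq_comp_of_eq {X Y Z X' Y' Z' : D} {f : X ⟶ Y} {g : Y ⟶ Z} {f' : X' ⟶ Y'}
    {g' : Y' ⟶ Z'} (hX : X = X') (hY : Y = Y') (hZ : Z = Z') (hf : HEq f f') (hg : HEq g g') :
    HEq (f ≫ g) (f' ≫ g') := by
  subst hX hY hZ; cases hf; cases hg; rfl

theorem heq_tensor_of_eq [MonoidalCategory D] {X Y Z W X' Y' Z' W' : D} {f : X ⟶ Y}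
    {g : Z ⟶ W} {f' : X' ⟶ Y'} {g' : Z' ⟶ W'} (hX : X = X') (hY : Y = Y') (hZ : Z = Z') (hW : W = W') (hf : HEq f f')
    (hg : HEq g g') : HEq (f ⊗ₘ g) (f' ⊗ₘ g') := by
  subst hX hY hZ hW; cases hf; cases hg; rfl

theorem heq_eqToHom_of_eq {X Y X' Y' : D} (h : X = Y) (h' : X' = Y') (hX : X = X') :
    HEq (eqToHom h) (eqToHom h') := by
  subst h h' hX; rfl

variable [MonoidalCategory D] [CopyDiscardCategory D] {S : Signature.{w}} {d : Doctrine}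

theorem CDFunctor.map_tensor_heq {C : Type*} [Category* C] [MonoidalCategory C]
    [CopyDiscardCategory C] (F : CDFunctor C D) {X Y Z W : C} (f : X ⟶ Y) (g : Z ⟶ W) :
    HEq (F.map (f ⊗ₘ g)) (F.map f ⊗ₘ F.map g) := by
  rw [F.map_tensor]
  exact (eqToHom_comp_heq _ _).trans (comp_eqToHom_heq _ _)

theorem CDFunctor.map_braiding_heq {C : Type*} [Category* C] [MonoidalCategory C]
    [CopyDiscardCategory C] (F : CDFunctor C D) (X Y : C) :
    HEq (F.map (β_ X Y).hom) (β_ (F.obj X) (F.obj Y)).hom := by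
  rw [F.map_braiding]
  exact (eqToHom_comp_heq _ _).trans (comp_eqToHom_heq _ _)

/-- CD-functors out of a free CD-category agree on objects if they agree on the generating ones. -/
theorem CDFunctor.obj_eq_of_free (F G : CDFunctor (Free S d) D)
    (ho : ∀ a, F.obj ⟨[a]⟩ = G.obj ⟨[a]⟩) (X : Free S d) : F.obj X = G.obj X := by
  obtain ⟨l⟩ := X
  induction l with
  | nil => exact F.obj_unit.trans G.obj_unit.symm
  | cons a l ih =>
    exact (F.obj_tensor ⟨[a]⟩ ⟨l⟩).trans
      ((congrArg₂ (· ⊗ ·) (ho a) ih).trans (G.obj_tensor ⟨[a]⟩ ⟨l⟩).symm)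

/-- A CD-functor out of a free CD-category is determined by its values on generators. -/
theorem CDFunctor.ext_of_free (F G : CDFunctor (Free S .cd) D)
    (ho : ∀ a, F.obj ⟨[a]⟩ = G.obj ⟨[a]⟩)
    (hg : ∀ g, HEq (F.map (Free.mk' (Term.gen g))) (G.map (Free.mk' (Term.gen g)))) :
    F.toFunctor = G.toFunctor := by
  have hob := F.obj_eq_of_free G ho
  refine Functor.hext hob ?_
  -- Every morphism is the class of a term, and both functors are already well defined on classes,
  -- so induction on a representative suffices and the relations play no role.
  suffices h : ∀ {X Y : List S.Ob} (t : Term S .cd X Y),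
      HEq (F.map (Free.mk' t)) (G.map (Free.mk' t)) by
    rintro ⟨X⟩ ⟨Y⟩ ⟨t⟩
    exact h t
  intro X Y t
  induction t with
  | id X =>
    change HEq (F.map (𝟙 _)) (G.map (𝟙 _))
    rw [F.map_id, G.map_id, hob]
  | comp f g ihf ihg =>
    change HEq (F.map (Free.mk' f ≫ Free.mk' g)) (G.map (Free.mk' f ≫ Free.mk' g))
    rw [F.map_comp, G.map_comp]
    exact heq_comp_of_eq (hob _) (hob _) (hob _) ihf ihg
  | tensor f g ihf ihg =>
    exact (F.map_tensor_heq (Free.mk' f) (Free.mk' g)).trans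
      ((heq_tensor_of_eq (hob _) (hob _) (hob _) (hob _) ihf ihg).trans
        (G.map_tensor_heq (Free.mk' f) (Free.mk' g)).symm)
  | eqTo h =>
    rw [← Free.eqToHom_eq h, eqToHom_map, eqToHom_map]
    exact heq_eqToHom_of_eq _ _ (hob _)
  | swap X Y =>
    refine (F.map_braiding_heq ⟨X⟩ ⟨Y⟩).trans (HEq.trans ?_ (G.map_braiding_heq ⟨X⟩ ⟨Y⟩).symm)
    rw [hob, hob]
  | copy X =>
    refine (heq_of_eq (F.map_copy ⟨X⟩)).trans
      (HEq.trans ?_ (heq_of_eq (G.map_copy ⟨X⟩)).symm)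
    refine (comp_eqToHom_heq _ _).trans (HEq.trans ?_ (comp_eqToHom_heq _ _).symm)
    rw [hob]
  | del X =>
    refine (heq_of_eq (F.map_del ⟨X⟩)).trans
      (HEq.trans ?_ (heq_of_eq (G.map_del ⟨X⟩)).symm)
    refine (comp_eqToHom_heq _ _).trans (HEq.trans ?_ (comp_eqToHom_heq _ _).symm)
    rw [hob]
  | compare h => exact nomatch h
  | omni h => exact nomatch h
  | gen g => exact hg g

end Uniqueness

/-! ### Entries of matrices -/

namespace MatObj

variable {A : Type u}

/-- Entries are indexed by all pairs of words over the alphabet, extended by zero, so transport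
along an equality of objects is invisible to them. This lets all coherence morphisms drop out of the
entry computations. -/
theorem entry_comp_eqToHom {X Y Z : MatObj A} (f : X ⟶ Y) (h : Y = Z) :
    MatHom.entry (f ≫ eqToHom h) = MatHom.entry f := by
  subst h; exact congrArg _ (Category.comp_id f)

theorem entry_eqToHom_comp {X Y Z : MatObj A} (h : X = Y) (f : Y ⟶ Z) :
    MatHom.entry (eqToHom h ≫ f) = MatHom.entry f := by
  subst h; exact congrArg _ (Category.id_comp f)

theorem heq_of_entry {X Y X' Y' : MatObj A} {f : X ⟶ Y} {g : X' ⟶ Y'} (hX : X = X')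
    (hY : Y = Y') (h : MatHom.entry f = MatHom.entry g) : HEq f g := by
  subst hX hY
  exact heq_of_eq (MatHom.ext h)

theorem IsFun.entry {X Y : MatObj A} {m : X ⟶ Y} {φ : List A → List A} (hm : IsFun m φ)
    {x : List A} (hx : x ∈ X.carrier) (y : List A) :
    MatHom.entry m y x = open scoped Classical in if y = φ x then 1 else 0 := by
  obtain ⟨h, rfl⟩ := hm
  exact ofFun_entry hx y

theorem IsCofun.entry {X Y : MatObj A} {m : X ⟶ Y} {φ : List A → List A} (hm : IsCofun m φ)
    {y : List A} (hy : y ∈ Y.carrier) (x : List A) :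
    MatHom.entry m y x = open scoped Classical in if x = φ y then 1 else 0 := by
  obtain ⟨h, rfl⟩ := hm
  exact ofFun_entry (hφ := h) hy x

theorem tensorHom_entry {X Y Z W : MatObj A} (f : X ⟶ Y) (g : Z ⟶ W) {y x : List A}
    (hy : y ∈ Y.carrier) (hx : x ∈ X.carrier) (w z : List A) :
    MatHom.entry (f ⊗ₘ g) (y ++ w) (x ++ z) = MatHom.entry f y x * MatHom.entry g w z :=
  kron_entry f g hy hx w z

end MatObj

/-- The inclusion of stochastic matrices into all matrices. -/
noncomputable def stochInclusion (A : Type u) : CDFunctor (FinStoch A) (Mat A) where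
  toFunctor := wideSubcategoryInclusion (MatObj.stochastic A)
  obj_unit := rfl
  obj_tensor _ _ := rfl
  map_tensor _ _ := ((Category.id_comp _).trans (Category.comp_id _)).symm
  map_braiding _ _ := ((Category.id_comp _).trans (Category.comp_id _)).symm
  map_copy _ := (Category.comp_id _).symm
  map_del _ := (Category.comp_id _).symm

/-! ### Entries of the values of terms -/

namespace CDFunctor

open MatObj

variable {A : Type u} {S : Signature.{w}} {d : Doctrine} (Ψ : CDFunctor (Free S d) (Mat A))

/-- The finite set of values of a generating object. -/
def states (a : S.Ob) : Finset (List A) := (Ψ.obj ⟨[a]⟩).carrier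

/-- The finite set of values of a word. -/
def words (l : List S.Ob) : Finset (List A) := (Ψ.obj ⟨l⟩).carrier

/-- The matrix entries of the value of a term. -/
def entry {X Y : List S.Ob} (t : Term S d X Y) : List A → List A → ℝ≥0 :=
  MatHom.entry (Ψ.map (Free.mk' t))

theorem mem_words_nil {x : List A} : x ∈ Ψ.words [] ↔ x = [] := by
  rw [words, show Ψ.obj ⟨[]⟩ = 𝟙_ _ from Ψ.obj_unit, mem_unit]

theorem mem_words_append {l l' : List S.Ob} {x : List A} :
    x ∈ Ψ.words (l ++ l') ↔ ∃ a ∈ Ψ.words l, ∃ b ∈ Ψ.words l', a ++ b = x := by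
  rw [words, show Ψ.obj ⟨l ++ l'⟩ = _ from Ψ.obj_tensor ⟨l⟩ ⟨l'⟩]
  exact mem_tensor

theorem mem_words_cons {a : S.Ob} {l : List S.Ob} {x : List A} :
    x ∈ Ψ.words (a :: l) ↔ ∃ y ∈ Ψ.states a, ∃ b ∈ Ψ.words l, y ++ b = x :=
  Ψ.mem_words_append (l := [a])

theorem length_eq_of_mem_words {l : List S.Ob} {x y : List A} (hx : x ∈ Ψ.words l)
    (hy : y ∈ Ψ.words l) : x.length = y.length :=
  ((Ψ.obj ⟨l⟩).length_eq x hx).trans ((Ψ.obj ⟨l⟩).length_eq y hy).symm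

/-- Words of one object have a common length, so a concatenation splits in only one way. -/
theorem append_eq_append_iff {l : List S.Ob} {x y x' y' : List A} (hx : x ∈ Ψ.words l)
    (hy : y ∈ Ψ.words l) : x ++ x' = y ++ y' ↔ x = y ∧ x' = y' :=
  ⟨fun h => List.append_inj h (Ψ.length_eq_of_mem_words hx hy), fun h => by rw [h.1, h.2]⟩

/-- An assignment `s` picks one value for each generating object, and `l.flatMap s` is the resulting
value of the word `l`. Evaluating terms only at such words turns diagrams into products of functions
of `s`. -/
theorem flatMap_mem_words {s : S.Ob → List A} (hs : ∀ a, s a ∈ Ψ.states a) (l : List S.Ob) :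
    l.flatMap s ∈ Ψ.words l := by
  induction l with
  | nil => exact Ψ.mem_words_nil.2 rfl
  | cons a l ih => exact Ψ.mem_words_cons.2 ⟨_, hs a, _, ih, rfl⟩

theorem flatMap_eq_flatMap_iff {s t : S.Ob → List A} (hs : ∀ a, s a ∈ Ψ.states a)
    (ht : ∀ a, t a ∈ Ψ.states a) (l : List S.Ob) :
    l.flatMap s = l.flatMap t ↔ ∀ a ∈ l, s a = t a := by
  induction l with
  | nil => simp
  | cons a l ih =>
    rw [List.flatMap_cons, List.flatMap_cons,
      Ψ.append_eq_append_iff (l := [a]) (hs a) (ht a), ih, List.forall_mem_cons]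

open scoped Classical in
/-- Every value of a word without repetitions comes from values of the generating objects. -/
theorem exists_flatMap_eq {s₀ : S.Ob → List A} (hs₀ : ∀ a, s₀ a ∈ Ψ.states a) {l : List S.Ob}
    (hl : l.Nodup) {x : List A} (hx : x ∈ Ψ.words l) :
    ∃ s : S.Ob → List A, (∀ a, s a ∈ Ψ.states a) ∧ l.flatMap s = x := by
  induction l generalizing x with
  | nil => exact ⟨s₀, hs₀, (Ψ.mem_words_nil.1 hx).symm⟩
  | cons a l ih =>
    obtain ⟨y, hy, b, hb, rfl⟩ := Ψ.mem_words_cons.1 hx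
    rw [List.nodup_cons] at hl
    obtain ⟨s, hs, rfl⟩ := ih hl.2 hb
    -- The letter `a` does not occur in `l`, so giving it the value `y` leaves the value of `l`
    -- intact; with repetitions two occurrences could carry different values. Letters outside the
    -- word keep the default `s₀`.
    refine ⟨Function.update s a y, fun c => ?_, ?_⟩
    · rcases eq_or_ne c a with rfl | h
      · rwa [Function.update_self]
      · rw [Function.update_of_ne h]; exact hs c
    · rw [List.flatMap_cons, Function.update_self]
      refine congrArg _ ((Ψ.flatMap_eq_flatMap_iff (fun c => ?_) hs l).2 fun c hc => ?_)
      · rcases eq_or_ne c a with rfl | h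
        · rwa [Function.update_self]
        · rw [Function.update_of_ne h]; exact hs c
      · exact Function.update_of_ne (ne_of_mem_of_not_mem hc hl.1) _ _

theorem states_nonempty_of_words {l : List S.Ob} (h : (Ψ.words l).Nonempty) {a : S.Ob}
    (ha : a ∈ l) : (Ψ.states a).Nonempty := by
  induction l with
  | nil => exact absurd ha List.not_mem_nil
  | cons b l ih =>
    obtain ⟨x, hx⟩ := h
    obtain ⟨y, hy, z, hz, rfl⟩ := Ψ.mem_words_cons.1 hx
    rcases List.mem_cons.1 ha with rfl | h
    · exact ⟨y, hy⟩
    · exact ih ⟨z, hz⟩ h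

theorem entry_eq_zero_right {X Y : List S.Ob} (t : Term S d X Y) {y x : List A}
    (hx : x ∉ Ψ.words X) : Ψ.entry t y x = 0 :=
  MatHom.entry_eq_zero _ y x fun h => hx h.2

theorem entry_eq_zero_left {X Y : List S.Ob} (t : Term S d X Y) {y x : List A}
    (hy : y ∉ Ψ.words Y) : Ψ.entry t y x = 0 :=
  MatHom.entry_eq_zero _ y x fun h => hy h.1

theorem entry_comp {X Y Z : List S.Ob} (f : Term S d X Y) (g : Term S d Y Z) (z x : List A) :
    Ψ.entry (f.comp g) z x = ∑ y ∈ Ψ.words Y, Ψ.entry g z y * Ψ.entry f y x := by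
  rw [entry, show Free.mk' (f.comp g) = Free.mk' f ≫ Free.mk' g from rfl, Ψ.map_comp]
  rfl

theorem entry_tensor {X Y Z W : List S.Ob} (f : Term S d X Y) (g : Term S d Z W) {y x : List A}
    (hy : y ∈ Ψ.words Y) (hx : x ∈ Ψ.words X) (w z : List A) :
    Ψ.entry (f.tensor g) (y ++ w) (x ++ z) = Ψ.entry f y x * Ψ.entry g w z := by
  rw [entry, show Ψ.map (Free.mk' (f.tensor g)) = _ from Ψ.map_tensor (Free.mk' f) (Free.mk' g),
    entry_eqToHom_comp, entry_comp_eqToHom]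
  exact tensorHom_entry _ _ hy hx w z

open scoped Classical in
theorem entry_id {X : List S.Ob} {x : List A} (hx : x ∈ Ψ.words X) (y : List A) :
    Ψ.entry (Term.id X) y x = if y = x then 1 else 0 := by
  rw [entry, show Ψ.map (Free.mk' (Term.id X)) = 𝟙 _ from Ψ.map_id ⟨X⟩]
  exact (IsFun.id _).entry hx y

theorem entry_comp_eqTo {X Y Z : List S.Ob} (f : Term S d X Y) (h : Y = Z) :
    Ψ.entry (f.comp (Term.eqTo h)) = Ψ.entry f := by
  rw [entry, show Free.mk' (f.comp (Term.eqTo h)) = Free.mk' f ≫ Free.mk' (Term.eqTo h) from rfl,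
    ← Free.eqToHom_eq h, Ψ.map_comp, eqToHom_map, entry_comp_eqToHom]
  rfl

theorem entry_eqTo_comp {X Y Z : List S.Ob} (h : X = Y) (f : Term S d Y Z) :
    Ψ.entry ((Term.eqTo h).comp f) = Ψ.entry f := by
  rw [entry, show Free.mk' ((Term.eqTo h).comp f) = Free.mk' (Term.eqTo h) ≫ Free.mk' f from rfl,
    ← Free.eqToHom_eq h, Ψ.map_comp, eqToHom_map, entry_eqToHom_comp]
  rfl

open scoped Classical in
theorem entry_eqTo {X Y : List S.Ob} (h : X = Y) {x : List A} (hx : x ∈ Ψ.words X) (y : List A) :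
    Ψ.entry (Term.eqTo h) y x = if y = x then 1 else 0 := by
  subst h
  rw [entry, ← Free.eqToHom_eq rfl, eqToHom_refl, Ψ.map_id]
  exact (IsFun.id _).entry hx y

open scoped Classical in
theorem entry_copy {X : List S.Ob} {x : List A} (hx : x ∈ Ψ.words X) (y : List A) :
    Ψ.entry (Term.copy X) y x = if y = x ++ x then 1 else 0 := by
  rw [entry, show Ψ.map (Free.mk' (Term.copy X)) = _ from Ψ.map_copy ⟨X⟩, entry_comp_eqToHom]
  exact (IsFun.copyHom _).entry hx y

open scoped Classical in
theorem entry_del {X : List S.Ob} {x : List A} (hx : x ∈ Ψ.words X) (y : List A) :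
    Ψ.entry (Term.del X) y x = if y = [] then 1 else 0 := by
  rw [entry, show Ψ.map (Free.mk' (Term.del X)) = _ from Ψ.map_del ⟨X⟩, entry_comp_eqToHom]
  exact (IsFun.delHom _).entry hx y

-- Copying forces the intermediate word to be `x ++ x`, so a single term of the sum survives and
-- both factors see the same input.
open scoped Classical in
theorem entry_copy_comp_tensor {X Y Z : List S.Ob} (f : Term S d X Y) (g : Term S d X Z)
    {x y : List A} (hx : x ∈ Ψ.words X) (hy : y ∈ Ψ.words Y) (z : List A) :
    Ψ.entry ((Term.copy X).comp (f.tensor g)) (y ++ z) x = Ψ.entry f y x * Ψ.entry g z x := by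
  rw [entry_comp, Finset.sum_eq_single (x ++ x), Ψ.entry_copy hx, if_pos rfl, mul_one,
    Ψ.entry_tensor f g hy hx]
  · intro b _ hb
    rw [Ψ.entry_copy hx, if_neg hb, mul_zero]
  · intro h
    exact absurd (Ψ.mem_words_append.2 ⟨x, hx, x, hx, rfl⟩) h

/-! ### Projections and wirings as matrices of functions of assignments. -/

section Wire

variable {Ψ} {s : S.Ob → List A} (hs : ∀ a, s a ∈ Ψ.states a)
include hs

-- By induction along the word: the matching letter is kept while the rest is deleted, and any other
-- letter is deleted before passing on.
open scoped Classical in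
theorem entry_proj (v : S.Ob) (l : List S.Ob) (h : v ∈ l) (y : List A) :
    Ψ.entry (Term.proj v l h) y (l.flatMap s) = if y = s v then 1 else 0 := by
  induction l with
  | nil => exact absurd h List.not_mem_nil
  | cons a l ih =>
    by_cases hy : y ∈ Ψ.words [v]
    · rw [Term.proj, List.flatMap_cons]
      split_ifs with e hyv hyv
      · subst e
        -- The deleted tail outputs the empty word, so `y` has to be split as `y ++ []` to match the
        -- tensor product.
        rw [entry_comp_eqTo, ← List.append_nil y, Ψ.entry_tensor _ _ hy (hs a),
          Ψ.entry_id (hs a), Ψ.entry_del (flatMap_mem_words Ψ hs l)]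
        simp [hyv]
      · subst e
        rw [entry_comp_eqTo, ← List.append_nil y, Ψ.entry_tensor _ _ hy (hs a),
          Ψ.entry_id (hs a), Ψ.entry_del (flatMap_mem_words Ψ hs l)]
        simp [hyv]
      all_goals
        refine (Ψ.entry_tensor _ _ (Ψ.mem_words_nil.2 rfl) (hs a) y _).trans ?_
        rw [Ψ.entry_del (hs a), ih]
        simp [hyv]
    · rw [Ψ.entry_eq_zero_left _ hy, if_neg]
      rintro rfl
      exact hy (hs v)

-- A wiring is deterministic: it carries the value of `l` under an assignment to the value of `l'`
-- under the same assignment, one copied and projected letter at a time.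
open scoped Classical in
theorem entry_wire (l l' : List S.Ob) (h : ∀ v ∈ l', v ∈ l) (y : List A) :
    Ψ.entry (Term.wire l l' h) y (l.flatMap s) = if y = l'.flatMap s then 1 else 0 := by
  induction l' generalizing y with
  | nil => exact Ψ.entry_del (flatMap_mem_words Ψ hs l) y
  | cons v l' ih =>
    by_cases hy : y ∈ Ψ.words (v :: l')
    · obtain ⟨a, ha, b, hb, rfl⟩ := Ψ.mem_words_cons.1 hy
      rw [Term.wire]
      refine (Ψ.entry_copy_comp_tensor _ _ (flatMap_mem_words Ψ hs l) ha b).trans ?_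
      rw [entry_proj hs, ih, List.flatMap_cons]
      simp only [Ψ.append_eq_append_iff (l := [v]) ha (hs v)]
      by_cases h1 : a = s v <;> by_cases h2 : b = l'.flatMap s <;> simp [h1, h2]
    · rw [Ψ.entry_eq_zero_left _ hy, if_neg]
      rintro rfl
      exact hy (flatMap_mem_words Ψ hs _)

theorem entry_wire_comp {l l' X : List S.Ob} (h : ∀ v ∈ l', v ∈ l) (t : Term S d l' X)
    (y : List A) :
    Ψ.entry ((Term.wire l l' h).comp t) y (l.flatMap s) = Ψ.entry t y (l'.flatMap s) := by
  classical
  rw [entry_comp, Finset.sum_eq_single (l'.flatMap s), entry_wire hs, if_pos rfl, mul_one]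
  · intro b _ hb
    rw [entry_wire hs, if_neg hb, mul_zero]
  · intro h
    exact absurd (flatMap_mem_words Ψ hs l') h

end Wire

/-! ### Copy-composition -/

/-- This is the Bayesian factorisation for an initial stage of the computation: each vertex adds one
factor, whose input is read off from the values already produced. -/
theorem entry_copyCompList {G : ODAG.{w}} {Ψ : CDFunctor (CDSyn G) (Mat A)}
    {s : G.V → List A} (hs : ∀ v, s v ∈ Ψ.states v) (l : List G.V) (h : G.Closed l) :
    Ψ.entry (G.copyCompList l h) (l.flatMap s) [] =
      (l.map fun v => Ψ.entry (Term.gen (S := G.sig) v) (s v) ((G.parents v).flatMap s)).prod := by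
  classical
  induction l with
  | nil =>
    exact (Ψ.entry_id (Ψ.mem_words_nil.2 rfl) []).trans (if_pos rfl)
  | cons v l ih =>
    rw [ODAG.copyCompList, entry_comp]
    -- Beside the new generator the copied word `l` is passed through by an identity, so an
    -- intermediate word contributes only if it equals the prescribed output on `l`.
    rw [Finset.sum_eq_single (l.flatMap s), ih, List.map_cons, List.prod_cons]
    · refine congrArg (· * _) ?_
      refine (Ψ.entry_copy_comp_tensor (Y := [v]) _ _ (flatMap_mem_words Ψ hs l) (hs v)
        (l.flatMap s)).trans ?_
      rw [Ψ.entry_id (flatMap_mem_words Ψ hs l), if_pos rfl, mul_one]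
      exact entry_wire_comp hs _ _ _
    · intro b hb hne
      refine mul_eq_zero_of_left ((Ψ.entry_copy_comp_tensor (Y := [v]) _ _ hb (hs v)
        (l.flatMap s)).trans ?_) _
      rw [Ψ.entry_id hb, if_neg hne.symm, mul_zero]
    · intro h
      exact absurd (flatMap_mem_words Ψ hs l) h

theorem entry_copyComp {G : ODAG.{w}} {Ψ : CDFunctor (CDSyn G) (Mat A)}
    {s : G.V → List A} (hs : ∀ v, s v ∈ Ψ.states v) :
    Ψ.entry G.copyComp (G.verts.flatMap s) [] =
      ∏ v, Ψ.entry (Term.gen (S := G.sig) v) (s v) ((G.parents v).flatMap s) := by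
  classical
  have mem_desc (v) : v ∈ G.vertsDesc := (Finset.mem_sort _).2 (Finset.mem_univ v)
  have nodup : G.vertsDesc.Nodup := Finset.sort_nodup _ _
  have mem_verts (v) : v ∈ G.verts := (Finset.mem_sort _).2 (Finset.mem_univ v)
  have entry_wire_verts {t : G.V → List A} (ht : ∀ v, t v ∈ Ψ.states v) (y : List A) :=
    entry_wire (Ψ := Ψ) ht G.vertsDesc G.verts (fun v _ => mem_desc v) y
  rw [ODAG.copyComp, entry_comp]
  -- The final wiring only reorders descending to ascending vertices. Both lists contain every
  -- vertex, so an intermediate word with nonzero contribution comes from an assignment equal to `s`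
  -- on every vertex.
  refine (Finset.sum_eq_single (G.vertsDesc.flatMap s) (fun b hb hne => ?_) fun h =>
    absurd (flatMap_mem_words Ψ hs _) h).trans ?_
  · obtain ⟨t, ht, rfl⟩ := Ψ.exists_flatMap_eq hs nodup hb
    refine mul_eq_zero_of_left ((entry_wire_verts ht _).trans (if_neg fun heq => ?_)) _
    rw [Ψ.flatMap_eq_flatMap_iff hs ht] at heq
    exact hne ((Ψ.flatMap_eq_flatMap_iff ht hs _).2 fun v _ => (heq v (mem_verts v)).symm)
  · refine (congrArg (· * _) ((entry_wire_verts hs _).trans (if_pos rfl))).trans ?_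
    rw [one_mul, entry_copyCompList hs, ← List.prod_toFinset _ nodup]
    exact Finset.prod_congr (Finset.eq_univ_of_forall fun v => List.mem_toFinset.2 (mem_desc v))
      fun _ _ => rfl

end CDFunctor

/-! ### Compare-composition -/

namespace HypFunctor

open MatObj CDFunctor

variable {A : Type u}

/-! ### Comparing wirings as transposed matrices of functions. -/

section Merge

variable {S : Signature.{w}} {Φ : HypFunctor (Free S .hypergraph) (Mat A)}

open scoped Classical in
theorem entry_compare {X : List S.Ob} {y : List A} (hy : y ∈ Φ.words X) (x : List A) :
    Φ.entry (Term.compare rfl X) y x = if x = y ++ y then 1 else 0 := by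
  rw [CDFunctor.entry,
    show Φ.map (Free.mk' (Term.compare rfl X)) = _ from Φ.map_compare ⟨X⟩, entry_eqToHom_comp]
  exact (IsCofun.compareHom _).entry hy x

open scoped Classical in
theorem entry_omni {X : List S.Ob} {y : List A} (hy : y ∈ Φ.words X) (x : List A) :
    Φ.entry (Term.omni rfl X) y x = if x = [] then 1 else 0 := by
  rw [CDFunctor.entry,
    show Φ.map (Free.mk' (Term.omni rfl X)) = _ from Φ.map_omni ⟨X⟩, entry_eqToHom_comp]
  exact (IsCofun.omniHom _).entry hy x

/-- Dual to copying: comparison forces both factors to output the same word, so their entries at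
that common output multiply. -/
theorem entry_tensor_comp_compare {X Y Z : List S.Ob} (f : Term S .hypergraph X Z)
    (g : Term S .hypergraph Y Z) {x z : List A} (hx : x ∈ Φ.words X) (hz : z ∈ Φ.words Z)
    (y : List A) :
    Φ.entry ((f.tensor g).comp (Term.compare rfl Z)) z (x ++ y) =
      Φ.entry f z x * Φ.entry g z y := by
  classical
  rw [CDFunctor.entry_comp, Finset.sum_eq_single (z ++ z), entry_compare hz, if_pos rfl, one_mul,
    CDFunctor.entry_tensor _ f g hz hx]
  · intro b _ hb
    rw [entry_compare hz, if_neg hb, zero_mul]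
  · intro h
    exact absurd (Φ.mem_words_append.2 ⟨z, hz, z, hz, rfl⟩) h

variable {s : S.Ob → List A} (hs : ∀ a, s a ∈ Φ.states a)
include hs

open scoped Classical in
theorem entry_inj (v : S.Ob) (l : List S.Ob) (h : v ∈ l) (x : List A) :
    Φ.entry (Term.inj v l h) (l.flatMap s) x = if x = s v then 1 else 0 := by
  induction l with
  | nil => exact absurd h List.not_mem_nil
  | cons a l ih =>
    by_cases hx : x ∈ Φ.words [v]
    · rw [Term.inj, List.flatMap_cons]
      split_ifs with e hxv hxv
      · subst e
        rw [entry_eqTo_comp]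
        refine (congrArg _ (List.append_nil x).symm).trans
          ((Φ.entry_tensor _ _ (hs a) hx _ []).trans ?_)
        rw [Φ.entry_id hx, entry_omni (flatMap_mem_words _ hs l)]
        simp [hxv]
      · subst e
        rw [entry_eqTo_comp]
        refine (congrArg _ (List.append_nil x).symm).trans
          ((Φ.entry_tensor _ _ (hs a) hx _ []).trans ?_)
        rw [Φ.entry_id hx, entry_omni (flatMap_mem_words _ hs l)]
        simp [Ne.symm hxv]
      all_goals
        refine (Φ.entry_tensor _ _ (hs a) (Φ.mem_words_nil.2 rfl) _ x).trans ?_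
        rw [entry_omni (hs a), ih]
        simp [hxv]
    · rw [Φ.entry_eq_zero_right _ hx, if_neg]
      rintro rfl
      exact hx (hs v)

-- The transposed counterpart of `CDFunctor.entry_wire`: an input word is accepted exactly when each
-- occurrence of a letter carries the value prescribed by the output.
open scoped Classical in
theorem entry_merge (l' l : List S.Ob) (h : ∀ v ∈ l, v ∈ l') (x : List A) :
    Φ.entry (Term.merge l' l h) (l'.flatMap s) x = if x = l.flatMap s then 1 else 0 := by
  induction l generalizing x with
  | nil => exact entry_omni (flatMap_mem_words _ hs l') x
  | cons v l ih =>
    by_cases hx : x ∈ Φ.words (v :: l)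
    · obtain ⟨a, ha, b, hb, rfl⟩ := Φ.mem_words_cons.1 hx
      rw [Term.merge]
      refine (entry_tensor_comp_compare _ _ ha (flatMap_mem_words _ hs l') b).trans ?_
      rw [entry_inj hs, ih, List.flatMap_cons]
      simp only [Φ.append_eq_append_iff (l := [v]) ha (hs v)]
      by_cases h1 : a = s v <;> by_cases h2 : b = l.flatMap s <;> simp [h1, h2]
    · rw [Φ.entry_eq_zero_right _ hx, if_neg]
      rintro rfl
      exact hx (flatMap_mem_words _ hs _)

end Merge

variable {H : OUGr.{w}} {Φ : HypFunctor (Syn H) (Mat A)} {s : H.V → List A}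
  (hs : ∀ v, s v ∈ Φ.states v)
include hs

/-- Comparison forces all cliques to read the same assignment, so their potentials multiply
pointwise. The matrix is not normalised. -/
theorem entry_compareCompList (l : List H.Clique) :
    Φ.entry (H.compareCompList l) (((H.out l).sort (· ≤ ·)).flatMap s) [] =
      (l.map fun C =>
        Φ.entry (Term.gen (S := H.sig) C) ((C.1.sort (· ≤ ·)).flatMap s) []).prod := by
  classical
  induction l with
  | nil =>
    refine (Φ.entry_eqTo _ (Φ.mem_words_nil.2 rfl) _).trans (if_pos ?_)
    simp [OUGr.out]
  | cons C l ih =>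
    rw [OUGr.compareCompList, Φ.entry_comp,
      Finset.sum_eq_single ((C.1.sort (· ≤ ·) ++ (H.out l).sort (· ≤ ·)).flatMap s),
      entry_merge hs, if_pos rfl, one_mul, List.flatMap_append]
    · refine (Φ.entry_tensor _ _ (flatMap_mem_words _ hs _) (Φ.mem_words_nil.2 rfl) _ []).trans ?_
      rw [ih, List.map_cons, List.prod_cons]
    · intro b _ hb
      rw [entry_merge hs, if_neg hb, zero_mul]
    · intro h
      exact absurd (flatMap_mem_words _ hs _) h

theorem entry_compareComp :
    Φ.entry H.compareComp (H.verts.flatMap s) [] =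
      ∏ C : H.Clique, Φ.entry (Term.gen (S := H.sig) C) ((C.1.sort (· ≤ ·)).flatMap s) [] := by
  have h : (H.out H.cliques).sort (· ≤ ·) = H.verts :=
    congrArg (fun U : Finset H.V => U.sort (· ≤ ·)) H.out_cliques
  calc
    _ = Φ.entry (H.compareCompList H.cliques) (H.verts.flatMap s) [] :=
      congrFun (congrFun (Φ.entry_comp_eqTo (H.compareCompList H.cliques) h) _) _
    _ = Φ.entry (H.compareCompList H.cliques) (((H.out H.cliques).sort (· ≤ ·)).flatMap s) [] :=
      congrArg (fun l : List H.V => Φ.entry (H.compareCompList H.cliques) (l.flatMap s) []) h.symm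
    _ = _ := (entry_compareCompList hs H.cliques).trans (Finset.prod_map_toList _ _)

end HypFunctor

/-! ### Conditional probabilities -/

section Marginal

variable {V : Type*} [Fintype V] [DecidableEq V] {β : Type*}

open scoped Classical in
/-- The marginal weight of the values of `s` on `U`: the total weight of all `t` agreeing with `s`
on `U`. -/
noncomputable def marginal (X : V → Finset β) (P : (V → β) → ℝ≥0) (U : Set V) (s : V → β) :
    ℝ≥0 :=
  ∑ t ∈ Fintype.piFinset X with ∀ v ∈ U, t v = s v, P t

open scoped Classical in
/-- The conditional weight of `s v` given the values of `s` on `U`, which is concentrated at the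
given state `s₀` if the condition has weight zero. -/
noncomputable def condWeight (X : V → Finset β) (P : (V → β) → ℝ≥0) (s₀ : V → β) (U : Set V)
    (v : V) (s : V → β) : ℝ≥0 :=
  if marginal X P U s = 0 then if s v = s₀ v then 1 else 0
  else marginal X P (insert v U) s / marginal X P U s

variable {X : V → Finset β} {P : (V → β) → ℝ≥0}

theorem marginal_of_forall_mem {U : Set V} (hU : ∀ v, v ∈ U) {s : V → β}
    (hs : s ∈ Fintype.piFinset X) : marginal X P U s = P s := by
  classical
  refine Finset.sum_eq_single_of_mem s ?_ fun t ht hne => ?_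
  · rw [Finset.mem_filter]
    exact ⟨hs, fun _ _ => rfl⟩
  · rw [Finset.mem_filter] at ht
    exact absurd (funext fun v => ht.2 v (hU v)) hne

theorem marginal_empty (s : V → β) :
    marginal X P ∅ s = ∑ t ∈ Fintype.piFinset X, P t := by
  simp [marginal]

/-- Fixing fewer coordinates admits more assignments, and all weights are nonnegative. Hence a
marginal that vanishes on `U` vanishes on every larger set. -/
theorem marginal_anti {U W : Set V} (h : U ⊆ W) (s : V → β) :
    marginal X P W s ≤ marginal X P U s := by
  classical
  refine Finset.sum_le_sum_of_subset fun t ht => ?_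
  rw [Finset.mem_filter] at ht ⊢
  exact ⟨ht.1, fun v hv => ht.2 v (h hv)⟩

/-- If the weight is the product of a function of the coordinates in `K ∪ U` and a function of the
coordinates outside `K`, then `v ∈ K` and `L` are conditionally independent given `U`. -/
theorem marginal_insert_mul {f g : (V → β) → ℝ≥0} {K U L : Set V} {v : V}
    (hP : ∀ s ∈ Fintype.piFinset X, P s = f s * g s)
    (hf : ∀ s t, (∀ u ∈ K ∪ U, s u = t u) → f s = f t)
    (hg : ∀ s t, (∀ u ∉ K, s u = t u) → g s = g t)
    (hUL : U ⊆ L) (hLK : Disjoint L K) (hv : v ∈ K) (s : V → β) :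
    marginal X P (insert v L) s * marginal X P U s =
      marginal X P L s * marginal X P (insert v U) s := by
  classical
  have hK {u} (hu : u ∈ L) : u ∉ K := Set.disjoint_left.1 hLK hu
  have mem {y z : V → β} (hy : y ∈ Fintype.piFinset X) (hz : z ∈ Fintype.piFinset X) :
      K.piecewise y z ∈ Fintype.piFinset X := by
    rw [Fintype.mem_piFinset] at hy hz ⊢
    intro u
    by_cases hu : u ∈ K <;> simp [hu, hy u, hz u]
  simp only [marginal, Finset.sum_mul_sum, ← Finset.sum_product']
  -- Both sides expand to sums over pairs of assignments. Exchanging the coordinates in `K` is an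
  -- involution that moves the constraint at `v ∈ K` from one member to the other, and leaves the
  -- constraints on `L` and `U` alone because these sets avoid `K`.
  let σ : (V → β) × (V → β) → (V → β) × (V → β) := fun p =>
    (K.piecewise p.2 p.1, K.piecewise p.1 p.2)
  have hσ (p) : σ (σ p) = p := by
    refine Prod.ext (funext fun u => ?_) (funext fun u => ?_) <;> by_cases hu : u ∈ K <;>
      simp [σ, hu]
  refine Finset.sum_nbij' σ σ ?_ ?_ (fun p _ => hσ p) (fun p _ => hσ p) ?_
  · rintro ⟨y, z⟩ h
    simp only [Finset.mem_product, Finset.mem_filter, Set.forall_mem_insert] at h ⊢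
    obtain ⟨⟨hy, hyv, hyL⟩, hz, hzU⟩ := h
    refine ⟨⟨mem hz hy, fun u hu => ?_⟩, mem hy hz, ?_, fun u hu => ?_⟩
    · simp [σ, hK hu, hyL u hu]
    · simp [σ, hv, hyv]
    · simp [σ, hK (hUL hu), hzU u hu]
  · rintro ⟨y, z⟩ h
    simp only [Finset.mem_product, Finset.mem_filter, Set.forall_mem_insert] at h ⊢
    obtain ⟨⟨hy, hyL⟩, hz, hzv, hzU⟩ := h
    refine ⟨⟨mem hz hy, ?_, fun u hu => ?_⟩, mem hy hz, fun u hu => ?_⟩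
    · simp [σ, hv, hzv]
    · simp [σ, hK hu, hyL u hu]
    · simp [σ, hK (hUL hu), hzU u hu]
  · rintro ⟨y, z⟩ h
    simp only [Finset.mem_product, Finset.mem_filter, Set.forall_mem_insert] at h
    obtain ⟨⟨hy, hyv, hyL⟩, hz, hzU⟩ := h
    -- Both members agree with `s` on `U`. So `f`, which sees only `K ∪ U`, follows the exchanged
    -- coordinates, while `g`, which sees only the complement of `K`, stays; the product of the two
    -- weights is unchanged.
    have hyz {u} (hu : u ∈ U) : y u = z u := (hyL u (hUL hu)).trans (hzU u hu).symm
    have f₁ : f (K.piecewise z y) = f z := hf _ _ fun u hu => by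
      by_cases h : u ∈ K
      · simp [h]
      · simp [h, hyz (hu.resolve_left h)]
    have f₂ : f (K.piecewise y z) = f y := hf _ _ fun u hu => by
      by_cases h : u ∈ K
      · simp [h]
      · simp [h, hyz (hu.resolve_left h)]
    have g₁ : g (K.piecewise z y) = g y := hg _ _ fun u hu => by simp [hu]
    have g₂ : g (K.piecewise y z) = g z := hg _ _ fun u hu => by simp [hu]
    simp only [σ]
    rw [hP _ hy, hP _ hz, hP _ (mem hz hy), hP _ (mem hy hz), f₁, f₂, g₁, g₂]
    ring

/-- Where the condition on `U` has positive weight this is division by that weight. Where it has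
weight zero, so have the two larger marginals, and the conventional value of the conditional weight
is irrelevant. -/
theorem marginal_insert_eq_mul_condWeight {U L : Set V} {v : V} {s : V → β} (s₀ : V → β)
    (hUL : U ⊆ L)
    (h : marginal X P (insert v L) s * marginal X P U s =
      marginal X P L s * marginal X P (insert v U) s) :
    marginal X P (insert v L) s = marginal X P L s * condWeight X P s₀ U v s := by
  by_cases h0 : marginal X P U s = 0
  · have hL : marginal X P L s = 0 := le_antisymm (h0 ▸ marginal_anti hUL s) zero_le
    rw [hL, zero_mul]
    exact le_antisymm (hL ▸ marginal_anti (Set.subset_insert v L) s) zero_le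
  · rw [condWeight, if_neg h0, ← mul_div_assoc, ← h, mul_div_cancel_right₀ _ h0]

end Marginal

/-- The chain rule for a weight satisfying the ordered local Markov property. -/
theorem eq_prod_condWeight {V : Type*} [Fintype V] [LinearOrder V] {β : Type*}
    {X : V → Finset β} {P : (V → β) → ℝ≥0} {U : V → Set V} (s₀ : V → β)
    (hU : ∀ v, U v ⊆ Set.Iio v) (hsum : ∑ t ∈ Fintype.piFinset X, P t = 1)
    (h : ∀ v s, marginal X P (insert v (Set.Iio v)) s * marginal X P (U v) s =
      marginal X P (Set.Iio v) s * marginal X P (insert v (U v)) s)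
    {s : V → β} (hs : s ∈ Fintype.piFinset X) :
    P s = ∏ v, condWeight X P s₀ (U v) v s := by
  -- The chain rule is proved for initial segments, adding one maximal vertex at a time. The empty
  -- segment contributes the total weight 1, and the segment of all vertices fixes the whole
  -- assignment.
  suffices key : ∀ S : Finset V, IsLowerSet (S : Set V) →
      marginal X P S s = ∏ v ∈ S, condWeight X P s₀ (U v) v s by
    have := key Finset.univ (by simpa using isLowerSet_univ)
    rwa [marginal_of_forall_mem (fun v => Finset.mem_coe.2 (Finset.mem_univ v)) hs] at this
  intro S
  induction S using Finset.induction_on_max with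
  | empty =>
    intro _
    rw [Finset.coe_empty, marginal_empty, hsum, Finset.prod_empty]
  | insert a S ha ih =>
    intro hlow
    -- All of `S` lies below `a` and the enlarged set is downward closed, so `S` consists of all
    -- predecessors of `a`, as the Markov hypothesis requires.
    have hS : (S : Set V) = Set.Iio a := by
      ext x
      refine ⟨fun hx => ha x hx, fun hx => ?_⟩
      have hx' := hlow (le_of_lt hx) (Finset.mem_coe.2 (Finset.mem_insert_self a S))
      exact (Finset.mem_insert.1 (Finset.mem_coe.1 hx')).resolve_left (ne_of_lt hx)
    rw [Finset.prod_insert fun h => lt_irrefl _ (ha a h), Finset.coe_insert, hS,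
      marginal_insert_eq_mul_condWeight s₀ (hU a) (h a s), ← hS,
      ih (hS ▸ isLowerSet_Iio a), mul_comm]

/-! ### Upper components, the ordered Markov property and functoriality of the triangulation. -/

namespace OUGr

variable (H : OUGr.{w})

/-- The vertices reachable from `v` through vertices that are at least `v`. -/
def upperComponent (v : H.V) : Set H.V :=
  {u | Relation.ReflTransGen (fun a b => H.graph.Adj a b ∧ v ≤ b) v u}

variable {H}

theorem le_of_mem_upperComponent {v u : H.V} (h : u ∈ H.upperComponent v) : v ≤ u := by
  rcases Relation.ReflTransGen.cases_tail h with h | ⟨_, _, h⟩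
  · exact h.ge
  · exact h.2

/-- Paths can be reversed although the bound is imposed on the target of each step: the source of
each step is also at least `v`, being either `v` itself or the target of an earlier step. -/
theorem reachable_of_mem_upperComponent {v u : H.V} (h : u ∈ H.upperComponent v) :
    Relation.ReflTransGen (fun a b => H.graph.Adj a b ∧ v ≤ b) u v := by
  change Relation.ReflTransGen _ v u at h
  induction h with
  | refl => exact .refl
  | tail hb hbc ih => exact .head ⟨hbc.1.symm, le_of_mem_upperComponent hb⟩ ih

/-- A neighbour of the upper component of `v` lies in it or is a parent of `v` in the
triangulation. -/
theorem mem_upperComponent_or_edge {v k u : H.V} (hk : k ∈ H.upperComponent v)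
    (h : H.graph.Adj k u) : u ∈ H.upperComponent v ∨ H.triangulation.edge u v := by
  rcases le_or_gt v u with hu | hu
  · exact Or.inl (Relation.ReflTransGen.tail hk ⟨h, hu⟩)
  -- A smaller neighbour `u` steps to `k` and then follows the reversed path back to `v`; every
  -- vertex after `u` is at least `v`, which is the condition for an edge of the triangulation.
  · exact Or.inr ⟨hu, Relation.TransGen.head' ⟨h.symm, le_of_mem_upperComponent hk⟩
      (reachable_of_mem_upperComponent hk)⟩

/-- A weight that is a product of functions of the cliques factorizes over the triangulation. -/
theorem eq_prod_condWeight_triangulation {β : Type*} {X : H.V → Finset β}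
    {P : (H.V → β) → ℝ≥0} {c : ℝ≥0} {φ : H.Clique → (H.V → β) → ℝ≥0}
    (hφ : ∀ C s t, (∀ v ∈ C.1, s v = t v) → φ C s = φ C t)
    (hP : ∀ s ∈ Fintype.piFinset X, P s = c * ∏ C, φ C s)
    (hsum : ∑ t ∈ Fintype.piFinset X, P t = 1) (s₀ : H.V → β)
    {s : H.V → β} (hs : s ∈ Fintype.piFinset X) :
    P s = ∏ v, condWeight X P s₀ {u | H.triangulation.edge u v} v s := by
  classical
  refine eq_prod_condWeight s₀ (fun v u hu => hu.1) hsum (fun v s => ?_) hs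
  let K := H.upperComponent v
  let meets : H.Clique → Prop := fun C => ∃ k ∈ C.1, k ∈ K
  -- The cliques are split by whether they meet the upper component of `v`; the constant goes with
  -- the first group.
  refine marginal_insert_mul (K := K)
    (f := fun s => c * ∏ C with meets C, φ C s) (g := fun s => ∏ C with ¬ meets C, φ C s)
    (fun s hs => ?_) (fun s t hst => ?_) (fun s t hst => ?_) (fun u hu => hu.1) ?_ .refl s
  · rw [hP s hs, mul_assoc, Finset.prod_filter_mul_prod_filter_not]
  · refine congrArg (c * ·) (Finset.prod_congr rfl fun C hC => hφ C s t fun u hu => hst u ?_)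
    obtain ⟨k, hkC, hk⟩ := (Finset.mem_filter.1 hC).2
    rcases eq_or_ne k u with rfl | hne
    · exact Or.inl hk
    -- Any other member of a clique containing `k ∈ K` is a neighbour of `k`, so the clique lies in
    -- `K` together with the parents of `v`.
    · exact mem_upperComponent_or_edge hk (C.2.2 hkC hu hne)
  · refine Finset.prod_congr rfl fun C hC => hφ C s t fun u hu => hst u fun huK => ?_
    exact (Finset.mem_filter.1 hC).2 ⟨u, hu, huK⟩
  · exact Set.disjoint_left.2 fun u hu huK => (le_of_mem_upperComponent huK).not_gt hu

/-- A morphism of ordered undirected graphs is a morphism of the triangulations. -/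
def Hom.triangulation {H' : OUGr.{w}} (α : H ⟶ H') : H.triangulation ⟶ H'.triangulation :=
  ODAG.Hom.mk (OUGr.Hom.toFun α) (OUGr.Hom.map_le α) fun {v w : H.V} h => by
    -- If the ends of the edge are identified, it is collapsed, which is allowed. Otherwise the
    -- image path is the witness.
    rcases (OUGr.Hom.map_le α h.1.le).eq_or_lt with heq | hlt
    · exact Or.inl heq
    · refine Or.inr ⟨hlt, ?_⟩
      have hpath : Relation.ReflTransGen
          (fun a b => H'.graph.Adj a b ∧ OUGr.Hom.toFun α w ≤ b)
          (OUGr.Hom.toFun α v) (OUGr.Hom.toFun α w) := by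
        -- Single edges of the path may collapse, so a priori the image is only a path of length at
        -- least zero; distinctness of its ends makes it nontrivial afterwards. Monotonicity
        -- preserves the lower bound.
        refine Relation.ReflTransGen.lift' (OUGr.Hom.toFun α) (fun a b hab => ?_) v w
          h.2.to_reflTransGen
        rcases OUGr.Hom.map_adj α hab.1 with heq | hadj
        · change Relation.ReflTransGen _ (OUGr.Hom.toFun α a) (OUGr.Hom.toFun α b)
          rw [heq]
        · exact .single ⟨hadj, OUGr.Hom.map_le α hab.2⟩
      exact (Relation.reflTransGen_iff_eq_or_transGen.1 hpath).resolve_left hlt.ne'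

end OUGr

/-! ### Locality and normalisation of conditional weights. -/

section Conditional

variable {V : Type*} [Fintype V] [DecidableEq V] {β : Type*}
  {X : V → Finset β} {P : (V → β) → ℝ≥0}

theorem marginal_congr {U : Set V} {s t : V → β} (h : ∀ u ∈ U, s u = t u) :
    marginal X P U s = marginal X P U t := by
  classical
  refine Finset.sum_congr (Finset.filter_congr fun r _ => ?_) fun _ _ => rfl
  exact forall₂_congr fun u hu => by rw [h u hu]

/-- Needed to turn the conditional weight, defined on full assignments, into a matrix indexed by the
values at `U` and `v` alone. -/
theorem condWeight_congr {s₀ : V → β} {U : Set V} {v : V} {s t : V → β}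
    (h : ∀ u ∈ insert v U, s u = t u) :
    condWeight X P s₀ U v s = condWeight X P s₀ U v t := by
  rw [condWeight, condWeight, marginal_congr h,
    marginal_congr fun u hu => h u (Set.mem_insert_of_mem v hu), h v (Set.mem_insert v U)]

/-- The assignments agreeing with `s` on `U` are grouped by their value at `v`; since `v ∉ U`,
changing `s` at `v` does not affect the condition. -/
theorem sum_marginal_update {U : Set V} {v : V} (hv : v ∉ U) (s : V → β) :
    ∑ y ∈ X v, marginal X P (insert v U) (Function.update s v y) = marginal X P U s := by
  classical
  rw [marginal, ← Finset.sum_fiberwise_of_maps_to (t := X v) (g := fun t : V → β => t v)]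
  · refine Finset.sum_congr rfl fun y _ => ?_
    rw [marginal, Finset.filter_filter]
    refine Finset.sum_congr (Finset.ext fun t => ?_) fun _ _ => rfl
    simp only [Finset.mem_filter, Set.forall_mem_insert, Function.update_self]
    rw [and_comm (a := t v = y)]
    refine and_congr_right' (and_congr_left' (forall₂_congr fun u hu => ?_))
    rw [Function.update_of_ne (ne_of_mem_of_not_mem hu hv)]
  · intro t ht
    rw [Finset.mem_filter, Fintype.mem_piFinset] at ht
    exact ht.1 v

/-- This is the stochasticity of the conditional. The point mass at `s₀ v` supplies the total 1 when
the condition has weight zero, which is why `s₀ v` has to be an admissible value. -/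
theorem sum_condWeight_update {s₀ : V → β} {U : Set V} {v : V} (hv : v ∉ U)
    (h₀ : s₀ v ∈ X v) (s : V → β) :
    ∑ y ∈ X v, condWeight X P s₀ U v (Function.update s v y) = 1 := by
  classical
  have hU (y) : marginal X P U (Function.update s v y) = marginal X P U s :=
    marginal_congr fun u hu => Function.update_of_ne (ne_of_mem_of_not_mem hu hv) _ _
  by_cases h : marginal X P U s = 0
  · simp [condWeight, hU, h, h₀]
  · simp only [condWeight, hU, if_neg h]
    rw [← Finset.sum_div, sum_marginal_update hv, div_self h]

end Conditional

open MatObj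

variable {A : Type u}

/-! ### Stochastic matrices with prescribed entries -/

namespace CDFunctor

variable {S : Signature.{w}} {d : Doctrine} (Ψ : CDFunctor (Free S d) (Mat A))

/-- A conditional weight gives a stochastic matrix. -/
theorem exists_stochastic_entry_eq [DecidableEq S.Ob] {s₀ : S.Ob → List A}
    (hs₀ : ∀ a, s₀ a ∈ Ψ.states a) {l : List S.Ob} (hl : l.Nodup) {v : S.Ob} (hv : v ∉ l)
    {W : (S.Ob → List A) → ℝ≥0} (hW : ∀ s t, (∀ u, u = v ∨ u ∈ l → s u = t u) → W s = W t)
    (hsum : ∀ s, ∑ y ∈ Ψ.states v, W (Function.update s v y) = 1) :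
    ∃ f : Ψ.obj ⟨l⟩ ⟶ Ψ.obj ⟨[v]⟩, stochastic A f ∧
      ∀ s : S.Ob → List A, (∀ a, s a ∈ Ψ.states a) →
        MatHom.entry f (s v) (l.flatMap s) = W s := by
  classical
  -- Each input word is decoded to some full assignment. Its values outside `l` are arbitrary, but
  -- `W` depends only on `v` and `l`, so the entry at a word coming from `s` does not depend on the
  -- choice.
  choose dec hdec hdec' using fun x (hx : x ∈ Ψ.words l) => Ψ.exists_flatMap_eq hs₀ hl hx
  let f : MatHom (Ψ.obj ⟨l⟩) (Ψ.obj ⟨[v]⟩) :=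
    { entry := fun y x => if h : y ∈ Ψ.states v ∧ x ∈ Ψ.words l then
        W (Function.update (dec x h.2) v y) else 0
      entry_eq_zero := fun y x h => dif_neg h }
  refine ⟨f, fun x hx => ?_, fun s hs => ?_⟩
  · rw [← hsum (dec x hx)]
    exact Finset.sum_congr rfl fun y hy => dif_pos ⟨hy, hx⟩
  · have hx := Ψ.flatMap_mem_words hs l
    refine (dif_pos ⟨hs v, hx⟩).trans (hW _ _ fun u hu => ?_)
    rcases eq_or_ne u v with rfl | hne
    · exact Function.update_self _ _ _
    · rw [Function.update_of_ne hne]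
      exact (Ψ.flatMap_eq_flatMap_iff (hdec _ hx) hs l).1 (hdec' _ hx) u (hu.resolve_left hne)

/-- The words of a product are determined by the values of the generating objects. -/
theorem wordObj_stoch_obj (l : List S.Ob) :
    (wordObj (fun a => (⟨Ψ.obj ⟨[a]⟩⟩ : FinStoch A)) l).obj = Ψ.obj ⟨l⟩ := by
  induction l with
  | nil => exact Ψ.obj_unit.symm
  | cons a l ih =>
    exact (congrArg (Ψ.obj ⟨[a]⟩ ⊗ ·) ih).trans (Ψ.obj_tensor ⟨[a]⟩ ⟨l⟩).symm

/-- The sum over the words with pairwise distinct letters that list all generating objects. -/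
theorem sum_words [Fintype S.Ob] [DecidableEq S.Ob] {s₀ : S.Ob → List A}
    (hs₀ : ∀ a, s₀ a ∈ Ψ.states a) {l : List S.Ob} (hl : l.Nodup) (hmem : ∀ a, a ∈ l)
    (f : List A → ℝ≥0) :
    ∑ t ∈ Fintype.piFinset Ψ.states, f (l.flatMap t) = ∑ x ∈ Ψ.words l, f x := by
  refine Finset.sum_nbij (fun t => l.flatMap t) (fun t ht => ?_) (fun t ht t' ht' h => ?_)
    (fun x hx => ?_) fun _ _ => rfl
  · exact Ψ.flatMap_mem_words (Fintype.mem_piFinset.1 ht) l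
  · exact funext fun a => (Ψ.flatMap_eq_flatMap_iff (Fintype.mem_piFinset.1 ht)
      (Fintype.mem_piFinset.1 ht') l).1 h a (hmem a)
  · obtain ⟨t, ht, h⟩ := Ψ.exists_flatMap_eq hs₀ hl hx
    exact ⟨t, Fintype.mem_piFinset.2 ht, h⟩

end CDFunctor

namespace FinStoch

theorem exists_hom_entry_eq {X Y : FinStoch A} {X' Y' : MatObj A} (hX : X.obj = X')
    (hY : Y.obj = Y') {f : X' ⟶ Y'} (hf : stochastic A f) :
    ∃ g : X ⟶ Y, MatHom.entry g.hom = MatHom.entry f := by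
  subst hX hY
  exact ⟨⟨f, hf⟩, rfl⟩

theorem heq_of_entry {X Y X' Y' : FinStoch A} {f : X ⟶ Y} {g : X' ⟶ Y'} (hX : X = X')
    (hY : Y = Y') (h : MatHom.entry f.hom = MatHom.entry g.hom) : HEq f g := by
  subst hX hY
  exact heq_of_eq (WideSubcategory.hom_ext _ (MatHom.ext h))

end FinStoch

/-- Proportionality is already a congruence, so the quotient identifies no further matrices. -/
theorem proportional_of_heq {X Y X' Y' : MatObj A} {f : X ⟶ Y} {g : X' ⟶ Y'} (hX : X = X')
    (hY : Y = Y') (h : HEq ((quotFunctor A).map f) ((quotFunctor A).map g)) :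
    ∃ c : ℝ≥0, 0 < c ∧ ∀ y x, c * MatHom.entry f y x = MatHom.entry g y x := by
  subst hX hY
  exact (CategoryTheory.Quotient.functor_map_eq_iff _ _ _).1 (eq_of_heq h)

/-! ### From Markov networks to Bayesian networks -/

namespace ODAG

variable {G : ODAG.{w}}

theorem mem_parents {u v : G.V} : u ∈ G.parents v ↔ G.edge u v := by
  simp [parents]

variable (G)

theorem mem_verts (v : G.V) : v ∈ G.verts := (Finset.mem_sort _).2 (Finset.mem_univ v)

theorem nodup_verts : G.verts.Nodup := Finset.sort_nodup _ _

theorem nodup_parents (v : G.V) : (G.parents v).Nodup := Finset.sort_nodup _ _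

end ODAG

section Factorization

variable {ω : CDFunctor CDSynPoint (FinStoch A)} {H : OUGr.{w}} {Φ : HypFunctor (Syn H) (Mat A)}
  (hω : ω.toFunctor ⋙ stochFunctor A =
    star.toFunctor ⋙ H.bang.toFunctor ⋙ Φ.toFunctor ⋙ quotFunctor A)
include hω

theorem obj_pt_eq : (ω.obj CDSynPoint.pt).obj = Φ.obj ⟨H.verts⟩ := by
  have h : (ω.obj CDSynPoint.pt).obj = Φ.obj ⟨H.verts ++ []⟩ :=
    congrArg CategoryTheory.Quotient.as (Functor.congr_obj hω CDSynPoint.pt)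
  -- The generating object is a word of length one, so its image is the list of vertices followed by
  -- the empty word.
  rw [h, List.append_nil]

/-- Equality in $\mathsf{FinProjStoch}$ determines the state only up to a positive factor. As the
state has total weight 1, `c` is the partition function, the total of the product of the potentials.
-/
theorem exists_mul_state_entry_eq :
    ∃ c : ℝ≥0, 0 < c ∧ ∀ y x, c * MatHom.entry (ω.map CDSynPoint.state).hom y x =
      Φ.entry H.compareComp y x := by
  have h : HEq ((quotFunctor A).map (ω.map CDSynPoint.state).hom)
      ((quotFunctor A).map (Φ.map (H.bang.map (star.map CDSynPoint.state)))) := by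
    have := Functor.hcongr_hom hω CDSynPoint.state
    exact this
  obtain ⟨c, hc, hc'⟩ := proportional_of_heq
    (congrArg CategoryTheory.Quotient.as (Functor.congr_obj hω (𝟙_ CDSynPoint)))
    (congrArg CategoryTheory.Quotient.as (Functor.congr_obj hω CDSynPoint.pt)) h
  refine ⟨c, hc, fun y x => (hc' y x).trans ?_⟩
  exact congrFun (congrFun (Φ.entry_comp_eqTo H.compareComp (List.append_nil H.verts).symm) y) x

/-- The source of the state is the unit, whose only word is empty, so stochasticity concerns this
one column. -/
theorem sum_state_entry :
    ∑ y ∈ Φ.words H.verts, MatHom.entry (ω.map CDSynPoint.state).hom y [] = 1 := by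
  have h : ([] : List A) ∈ (ω.obj (𝟙_ CDSynPoint)).obj.carrier := by
    rw [ω.obj_unit]
    exact mem_unit.2 rfl
  have := (ω.map CDSynPoint.state).property [] h
  rwa [← show Φ.words H.verts = _ from congrArg MatObj.carrier (obj_pt_eq hω).symm] at this

/-- The factorising functor keeps the value sets of the vertices given by `Φ` and sends each
generator to the conditional distribution of its vertex given its parents in the triangulation. -/
theorem factors_triangulation : ∃ F : CDFunctor (CDSyn H.triangulation) (FinStoch A),
    ω.toFunctor = H.triangulation.bang.toFunctor ⋙ F.toFunctor := by
  classical
  let P : (H.V → List A) → ℝ≥0 := fun s =>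
    MatHom.entry (ω.map CDSynPoint.state).hom (H.verts.flatMap s) []
  have mem_verts : ∀ v, v ∈ H.verts := H.triangulation.mem_verts
  have nodup_verts : H.verts.Nodup := H.triangulation.nodup_verts
  -- Total weight 1 excludes an empty set of joint values. Hence every vertex has a value, and the
  -- default assignment `s₀` exists.
  have hne : (Φ.words H.verts).Nonempty :=
    Finset.nonempty_of_sum_ne_zero (ne_of_eq_of_ne (sum_state_entry hω) one_ne_zero)
  choose s₀ hs₀ using fun v : H.V => Φ.states_nonempty_of_words hne (mem_verts v)
  have hsum : ∑ t ∈ Fintype.piFinset Φ.states, P t = 1 :=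
    (Φ.sum_words hs₀ nodup_verts mem_verts _).trans (sum_state_entry hω)
  let φ : H.Clique → (H.V → List A) → ℝ≥0 := fun C s =>
    Φ.entry (Term.gen (S := H.sig) C) ((C.1.sort (· ≤ ·)).flatMap s) []
  have hφ (C : H.Clique) (s t : H.V → List A) (h : ∀ v ∈ C.1, s v = t v) : φ C s = φ C t := by
    refine congrArg (fun x => Φ.entry (Term.gen (S := H.sig) C) x []) ?_
    exact List.flatMap_congr fun v hv => h v ((Finset.mem_sort _).1 hv)
  obtain ⟨c, hc, hc'⟩ := exists_mul_state_entry_eq hω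
  have hP (s) (hs : s ∈ Fintype.piFinset Φ.states) : P s = c⁻¹ * ∏ C, φ C s := by
    rw [eq_inv_mul_iff_mul_eq₀ hc.ne']
    exact (hc' _ _).trans (HypFunctor.entry_compareComp (Fintype.mem_piFinset.1 hs))
  have key {s} (hs : s ∈ Fintype.piFinset Φ.states) :=
    OUGr.eq_prod_condWeight_triangulation hφ hP hsum s₀ hs
  let o : H.V → FinStoch A := fun v => ⟨Φ.obj ⟨[v]⟩⟩
  have hκ (v : H.V) : ∃ f : wordObj o (H.triangulation.parents v) ⟶ wordObj o [v],
      ∀ s : H.V → List A, (∀ a, s a ∈ Φ.states a) →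
        MatHom.entry f.hom (s v) ((H.triangulation.parents v).flatMap s) =
          condWeight Φ.states P s₀ {u | H.triangulation.edge u v} v s := by
    obtain ⟨f, hf, hf'⟩ := Φ.exists_stochastic_entry_eq hs₀
      (l := H.triangulation.parents v) (v := v)
      (W := condWeight Φ.states P s₀ {u | H.triangulation.edge u v} v)
      (ODAG.nodup_parents _ _) (fun h => lt_irrefl _ (ODAG.mem_parents.1 h).1)
      (fun s t h => condWeight_congr fun u hu => h u (hu.imp_right ODAG.mem_parents.2))
      (fun s => sum_condWeight_update (fun h => lt_irrefl _ h.1) (hs₀ v) s)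
    obtain ⟨g, hg⟩ := FinStoch.exists_hom_entry_eq
      (Φ.wordObj_stoch_obj (H.triangulation.parents v)) (Φ.wordObj_stoch_obj [v]) hf
    exact ⟨g, fun s hs => by rw [hg, hf' s hs]⟩
  choose κ hκ' using hκ
  let F : CDFunctor (CDSyn H.triangulation) (FinStoch A) :=
    liftCD (S := H.triangulation.sig) o κ
  -- The entry formula for copy-composition lives in `Mat A`, so `F` is viewed there.
  let Ψ : CDFunctor (CDSyn H.triangulation) (Mat A) := F.comp (stochInclusion A)
  have hstates (v : H.V) : Ψ.states v = Φ.states v :=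
    congrArg MatObj.carrier (Φ.wordObj_stoch_obj [v])
  refine ⟨F, ω.ext_of_free (H.triangulation.bang.comp F) ?_ ?_⟩
  · rintro ⟨⟩
    refine WideSubcategory.ext ?_
    refine (obj_pt_eq hω).trans ((Φ.wordObj_stoch_obj H.verts).symm.trans ?_)
    exact congrArg (fun l => (wordObj o l).obj) (List.append_nil H.verts).symm
  · rintro ⟨⟩
    have hpt : (ω.obj CDSynPoint.pt).obj.carrier = Φ.words H.verts :=
      congrArg MatObj.carrier (obj_pt_eq hω)
    have hwords : Ψ.words H.verts = Φ.words H.verts :=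
      congrArg MatObj.carrier (Φ.wordObj_stoch_obj H.verts)
    have hbang : MatHom.entry ((H.triangulation.bang.comp F).map CDSynPoint.state).hom =
        Ψ.entry H.triangulation.copyComp :=
      Ψ.entry_comp_eqTo H.triangulation.copyComp (List.append_nil H.verts).symm
    refine FinStoch.heq_of_entry ω.obj_unit ?_
      (Eq.trans (funext fun y => funext fun x => ?_) hbang.symm)
    · refine WideSubcategory.ext ?_
      refine (obj_pt_eq hω).trans ((Φ.wordObj_stoch_obj H.verts).symm.trans ?_)
      exact congrArg (fun l => (wordObj o l).obj) (List.append_nil H.verts).symm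
    -- Outside the admissible words both matrices vanish by convention; inside, the entry comes from
    -- an assignment, where the factorisation of `P` and the product formula for copy-composition
    -- meet.
    · by_cases hy : y ∈ Φ.words H.verts
      · by_cases hx : x = []
        · subst hx
          obtain ⟨s, hs, rfl⟩ := Φ.exists_flatMap_eq hs₀ nodup_verts hy
          refine (key (Fintype.mem_piFinset.2 hs)).trans (Eq.symm ?_)
          refine (Ψ.entry_copyComp fun v => (hstates v).symm ▸ hs v).trans ?_
          exact Finset.prod_congr rfl fun v _ => hκ' v s hs
        · refine Eq.trans ?_ (Ψ.entry_eq_zero_right _ (mt Ψ.mem_words_nil.1 hx)).symm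
          refine MatHom.entry_eq_zero _ _ _ fun h => hx (mem_unit.1 ?_)
          have := h.2
          rwa [show ω.obj ⟨[]⟩ = 𝟙_ _ from ω.obj_unit] at this
      · exact (MatHom.entry_eq_zero _ _ _ fun h => hy (hpt ▸ h.1)).trans
          (Ψ.entry_eq_zero_left _ (hwords ▸ hy)).symm

end Factorization

/-- The Bayesian network on the triangulation of the graph of a Markov network. -/
noncomputable def MN.toBN (M : MN.{u, w} A) : BN.{u, w} A where
  dist := M.dist
  graph := M.graph.triangulation
  factors := factors_triangulation M.factors.choose_spec

/-- The triangulation functor. -/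
noncomputable def triangulationFunctor (A : Type u) : MN.{u, w} A ⥤ BN.{u, w} A where
  obj := MN.toBN
  -- The underlying vertex map and the transformation are untouched, so identities and composites
  -- are preserved on the nose.
  map f := BN.Hom.mk (OUGr.Hom.triangulation (MN.Hom.graphHom f)) (MN.Hom.trans f)

end PGM

/-- The types of the vertex map and of the transformation depend on `T.obj`, so that they are
unchanged is expressed by heterogeneous equality; for the triangulation functor these types coincide
by definition. -/
theorem theorem5p4 (A : Type u) :
    ∃ T : PGM.MN.{u, w} A ⥤ PGM.BN.{u, w} A,
      (∀ M : PGM.MN.{u, w} A,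
        (T.obj M).dist = M.dist ∧ (T.obj M).graph = M.graph.triangulation) ∧
      ∀ {M N : PGM.MN.{u, w} A} (f : M ⟶ N),
        HEq (T.map f).graphHom.toFun f.graphHom.toFun ∧ HEq (T.map f).trans f.trans :=
  ⟨PGM.triangulationFunctor A, fun _ => ⟨rfl, rfl⟩, fun _ => ⟨HEq.rfl, HEq.rfl⟩⟩
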